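/- Let $k$ be a field and let $s,r\ge 4$. Let $\tilde Q=\tilde Q(s,r)$ be the McKay quiver of the group $G(s,r)\cong \mathbb Z/s\mathbb Z\times\mathbb Z/r\mathbb Z$ embedded in $\mathrm{SL}(3,\mathbb C)$ by $(\xi_s^{m},\xi_r^{n})\mapsto \mathrm{diag}(\xi_s^{m},\xi_r^{n},\xi_s^{-m}\xi_r^{-n})$, where $\xi_s,\xi_r$ are primitive $s$-th and $r$-th roots of unity. Explicitly, its vertex set is $\tilde Q_0=\mathbb Z/s\mathbb Z\times \mathbb Z/r\mathbb Z$ and, with $e_1=(1,0)$, $e_2=(0,1)$, $e=e_1+e_2$, its arrows are $\alpha_i:i\to i+e_1$, $\beta_i:i\to i+e_2$, $\gamma_i:i\to i-e$, one of each for every $i\in\tilde Q_0$. Paths are composed from right to left. Let $I$ be a two-sided ideal of the path algebra $k\tilde Q$ that is homogeneous for the grading by the length of paths and is contained in the span of the paths of length $\ge 2$, and give $\Lambda=k\tilde Q/I$ the induced grading $\Lambda=\bigoplus_{t\ge0}\Lambda_t$. Suppose that $\Lambda$ is a (stable) $2$-translation algebra, that is, $\Lambda$ is self-injective and, for some $q$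 with $2\le q\le\infty$, it is $(3,q)$-Koszul: $\Lambda_t=0$ for $t>3$, and the left module $\Lambda_0$ has a graded projective resolution $\cdots\to P^1\xrightarrow{f_1}P^0\xrightarrow{f_0}\Lambda_0\to0$ such that $P^t$ is generated by its degree $t$ part for all (finite) $t\le q$ and, if $q<\infty$, $\ker f_q$ is concentrated in degree $q+3$. Then there are nonzero scalars $a_i,b_i,c_i\in k$ $(i\in\tilde Q_0)$ such that $I$ is generated, as a two-sided ideal, by the commutativity relations $$z(\alpha,i,a_i)=a_i\,\beta_{i-e}\gamma_i+\gamma_{i+e_2}\beta_i,\qquad z(\beta,i,b_i)=b_i\,\alpha_{i-e}\gamma_i+\gamma_{i+e_1}\alpha_i,\qquad z(\gamma,i,c_i)=c_i\,\beta_{i+e_1}\alpha_i+\alpha_{i+e_2}\beta_i$$ together with the zero relations $\alpha_{i+e_1}\alpha_i$, $\beta_{i+e_2}\beta_i$, $\gamma_{i-e}\gamma_i$, for all $i\in\tilde Q_0$. -/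

import Mathlib

universe u

noncomputable section

/-! ### The path algebra of a quiver with finitely many vertices -/

/-- The underlying space of the path algebra `kQ`: formal `k`-linear combinations of all paths. -/
def PathAlgebra (k : Type u) (V : Type) [Field k] [Quiver.{0} V] : Type u :=
  (Σ a b : V, Quiver.Path a b) →₀ k

namespace PathAlgebra

variable {k : Type u} {V : Type} [Field k] [Quiver.{0} V]

instance : AddCommGroup (PathAlgebra k V) :=
  inferInstanceAs (AddCommGroup ((Σ a b : V, Quiver.Path a b) →₀ k))

instance : Module k (PathAlgebra k V) :=
  inferInstanceAs (Module k ((Σ a b : V, Quiver.Path a b) →₀ k))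

variable (k V) in
/-- An element of `kQ` as a finitely supported family of coefficients. -/
def toFinsupp : PathAlgebra k V ≃ₗ[k] ((Σ a b : V, Quiver.Path a b) →₀ k) :=
  LinearEquiv.refl k ((Σ a b : V, Quiver.Path a b) →₀ k)

/-- The basis element of `kQ` given by a path `p` from `a` to `b`. -/
def ofPath {a b : V} (p : Quiver.Path a b) : PathAlgebra k V :=
  (toFinsupp k V).symm (Finsupp.single ⟨a, b, p⟩ 1)

/-- The coefficient of the path `p` in the element `x` of `kQ`. -/
def coeff (x : PathAlgebra k V) {a b : V} (p : Quiver.Path a b) : k :=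
  toFinsupp k V x ⟨a, b, p⟩

/-- The homogeneous component of degree `n` of an element of `kQ`, for the grading by the length
of paths. -/
def component (n : ℕ) (x : PathAlgebra k V) : PathAlgebra k V :=
  (toFinsupp k V).symm (Finsupp.filter (fun p => p.2.2.length = n) (toFinsupp k V x))

variable (k V) in
/-- `kQ_n`, the space spanned by the paths of length `n`. -/
def lengthPart (n : ℕ) : Submodule k (PathAlgebra k V) :=
  Submodule.span k {x | ∃ (a b : V) (p : Quiver.Path a b), p.length = n ∧ x = ofPath p}

theorem induction {P : PathAlgebra k V → Prop} (x : PathAlgebra k V) (h0 : P 0)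
    (hadd : ∀ x y, P x → P y → P (x + y))
    (hs : ∀ (c : k) {a b : V} (p : Quiver.Path a b), P (c • ofPath p)) : P x := by
  obtain ⟨f, rfl⟩ := (toFinsupp k V).symm.surjective x
  induction f using Finsupp.induction_linear with
  | zero => simpa using h0
  | add f g hf hg => simpa using hadd _ _ hf hg
  | single p c =>
    obtain ⟨a, b, p⟩ := p
    have := hs c p
    rwa [ofPath, ← map_smul, Finsupp.smul_single, smul_eq_mul, mul_one] at this

instance [Fintype V] : One (PathAlgebra k V) := ⟨∑ v : V, ofPath (Quiver.Path.nil : Quiver.Path v v)⟩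

theorem one_def [Fintype V] :
    (1 : PathAlgebra k V) = ∑ v : V, ofPath (Quiver.Path.nil : Quiver.Path v v) := rfl

variable [DecidableEq V]

variable (k) in
/-- The product of two paths, written like a composition of maps: `p * q` is the path
`q` followed by `p` if `q` ends where `p` starts, and it is zero otherwise. -/
def pathMul (p q : Σ a b : V, Quiver.Path a b) : PathAlgebra k V :=
  if h : q.2.1 = p.1 then ofPath ((q.2.2.cast rfl h).comp p.2.2) else 0

variable (k V) in
/-- The bilinear extension of the product of paths. -/
def mulLin : PathAlgebra k V →ₗ[k] PathAlgebra k V →ₗ[k] PathAlgebra k V :=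
  Finsupp.lift _ k (Σ a b : V, Quiver.Path a b) (fun p =>
    Finsupp.lift _ k (Σ a b : V, Quiver.Path a b) (fun q => pathMul k p q) ∘ₗ
      (toFinsupp k V).toLinearMap) ∘ₗ (toFinsupp k V).toLinearMap

instance : Mul (PathAlgebra k V) := ⟨fun x y => mulLin k V x y⟩

theorem mul_def (x y : PathAlgebra k V) : x * y = mulLin k V x y := rfl

theorem ofPath_mul_ofPath {a b b' c : V} (p : Quiver.Path b c) (q : Quiver.Path a b') :
    (ofPath p * ofPath q : PathAlgebra k V) =
      if h : b' = b then ofPath ((q.cast rfl h).comp p) else 0 := by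
  simp [mul_def, mulLin, ofPath, pathMul]

theorem ofPath_mul_comp {a b c : V} (p : Quiver.Path b c) (q : Quiver.Path a b) :
    (ofPath p * ofPath q : PathAlgebra k V) = ofPath (q.comp p) := by
  rw [ofPath_mul_ofPath]; simp

theorem ofPath_mul_of_ne {a b b' c : V} (h : b' ≠ b) (p : Quiver.Path b c)
    (q : Quiver.Path a b') : (ofPath p * ofPath q : PathAlgebra k V) = 0 := by
  rw [ofPath_mul_ofPath]; simp [h]

theorem add_mul' (x y z : PathAlgebra k V) : (x + y) * z = x * z + y * z := by
  simp [mul_def]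

theorem mul_add' (x y z : PathAlgebra k V) : x * (y + z) = x * y + x * z := by
  simp [mul_def]

theorem smul_mul' (c : k) (x y : PathAlgebra k V) : (c • x) * y = c • (x * y) := by
  simp [mul_def]

theorem mul_smul' (c : k) (x y : PathAlgebra k V) : x * (c • y) = c • (x * y) := by
  simp [mul_def]

theorem zero_mul' (x : PathAlgebra k V) : 0 * x = 0 := by
  simp [mul_def]

theorem mul_zero' (x : PathAlgebra k V) : x * 0 = 0 := by
  simp [mul_def]

theorem mul_assoc' (x y z : PathAlgebra k V) : x * y * z = x * (y * z) := by
  induction x using induction with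
  | h0 => simp [zero_mul']
  | hadd x₁ x₂ h₁ h₂ => simp [add_mul', h₁, h₂]
  | hs c p =>
  induction y using induction with
  | h0 => simp [zero_mul', mul_zero']
  | hadd x₁ x₂ h₁ h₂ => simp [add_mul', mul_add', h₁, h₂]
  | hs d q =>
  induction z using induction with
  | h0 => simp [mul_zero']
  | hadd x₁ x₂ h₁ h₂ => simp [mul_add', h₁, h₂]
  | hs e w =>
    rename_i a b a₁ b₁ a₂ b₂
    simp only [smul_mul', mul_smul']
    by_cases h₁ : b₁ = a
    · subst h₁
      by_cases h₂ : b₂ = a₁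
      · subst h₂
        simp [ofPath_mul_comp]
      · rw [ofPath_mul_comp, ofPath_mul_of_ne h₂, ofPath_mul_of_ne h₂]
        simp [mul_zero']
    · rw [ofPath_mul_of_ne h₁]
      by_cases h₂ : b₂ = a₁
      · subst h₂
        rw [ofPath_mul_comp, ofPath_mul_of_ne h₁]
        simp [zero_mul']
      · rw [ofPath_mul_of_ne h₂]
        simp [zero_mul', mul_zero']

variable [Fintype V]

theorem one_mul' (x : PathAlgebra k V) : 1 * x = x := by
  induction x using induction with
  | h0 => simp [mul_zero']
  | hadd x₁ x₂ h₁ h₂ => simp [mul_add', h₁, h₂]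
  | hs c p =>
    rename_i a b
    have h : (1 * ofPath p : PathAlgebra k V) =
        ∑ v : V, ofPath (Quiver.Path.nil : Quiver.Path v v) * ofPath p := by
      rw [one_def, mul_def, map_sum, LinearMap.sum_apply]; rfl
    rw [mul_smul', h, Finset.sum_eq_single b]
    · rw [ofPath_mul_comp]; simp
    · intro v _ hv
      exact ofPath_mul_of_ne (Ne.symm hv) _ _
    · simp

theorem mul_one' (x : PathAlgebra k V) : x * 1 = x := by
  induction x using induction with
  | h0 => simp [zero_mul']
  | hadd x₁ x₂ h₁ h₂ => simp [add_mul', h₁, h₂]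
  | hs c p =>
    rename_i a b
    have h : (ofPath p * 1 : PathAlgebra k V) =
        ∑ v : V, ofPath p * ofPath (Quiver.Path.nil : Quiver.Path v v) := by
      rw [one_def, mul_def, map_sum]; rfl
    rw [smul_mul', h, Finset.sum_eq_single a]
    · rw [ofPath_mul_comp]; simp
    · intro v _ hv
      exact ofPath_mul_of_ne hv _ _
    · simp

instance : Ring (PathAlgebra k V) where
  __ := (inferInstance : AddCommGroup (PathAlgebra k V))
  __ := (inferInstance : Mul (PathAlgebra k V))
  __ := (inferInstance : One (PathAlgebra k V))
  left_distrib := mul_add'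
  right_distrib := add_mul'
  zero_mul := zero_mul'
  mul_zero := mul_zero'
  mul_assoc := mul_assoc'
  one_mul := one_mul'
  mul_one := mul_one'

instance : Algebra k (PathAlgebra k V) := Algebra.ofModule smul_mul' mul_smul'

/-- A (two-sided) ideal of relations: it is homogeneous for the grading by the length of paths, and it only
involves paths of length at least two, so that `Q` is the quiver of `kQ/I`.  Equivalently, `I` is
generated, as a two-sided ideal, by linear combinations of parallel paths of the same length
`≥ 2`. -/
structure IsRelationIdeal (I : Ideal (PathAlgebra k V)) : Prop where
  component_mem : ∀ x ∈ I, ∀ n : ℕ, component n x ∈ I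
  two_le_length : ∀ x ∈ I, ∀ (a b : V) (p : Quiver.Path a b), coeff x p ≠ 0 → 2 ≤ p.length

/-- The grading of `Λ = kQ/I` induced by the length of paths: `Λ_n` is the image of `kQ_n`. -/
def quotientGrading (I : Ideal (PathAlgebra k V)) [I.IsTwoSided] (n : ℕ) :
    Submodule k (PathAlgebra k V ⧸ I) :=
  (lengthPart k V n).map (Ideal.Quotient.mkₐ k I).toLinearMap

end PathAlgebra

/-! ### Graded modules, graded resolutions, `(p,q)`-Koszul and stable `n`-translation algebras -/

section Koszul

variable {k : Type u} [Field k] {R : Type u} [Ring R] [Algebra k R] (𝒜 : ℕ → Submodule k R)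

/-- `ℳ` is a grading of the left `R`-module `M` compatible with the grading `𝒜` of `R`. -/
structure IsModuleGrading {M : Type u} [AddCommGroup M] [Module R M] (ℳ : ℕ → AddSubgroup M) :
    Prop where
  isInternal : DirectSum.IsInternal ℳ
  smul_mem : ∀ (m n : ℕ) (a : R) (x : M), a ∈ 𝒜 m → x ∈ ℳ n → a • x ∈ ℳ (m + n)

/-- A graded projective resolution `⋯ ⟶ P 1 ⟶ P 0 ⟶ M ⟶ 0` of the graded left `R`-module `M`. -/
structure GradedProjectiveResolution (M : Type u) [AddCommGroup M] [Module R M]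
    (ℳ : ℕ → AddSubgroup M) where
  P : ℕ → Type u
  [addCommGroup : ∀ t, AddCommGroup (P t)]
  [module : ∀ t, Module R (P t)]
  gr : ∀ t, ℕ → AddSubgroup (P t)
  isModuleGrading : ∀ t, IsModuleGrading 𝒜 (gr t)
  projective : ∀ t, Module.Projective R (P t)
  /-- the augmentation `f_0` -/
  ε : P 0 →ₗ[R] M
  /-- the differential `f_(t+1)` -/
  d : ∀ t, P (t + 1) →ₗ[R] P t
  ε_mem : ∀ n, ∀ x ∈ gr 0 n, ε x ∈ ℳ n
  d_mem : ∀ t n, ∀ x ∈ gr (t + 1) n, d t x ∈ gr t n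
  ε_surjective : Function.Surjective ε
  exact_zero : Function.Exact (d 0) ε
  exact_succ : ∀ t, Function.Exact (d (t + 1)) (d t)

attribute [instance] GradedProjectiveResolution.addCommGroup GradedProjectiveResolution.module

/-- The kernel of the map `f_t` that starts at `P t`. -/
def GradedProjectiveResolution.ker {𝒜 : ℕ → Submodule k R} {M : Type u} [AddCommGroup M]
    [Module R M] {ℳ : ℕ → AddSubgroup M} (F : GradedProjectiveResolution 𝒜 M ℳ) :
    (t : ℕ) → Submodule R (F.P t)
  | 0 => LinearMap.ker F.ε
  | t + 1 => LinearMap.ker (F.d t)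

/-- The left ideal generated by the elements of positive degree.  For a graded algebra
`R = R_0 + R_1 + ⋯` it is `R_1 + R_2 + ⋯`, and `R ⧸ positivePart` is `R_0` as a left module. -/
def positivePart : Ideal R := Ideal.span {x | ∃ n, 0 < n ∧ x ∈ 𝒜 n}

/-- The grading of a module that is concentrated in degree zero. -/
def degreeZeroGrading (M : Type u) [AddCommGroup M] (n : ℕ) : AddSubgroup M :=
  if n = 0 then ⊤ else ⊥

/-- `R = R_0 + R_1 + ⋯` is `(p,q)`-Koszul: `R_t = 0` for `t > p`, and `R_0` has a graded projective
resolution in which `P t` is generated in degree `t` for all `t ≤ q`, and, if `q` is finite, the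
kernel of `f_q` is concentrated in degree `q + p`. -/
def IsKoszulPQ (p : ℕ) (q : ℕ∞) : Prop :=
  (∀ t, p < t → 𝒜 t = ⊥) ∧
  ∃ F : GradedProjectiveResolution 𝒜 (R ⧸ positivePart 𝒜) (degreeZeroGrading _),
    (∀ t : ℕ, (t : ℕ∞) ≤ q → Submodule.span R (F.gr t t : Set (F.P t)) = ⊤) ∧
    (∀ t : ℕ, (t : ℕ∞) = q → ∀ x ∈ F.ker t, x ∈ F.gr t (t + p))

/-- A stable `n`-translation algebra: self-injective and `(n+1,q)`-Koszul for some `q ≥ 2` or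
`q = ∞`. -/
def IsStableTranslationAlgebra (n : ℕ) : Prop :=
  Module.Injective R R ∧ ∃ q : ℕ∞, 2 ≤ q ∧ IsKoszulPQ 𝒜 (n + 1) q

end Koszul

/-! ### The McKay quiver of `G(s,r)` in `SL(3,ℂ)` -/

/-- The vertex set `ℤ/s × ℤ/r` of the McKay quiver. -/
def McKayVertex (s r : ℕ) : Type := ZMod s × ZMod r

namespace McKayVertex

variable (s r : ℕ)

instance : AddCommGroup (McKayVertex s r) := inferInstanceAs (AddCommGroup (ZMod s × ZMod r))

instance : DecidableEq (McKayVertex s r) := inferInstanceAs (DecidableEq (ZMod s × ZMod r))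

instance [NeZero s] [NeZero r] : Fintype (McKayVertex s r) :=
  inferInstanceAs (Fintype (ZMod s × ZMod r))

/-- `e₁ = (1,0)` -/
def e₁ : McKayVertex s r := ((1 : ZMod s), (0 : ZMod r))

/-- `e₂ = (0,1)` -/
def e₂ : McKayVertex s r := ((0 : ZMod s), (1 : ZMod r))

/-- `e = e₁ + e₂ = (1,1)` -/
def e : McKayVertex s r := e₁ s r + e₂ s r

/-- The three steps `e₁`, `e₂`, `-e` of the arrows. -/
def step : Fin 3 → McKayVertex s r := ![e₁ s r, e₂ s r, -e s r]

variable {s r}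

/-- From every vertex `i` there is one arrow to each of `i + e₁`, `i + e₂` and `i - e`. -/
instance : Quiver.{0} (McKayVertex s r) := ⟨fun i j => {t : Fin 3 // i + step s r t = j}⟩

/-- The arrow `α_i : i ⟶ i + e₁`. -/
def arrowα (i : McKayVertex s r) : i ⟶ i + e₁ s r := ⟨0, rfl⟩

/-- The arrow `β_i : i ⟶ i + e₂`. -/
def arrowβ (i : McKayVertex s r) : i ⟶ i + e₂ s r := ⟨1, rfl⟩

/-- The arrow `γ_i : i ⟶ i - e`. -/
def arrowγ (i : McKayVertex s r) : i ⟶ i - e s r := ⟨2, (sub_eq_add_neg i (e s r)).symm⟩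

end McKayVertex

/-! The following shows that this is the McKay quiver of the group `G(s,r)`, that is, of
`ℤ/s × ℤ/r` embedded in `SL(3,ℂ)` by `g ↦ diag (ξ_s^g₁, ξ_r^g₂, ξ_s^(-g₁) ξ_r^(-g₂))`: the
irreducible representations are the characters `χ_i`, and the number of arrows `i ⟶ j` is the
multiplicity of `χ_j` in `ℂ³ ⊗ χ_i`. -/

namespace McKayGroup

open McKayVertex

variable {s r : ℕ} [NeZero s] [NeZero r]

/-- The character `χ_i` of `ℤ/s × ℤ/r`, with `χ_i(g) = ξ_s^(i₁ g₁) ξ_r^(i₂ g₂)` where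
`ξ_n = exp(2πi/n)`. -/
def char (i : McKayVertex s r) (g : ZMod s × ZMod r) : ℂ :=
  ZMod.stdAddChar (i.1 * g.1) * ZMod.stdAddChar (i.2 * g.2)

/-- The embedding of `ℤ/s × ℤ/r` in `SL(3,ℂ)`. -/
def embed (g : ZMod s × ZMod r) : Matrix (Fin 3) (Fin 3) ℂ :=
  Matrix.diagonal ![ZMod.stdAddChar g.1, ZMod.stdAddChar g.2,
    (ZMod.stdAddChar g.1)⁻¹ * (ZMod.stdAddChar g.2)⁻¹]

theorem det_embed (g : ZMod s × ZMod r) : (embed g).det = 1 := by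
  have h1 : (ZMod.stdAddChar g.1 : ℂ) ≠ 0 := (AddChar.val_isUnit _ _).ne_zero
  have h2 : (ZMod.stdAddChar g.2 : ℂ) ≠ 0 := (AddChar.val_isUnit _ _).ne_zero
  simp [embed, Fin.prod_univ_three]
  field_simp

theorem char_mul_step (i : McKayVertex s r) (t : Fin 3) (g : ZMod s × ZMod r) :
    char i g * embed g t t = char (i + step s r t) g := by
  have key : ∀ a : McKayVertex s r, char (i + a) g = char i g * char a g := by
    intro a
    have h1 : (i + a).1 = i.1 + a.1 := rfl
    have h2 : (i + a).2 = i.2 + a.2 := rfl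
    simp only [char, h1, h2, add_mul, AddChar.map_add_eq_mul]
    ring
  rw [key]
  congr 1
  have e1 : (- e s r).1 = -1 := by
    change -((1 : ZMod s) + 0) = -1
    simp
  have e2 : (- e s r).2 = -1 := by
    change -((0 : ZMod r) + 1) = -1
    simp
  fin_cases t
  · simp [embed, step, char, e₁]
  · simp [embed, step, char, e₂]
  · simp [embed, step, char, e1, e2, AddChar.map_neg_eq_inv]

theorem char_injective {i j : McKayVertex s r} (h : ∀ g, char i g = char j g) : i = j := by
  refine Prod.ext ?_ ?_
  · have := h (1, 0)
    simpa [char, (ZMod.injective_stdAddChar (N := s)).eq_iff] using this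
  · have := h (0, 1)
    simpa [char, (ZMod.injective_stdAddChar (N := r)).eq_iff] using this

/-- The space of `G(s,r)`-equivariant maps `χ_j ⟶ ℂ³ ⊗ χ_i`: a map is given by the image `x` of a
basis vector.  Its dimension is the multiplicity of `χ_j` in `ℂ³ ⊗ χ_i`. -/
def homSpace (i j : McKayVertex s r) : Submodule ℂ (Fin 3 → ℂ) where
  carrier := {x | ∀ g, char i g • (embed g).mulVec x = char j g • x}
  zero_mem' := by simp
  add_mem' := by
    intro x y hx hy g
    rw [Matrix.mulVec_add, smul_add, smul_add, hx g, hy g]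
  smul_mem' := by
    intro c x hx g
    rw [Matrix.mulVec_smul, smul_comm, hx g, smul_comm]

theorem mem_homSpace_iff (i j : McKayVertex s r) (x : Fin 3 → ℂ) :
    x ∈ homSpace i j ↔ ∀ t, i + step s r t ≠ j → x t = 0 := by
  have hx : ∀ g t, (char i g • (embed g).mulVec x) t = char (i + step s r t) g * x t := by
    intro g t
    rw [← char_mul_step]
    simp [embed, Matrix.mulVec_diagonal, mul_assoc]
  constructor
  · intro h t ht
    by_contra h0
    refine ht (char_injective fun g => ?_)
    have h1 := congrFun (h g) t
    rw [hx] at h1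
    exact mul_right_cancel₀ h0 (by simpa using h1)
  · intro h g
    funext t
    rw [hx]
    by_cases ht : i + step s r t = j
    · simp [ht]
    · simp [h t ht]

theorem card_arrows (i j : McKayVertex s r) :
    Nat.card (i ⟶ j) = Module.finrank ℂ (homSpace i j) := by
  let f : homSpace i j ≃ₗ[ℂ] ({t : Fin 3 // i + step s r t = j} → ℂ) :=
    { toFun := fun x t => x.1 t.1
      map_add' := fun _ _ => rfl
      map_smul' := fun _ _ => rfl
      invFun := fun y => ⟨fun t => if h : i + step s r t = j then y ⟨t, h⟩ else 0, by
        rw [mem_homSpace_iff]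
        intro t ht
        simp [ht]⟩
      left_inv := by
        intro x
        ext t
        by_cases ht : i + step s r t = j
        · simp [ht]
        · simp [ht, (mem_homSpace_iff i j x.1).1 x.2 t ht]
      right_inv := by
        intro y
        funext t
        simp [t.2] }
  rw [f.finrank_eq, Module.finrank_fintype_fun_eq_card, ← Nat.card_eq_fintype_card]
  rfl

end McKayGroup

/-! ### The relations -/

namespace McKayRelations

open McKayVertex PathAlgebra

variable {k : Type u} [Field k] {s r : ℕ} [NeZero s] [NeZero r]

/-- `α_i` as an element of the path algebra. -/
def α (i : McKayVertex s r) : PathAlgebra k (McKayVertex s r) := ofPath (arrowα i).toPath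

/-- `β_i` as an element of the path algebra. -/
def β (i : McKayVertex s r) : PathAlgebra k (McKayVertex s r) := ofPath (arrowβ i).toPath

/-- `γ_i` as an element of the path algebra. -/
def γ (i : McKayVertex s r) : PathAlgebra k (McKayVertex s r) := ofPath (arrowγ i).toPath

/-- `z(γ,i,c) = c β_(i+e₁) α_i + α_(i+e₂) β_i` -/
def zγ (i : McKayVertex s r) (c : k) : PathAlgebra k (McKayVertex s r) :=
  c • (β (i + e₁ s r) * α i) + α (i + e₂ s r) * β i

/-- `z(β,i,b) = b α_(i-e) γ_i + γ_(i+e₁) α_i` -/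
def zβ (i : McKayVertex s r) (b : k) : PathAlgebra k (McKayVertex s r) :=
  b • (α (i - e s r) * γ i) + γ (i + e₁ s r) * α i

/-- `z(α,i,a) = a β_(i-e) γ_i + γ_(i+e₂) β_i` -/
def zα (i : McKayVertex s r) (a : k) : PathAlgebra k (McKayVertex s r) :=
  a • (β (i - e s r) * γ i) + γ (i + e₂ s r) * β i

/-- The commutativity relations. -/
def commRelations (a b c : McKayVertex s r → k) : Set (PathAlgebra k (McKayVertex s r)) :=
  {x | ∃ i, x = zα i (a i) ∨ x = zβ i (b i) ∨ x = zγ i (c i)}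

/-- The zero relations. -/
def zeroRelations (k : Type u) [Field k] (s r : ℕ) [NeZero s] [NeZero r] :
    Set (PathAlgebra k (McKayVertex s r)) :=
  {x | ∃ i : McKayVertex s r, x = α (i + e₁ s r) * α i ∨ x = β (i + e₂ s r) * β i ∨
    x = γ (i - e s r) * γ i}

/-- The two sets of relations together. -/
def relations (a b c : McKayVertex s r → k) : Set (PathAlgebra k (McKayVertex s r)) :=
  commRelations a b c ∪ zeroRelations k s r

end McKayRelations

end

/-!
# Relations of the McKay quiver of `G(s, r)`

Let `Λ = kQ/I`. Since `Λ` is self-injective, the projectives `Λ ε v` have simple socles, so every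
arrow at `v` can be prolonged to a path that spans the socle of `Λ ε v`. Starting from the three
arrows at a vertex `v` one gets three paths of length at most three with the same end; because
`s, r ≥ 4`, comparing displacements shows that these paths are closed of length three, with one
occurrence of every letter, unless the socle at `v` is spanned by the path `γ γ γ`
(`IsGradedQuiverAlgebra.closed_or_cube`). That exception would be a relation between a path
beginning with `γ` and one beginning with another letter, and the fact that the second syzygy of
`Λ₀` is generated in degree two excludes it (`IsGradedQuiverAlgebra.cube_ne_smul`).

Hence `Λ` has a basis of vertices, arrows, elements `U` dual to the arrows and socle elements `ω`,
and its structure is given by the coordinates `p v x y` of the products of two arrows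
(`IsGradedQuiverAlgebra.IsFrobenius`). A product of two equal arrows vanishes, for the lack of a
closing third arrow. It remains to see that a product of two different arrows does not: then the
two orders of composition are proportional, and `I` is generated by the stated relations, since
these already bring every path without repeated letters to a normal form and kill all the others
(`PathAlgebra.le_of_wordElt_notMem`).

For this the projective resolution of `Λ₀` is needed. It is linear up to step `q`. If `q` were
finite, the kernel at step `q` would live in degree `q + 3`; but the powers of one letter give a
nonzero cycle in degree `q + 1`. So `q = ∞` (`IsGradedQuiverAlgebra.eq_top_of_resolution`), and
the Koszul complex, written in terms of functions on words, is exact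
(`IsGradedQuiverAlgebra.koszul_exact`). The relations are homogeneous for the content of words,
that is, for the number of occurrences of each letter, and the Euler characteristic of the Koszul
complex then shows that the Koszul space of every content and every vertex has dimension one, as
for a polynomial ring in three variables (`KoszulExact.finrank_eq`). If `x`, `y` and `z` are the
three letters and the product of the arrows `x` and `y` at some vertex vanishes, then the
Frobenius structure makes the products of `y`, `z` and of `z`, `x` along the same triangle vanish
too. Going around the triangle before or after going `N = s r` times along `x` then gives two
different paths `x ^ N x y z` and `x y z x ^ N` with the same content, all of whose consecutive
products vanish; both lie in the Koszul space, a contradiction (`coordinate_ne_zero`).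
-/

/-! ### Graded algebras with three arrows at every vertex -/

/-- The displacement of a word in the three letters, when the letter `x` moves by `st x`. -/
def disp {V : Type} [AddCommGroup V] (st : Fin 3 → V) : List (Fin 3) → V
  | [] => 0
  | x :: l => st x + disp st l

/-- The quotient of a path algebra, presented by its vertex idempotents `ε v`, its arrows
`a x v : v → v + st x`, its grading `𝒜` and the projections `comp n` onto the graded parts, which
vanish in degree greater than three. -/
structure IsGradedQuiverAlgebra {k R : Type u} [Field k] [Ring R] [Algebra k R] {V : Type}
    [AddCommGroup V] [Fintype V] [DecidableEq V] (st : Fin 3 → V) (𝒜 : ℕ → Submodule k R)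
    (ε : V → R) (a : Fin 3 → V → R) (comp : ℕ → R →+ R) : Prop where
  eps_mul_eps : ∀ v w, ε v * ε w = if v = w then ε v else 0
  sum_eps : ∑ v, ε v = 1
  eps_mul_arrow : ∀ w x v, ε w * a x v = if w = v + st x then a x v else 0
  arrow_mul_eps : ∀ x v w, a x v * ε w = if v = w then a x v else 0
  zero_eq : 𝒜 0 = Submodule.span k (Set.range ε)
  succ_le : ∀ n, 𝒜 (n + 1) ≤ Submodule.span k {y | ∃ x v, ∃ r ∈ 𝒜 n, y = a x v * r}
  arrow_mem : ∀ x v, a x v ∈ 𝒜 1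
  mul_mem : ∀ m n r r', r ∈ 𝒜 m → r' ∈ 𝒜 n → r * r' ∈ 𝒜 (m + n)
  comp_mem : ∀ n r, comp n r ∈ 𝒜 n
  comp_of_mem : ∀ m n r, r ∈ 𝒜 n → comp m r = if m = n then r else 0
  eq_bot : ∀ n, 3 < n → 𝒜 n = ⊥
  sum_comp : ∀ r, ∑ n ∈ Finset.range 4, comp n r = r
  eps_ne : ∀ v, ε v ≠ 0
  arrow_ne : ∀ x v, a x v ≠ 0

namespace PathAlgebra

section Component

variable {k : Type u} {V : Type} [Field k] [Quiver.{0} V]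

theorem component_add (n : ℕ) (x y : PathAlgebra k V) :
    component n (x + y) = component n x + component n y := by
  simp [component, Finsupp.filter_add]

theorem component_smul (n : ℕ) (c : k) (x : PathAlgebra k V) :
    component n (c • x) = c • component n x := by
  simp [component, Finsupp.filter_smul]

theorem component_zero (n : ℕ) : component n (0 : PathAlgebra k V) = 0 := by
  have h := component_smul n (0 : k) (0 : PathAlgebra k V)
  rwa [zero_smul, zero_smul] at h

theorem component_ofPath (n : ℕ) {a b : V} (p : Quiver.Path a b) :
    component n (ofPath p : PathAlgebra k V) = if p.length = n then ofPath p else 0 := by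
  by_cases h : p.length = n
  · simp only [component, ofPath, LinearEquiv.apply_symm_apply, h, if_true]
    rw [Finsupp.filter_single_of_pos]
    exact h
  · simp only [component, ofPath, LinearEquiv.apply_symm_apply, h, if_false]
    rw [Finsupp.filter_single_of_neg, map_zero]
    exact h

theorem component_mem_lengthPart (n : ℕ) (x : PathAlgebra k V) :
    component n x ∈ lengthPart k V n := by
  induction x using PathAlgebra.induction with
  | h0 => rw [component_zero]; exact zero_mem _
  | hadd x y hx hy => rw [component_add]; exact add_mem hx hy
  | hs c p =>
    rw [component_smul, component_ofPath]
    split_ifs with h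
    · exact Submodule.smul_mem _ _ (Submodule.subset_span ⟨_, _, p, h, rfl⟩)
    · simp

theorem component_of_mem_lengthPart {m n : ℕ} {x : PathAlgebra k V} (hx : x ∈ lengthPart k V n) :
    component m x = if m = n then x else 0 := by
  induction hx using Submodule.span_induction with
  | mem x h =>
    obtain ⟨a, b, p, hp, rfl⟩ := h
    rw [component_ofPath, hp]
    simp only [eq_comm]
  | zero => simp [component_zero]
  | add x y _ _ hx hy => rw [component_add, hx, hy]; split_ifs <;> simp
  | smul c x _ hx => rw [component_smul, hx]; split_ifs <;> simp

theorem coeff_ofPath_self {a b : V} (p : Quiver.Path a b) :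
    coeff (ofPath p : PathAlgebra k V) p = 1 := by
  simp [coeff, ofPath]

end Component

section McKay

open McKayVertex

variable {k : Type u} [Field k] {s r : ℕ}

/-- The idempotent of the path algebra at the vertex `v`. -/
noncomputable def vertexElt (v : McKayVertex s r) : PathAlgebra k (McKayVertex s r) :=
  ofPath (Quiver.Path.nil : Quiver.Path v v)

/-- The arrow with letter `x` that starts at `v`. -/
def letterArrow (x : Fin 3) (v : McKayVertex s r) : v ⟶ v + step s r x := ⟨x, rfl⟩

/-- The arrow with letter `x` that starts at `v`, as an element of the path algebra. -/
noncomputable def arrowElt (x : Fin 3) (v : McKayVertex s r) : PathAlgebra k (McKayVertex s r) :=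
  ofPath (letterArrow x v).toPath

/-- The path that starts at `v` and whose letters, from the last one to the first one, are listed
in `l`. -/
noncomputable def wordElt (v : McKayVertex s r) :
    List (Fin 3) → PathAlgebra k (McKayVertex s r)
  | [] => vertexElt v
  | x :: l => arrowElt x (v + disp (step s r) l) * wordElt v l

theorem vertexElt_mul_vertexElt (v w : McKayVertex s r) :
    (vertexElt v * vertexElt w : PathAlgebra k (McKayVertex s r)) =
      if v = w then vertexElt v else 0 := by
  split_ifs with h
  · subst h; exact ofPath_mul_comp _ _
  · exact ofPath_mul_of_ne (Ne.symm h) _ _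

theorem vertexElt_mul_arrowElt (w : McKayVertex s r) (x : Fin 3) (v : McKayVertex s r) :
    (vertexElt w * arrowElt x v : PathAlgebra k (McKayVertex s r)) =
      if w = v + step s r x then arrowElt x v else 0 := by
  split_ifs with h
  · subst h; exact ofPath_mul_comp _ _
  · exact ofPath_mul_of_ne (Ne.symm h) _ _

theorem arrowElt_mul_vertexElt (x : Fin 3) (v w : McKayVertex s r) :
    (arrowElt x v * vertexElt w : PathAlgebra k (McKayVertex s r)) =
      if v = w then arrowElt x v else 0 := by
  split_ifs with h
  · subst h
    refine (ofPath_mul_comp _ _).trans ?_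
    rw [Quiver.Path.nil_comp]; rfl
  · exact ofPath_mul_of_ne (Ne.symm h) _ _

/-- Every path is given by its source and its letters. -/
theorem ofPath_eq_wordElt {v w : McKayVertex s r} (p : Quiver.Path v w) :
    ∃ l : List (Fin 3), w = v + disp (step s r) l ∧ l.length = p.length ∧
      (ofPath p : PathAlgebra k (McKayVertex s r)) = wordElt v l := by
  induction p with
  | nil => exact ⟨[], by simp [disp], rfl, rfl⟩
  | cons p e ih =>
    obtain ⟨l, hb, hl, h⟩ := ih
    subst hb
    obtain ⟨x, rfl⟩ := e
    refine ⟨x :: l, by simp only [disp]; abel, by simp [hl], ?_⟩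
    rw [wordElt, ← h]
    exact (ofPath_mul_comp (k := k) (letterArrow x (v + disp (step s r) l)).toPath p).symm

theorem wordElt_eq_ofPath (v : McKayVertex s r) (l : List (Fin 3)) :
    ∃ w, ∃ p : Quiver.Path v w, w = v + disp (step s r) l ∧ p.length = l.length ∧
      (wordElt v l : PathAlgebra k (McKayVertex s r)) = ofPath p := by
  induction l with
  | nil => exact ⟨v, Quiver.Path.nil, by simp [disp], rfl, rfl⟩
  | cons x l ih =>
    obtain ⟨w, p, hw, hp, h⟩ := ih
    subst hw
    refine ⟨_, p.cons (letterArrow x _), by simp only [disp]; abel, by simp [hp], ?_⟩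
    rw [wordElt, h]
    exact ofPath_mul_comp _ _

theorem wordElt_mem_lengthPart (v : McKayVertex s r) (l : List (Fin 3)) :
    (wordElt v l : PathAlgebra k (McKayVertex s r)) ∈ lengthPart k _ l.length := by
  obtain ⟨w, p, -, hp, h⟩ := wordElt_eq_ofPath (k := k) v l
  exact Submodule.subset_span ⟨_, _, p, hp, h⟩

variable [NeZero s] [NeZero r]

theorem lengthPart_mul_mem {m n : ℕ} {x y : PathAlgebra k (McKayVertex s r)}
    (hx : x ∈ lengthPart k _ m) (hy : y ∈ lengthPart k _ n) : x * y ∈ lengthPart k _ (m + n) := by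
  induction hx using Submodule.span_induction with
  | mem x h =>
    obtain ⟨a, b, p, hp, rfl⟩ := h
    induction hy using Submodule.span_induction with
    | mem y h =>
      obtain ⟨a', b', q, hq, rfl⟩ := h
      by_cases hb : b' = a
      · subst hb
        rw [ofPath_mul_comp]
        exact Submodule.subset_span ⟨_, _, _, by rw [Quiver.Path.length_comp]; omega, rfl⟩
      · rw [ofPath_mul_of_ne hb]; exact zero_mem _
    | zero => rw [mul_zero]; exact zero_mem _
    | add x y _ _ hx hy => rw [mul_add]; exact add_mem hx hy
    | smul c x _ hx => rw [mul_smul']; exact Submodule.smul_mem _ _ hx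
  | zero => rw [zero_mul]; exact zero_mem _
  | add x y _ _ hx hy => rw [add_mul]; exact add_mem hx hy
  | smul c x _ hx => rw [smul_mul']; exact Submodule.smul_mem _ _ hx

theorem ofPath_notMem {I : Ideal (PathAlgebra k (McKayVertex s r))} (hI : IsRelationIdeal I)
    {v w : McKayVertex s r} (p : Quiver.Path v w) (hp : p.length < 2) :
    (ofPath p : PathAlgebra k (McKayVertex s r)) ∉ I := by
  intro h
  have := hI.two_le_length _ h _ _ p (by rw [coeff_ofPath_self]; exact one_ne_zero)
  omega

variable (I : Ideal (PathAlgebra k (McKayVertex s r)))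

/-- The projection of `kQ/I` onto its part of degree `n`. -/
noncomputable def quotientComponent [I.IsTwoSided] (hI : IsRelationIdeal I) (n : ℕ) :
    PathAlgebra k (McKayVertex s r) ⧸ I →+ PathAlgebra k (McKayVertex s r) ⧸ I :=
  QuotientAddGroup.map I.toAddSubgroup I.toAddSubgroup
    (AddMonoidHom.mk' (component n) (component_add n)) (fun x hx => hI.component_mem x hx n)

theorem quotientComponent_mk [I.IsTwoSided] (hI : IsRelationIdeal I) (n : ℕ)
    (x : PathAlgebra k (McKayVertex s r)) :
    quotientComponent I hI n (Ideal.Quotient.mk I x) = Ideal.Quotient.mk I (component n x) := rfl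

theorem mk_smul [I.IsTwoSided] (c : k) (x : PathAlgebra k (McKayVertex s r)) :
    Ideal.Quotient.mk I (c • x) = c • Ideal.Quotient.mk I x := rfl

theorem isGradedQuiverAlgebra [I.IsTwoSided] (hI : IsRelationIdeal I)
    (h3 : ∀ t, 3 < t → quotientGrading I t = ⊥) :
    IsGradedQuiverAlgebra (k := k) (step s r) (quotientGrading I)
      (fun v => Ideal.Quotient.mk I (vertexElt v)) (fun x v => Ideal.Quotient.mk I (arrowElt x v))
      (quotientComponent I hI) where
  eps_mul_eps v w := by
    rw [← map_mul, vertexElt_mul_vertexElt]; split_ifs <;> simp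
  sum_eps := by rw [← map_sum]; rfl
  eps_mul_arrow w x v := by
    rw [← map_mul, vertexElt_mul_arrowElt]; split_ifs <;> simp
  arrow_mul_eps x v w := by
    rw [← map_mul, arrowElt_mul_vertexElt]; split_ifs <;> simp
  zero_eq := by
    apply le_antisymm
    · rintro y ⟨x, hx, rfl⟩
      induction hx using Submodule.span_induction with
      | mem x h =>
        obtain ⟨a, b, p, hp, rfl⟩ := h
        obtain ⟨l, -, hl, h⟩ := ofPath_eq_wordElt (k := k) p
        rw [hp, List.length_eq_zero_iff] at hl
        subst hl
        rw [h]
        exact Submodule.subset_span ⟨a, rfl⟩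
      | zero => rw [map_zero]; exact zero_mem _
      | add x y _ _ hx hy => rw [map_add]; exact add_mem hx hy
      | smul c x _ hx => rw [map_smul]; exact Submodule.smul_mem _ _ hx
    · rw [Submodule.span_le]
      rintro _ ⟨v, rfl⟩
      exact ⟨_, wordElt_mem_lengthPart v [], rfl⟩
  succ_le n := by
    rintro y ⟨x, hx, rfl⟩
    induction hx using Submodule.span_induction with
    | mem x h =>
      obtain ⟨a, b, p, hp, rfl⟩ := h
      obtain ⟨l, -, hl, h⟩ := ofPath_eq_wordElt (k := k) p
      rw [h]
      cases l with
      | nil => simp at hl; omega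
      | cons x l =>
        refine Submodule.subset_span ⟨x, _, _, ⟨wordElt a l, ?_, rfl⟩,
          map_mul (Ideal.Quotient.mk I) _ _⟩
        have := wordElt_mem_lengthPart (k := k) a l
        rwa [show l.length = n by simp at hl; omega] at this
    | zero => rw [map_zero]; exact zero_mem _
    | add x y _ _ hx hy => rw [map_add]; exact add_mem hx hy
    | smul c x _ hx => rw [map_smul]; exact Submodule.smul_mem _ _ hx
  arrow_mem x v := ⟨_, Submodule.subset_span ⟨_, _, (letterArrow x v).toPath, rfl, rfl⟩, rfl⟩
  mul_mem m n x y := by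
    rintro ⟨x, hx, rfl⟩ ⟨y, hy, rfl⟩
    exact ⟨x * y, lengthPart_mul_mem hx hy, map_mul (Ideal.Quotient.mk I) _ _⟩
  comp_mem n y := by
    obtain ⟨x, rfl⟩ := Ideal.Quotient.mk_surjective y
    exact ⟨_, component_mem_lengthPart n x, rfl⟩
  comp_of_mem m n y := by
    rintro ⟨x, hx, rfl⟩
    refine (congrArg (Ideal.Quotient.mk I) (component_of_mem_lengthPart (m := m) hx)).trans ?_
    split_ifs <;> rfl
  eq_bot := h3
  sum_comp y := by
    obtain ⟨x, rfl⟩ := Ideal.Quotient.mk_surjective y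
    simp only [quotientComponent_mk]
    induction x using PathAlgebra.induction with
    | h0 => simp [component_zero]
    | hadd x y hx hy => simp only [component_add, map_add, Finset.sum_add_distrib, hx, hy]
    | hs c p =>
      simp only [component_smul, component_ofPath, mk_smul, ← Finset.smul_sum]
      congr 1
      by_cases hp : p.length < 4
      · rw [Finset.sum_eq_single_of_mem _ (Finset.mem_range.2 hp)]
        · simp
        · intro b _ hb; rw [if_neg (Ne.symm hb), map_zero]
      · rw [Finset.sum_eq_zero]
        · have : Ideal.Quotient.mk I (ofPath p) ∈ quotientGrading I p.length :=
            ⟨_, Submodule.subset_span ⟨_, _, p, rfl, rfl⟩, rfl⟩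
          rw [h3 _ (by omega)] at this
          exact this.symm
        · intro b hb
          rw [if_neg, map_zero]
          have := Finset.mem_range.1 hb
          omega
  eps_ne v h := ofPath_notMem hI (Quiver.Path.nil : Quiver.Path v v) (by simp)
    (Ideal.Quotient.eq_zero_iff_mem.1 h)
  arrow_ne x v h := ofPath_notMem hI (letterArrow x v).toPath (by simp)
    (Ideal.Quotient.eq_zero_iff_mem.1 h)

end McKay

end PathAlgebra

/-! ### Displacements of short words -/

section Displacement

variable {V : Type} [AddCommGroup V]

theorem disp_append (st : Fin 3 → V) (l l' : List (Fin 3)) :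
    disp st (l ++ l') = disp st l + disp st l' := by
  induction l with
  | nil => simp [disp]
  | cons x l ih => simp [disp, ih, add_assoc]

theorem length_eq_count (l : List (Fin 3)) :
    l.length = l.count 0 + l.count 1 + l.count 2 := by
  induction l with
  | nil => simp
  | cons x l ih =>
    fin_cases x <;> simp [ih] <;> omega

theorem disp_eq_count (st : Fin 3 → V) (l : List (Fin 3)) :
    disp st l = l.count 0 • st 0 + l.count 1 • st 1 + l.count 2 • st 2 := by
  induction l with
  | nil => simp [disp]
  | cons x l ih =>
    fin_cases x <;> simp [ih, disp, add_smul] <;> abel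

/-- Up to length three, the number of occurrences of each letter in a word can be read off from its
length and its displacement, except that the third letter alone may compete with words in the
first two letters. -/
def SeparatesShortWords (st : Fin 3 → V) : Prop :=
  ∀ l l' : List (Fin 3), l.length = l'.length → l.length ≤ 3 → disp st l = disp st l' →
    (∀ x, l.count x = l'.count x) ∨ (l.count 2 = 3 ∧ l'.count 2 = 0) ∨
      (l'.count 2 = 3 ∧ l.count 2 = 0)

theorem step_sum (s r : ℕ) : McKayVertex.step s r 0 + McKayVertex.step s r 1 +
    McKayVertex.step s r 2 = 0 := by
  change McKayVertex.e₁ s r + McKayVertex.e₂ s r + -(McKayVertex.e₁ s r + McKayVertex.e₂ s r) = 0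
  abel

/-- A displacement determines the differences `n₀ - n₂` and `n₁ - n₂` of the numbers of occurrences
modulo `s` and `r`, and hence, since `s, r ≥ 4`, the word up to order apart from the stated
exceptions. -/
theorem separatesShortWords_step {s r : ℕ} (hs : 4 ≤ s) (hr : 4 ≤ r) :
    SeparatesShortWords (McKayVertex.step s r) := by
  intro l l' hl h3 h
  have key : ∀ l : List (Fin 3),
      (disp (McKayVertex.step s r) l).1 = (((l.count 0 : ℤ) - l.count 2 : ℤ) : ZMod s) ∧
      (disp (McKayVertex.step s r) l).2 = (((l.count 1 : ℤ) - l.count 2 : ℤ) : ZMod r) := by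
    intro l
    have h2 : McKayVertex.step s r 2 = ((-1 : ZMod s), (-1 : ZMod r)) := by
      change (-((1 : ZMod s) + 0), -((0 : ZMod r) + 1)) = _
      simp
    induction l with
    | nil => exact ⟨by simp [disp]; rfl, by simp [disp]; rfl⟩
    | cons x l ih =>
      have e1 : (disp (McKayVertex.step s r) (x :: l)).1 =
        (McKayVertex.step s r x).1 + (disp (McKayVertex.step s r) l).1 := rfl
      have e2 : (disp (McKayVertex.step s r) (x :: l)).2 =
        (McKayVertex.step s r x).2 + (disp (McKayVertex.step s r) l).2 := rfl
      rw [e1, e2, ih.1, ih.2]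
      fin_cases x
      · constructor
        · change (1 : ZMod s) + _ = _
          simp; ring
        · change (0 : ZMod r) + _ = _
          simp
      · constructor
        · change (0 : ZMod s) + _ = _
          simp
        · change (1 : ZMod r) + _ = _
          simp; ring
      · simp only [Fin.reduceFinMk, h2]
        constructor
        · simp; ring
        · simp; ring
  have h1 := (key l).1.symm.trans ((congrArg Prod.fst h).trans (key l').1)
  have h2 := (key l).2.symm.trans ((congrArg Prod.snd h).trans (key l').2)
  rw [← sub_eq_zero, ← Int.cast_sub, ZMod.intCast_zmod_eq_zero_iff_dvd] at h1 h2
  -- All that matters about `s` and `r` is that their nonzero multiples are at least `4` in absolute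
  -- value.
  have hd : ∀ (n : ℕ) (D : ℤ), 4 ≤ n → (n : ℤ) ∣ D → D = 0 ∨ 4 ≤ D ∨ D ≤ -4 := by
    intro n D hn hD
    rcases lt_trichotomy D 0 with h0 | h0 | h0
    · have := Int.le_of_dvd (by omega) ((dvd_neg).2 hD)
      omega
    · exact Or.inl h0
    · have := Int.le_of_dvd h0 hD
      omega
  have d1 := hd s _ hs h1
  have d2 := hd r _ hr h2
  have c1 := length_eq_count l
  have c2 := length_eq_count l'
  have : (l.count 0 = l'.count 0 ∧ l.count 1 = l'.count 1 ∧ l.count 2 = l'.count 2) ∨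
      (l.count 2 = 3 ∧ l'.count 2 = 0) ∨ (l'.count 2 = 3 ∧ l.count 2 = 0) := by
    omega
  refine this.imp_left fun h x => ?_
  fin_cases x
  exacts [h.1, h.2.1, h.2.2]

variable {st : Fin 3 → V}

theorem SeparatesShortWords.count_eq (hst : SeparatesShortWords st) (h0 : st 0 + st 1 + st 2 = 0)
    {l : List (Fin 3)} (hl : l.length = 3) (h : disp st l = 0) (x : Fin 3) : l.count x = 1 := by
  have := hst l [0, 1, 2] hl hl.le (by rw [h, disp_eq_count]; simp [h0])
  rcases this with h | h | h
  · rw [h x]; fin_cases x <;> rfl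
  · exact absurd h.2 (by decide)
  · exact absurd h.1 (by decide)

theorem SeparatesShortWords.eq_two (hst : SeparatesShortWords st) {x y : Fin 3}
    (h : st x + st y = st 2 + st 2) : x = 2 ∧ y = 2 := by
  have := hst [x, y] [2, 2] rfl (by simp) (by simpa [disp] using h)
  rcases this with h | h | h
  · have := h 2
    clear h
    clear * - this
    revert x y; decide
  · exact absurd h.2 (by decide)
  · exact absurd h.1 (by decide)

theorem SeparatesShortWords.injective (hst : SeparatesShortWords st) :
    Function.Injective st := by
  intro x y h
  have := hst [x] [y] rfl (by simp) (by simpa [disp] using h)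
  rcases this with h | h | h
  · have := h x
    by_contra hxy
    simp [Ne.symm hxy] at this
  · have := List.count_le_length (a := (2 : Fin 3)) (l := [x])
    rw [h.1] at this; simp at this
  · have := List.count_le_length (a := (2 : Fin 3)) (l := [y])
    rw [h.1] at this; simp at this

end Displacement

namespace IsGradedQuiverAlgebra

variable {k R : Type u} [Field k] [Ring R] [Algebra k R] {V : Type}
    [AddCommGroup V] [Fintype V] [DecidableEq V] {st : Fin 3 → V} {𝒜 : ℕ → Submodule k R}
    {ε : V → R} {a : Fin 3 → V → R} {comp : ℕ → R →+ R}

/-! ### Degrees and vertices in a graded quiver algebra -/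

section Basic

variable (h : IsGradedQuiverAlgebra st 𝒜 ε a comp)
include h

theorem eps_mul_self (v : V) : ε v * ε v = ε v := by rw [h.eps_mul_eps, if_pos rfl]

theorem eps_arrow (x : Fin 3) (v : V) : ε (v + st x) * a x v = a x v := by
  rw [h.eps_mul_arrow, if_pos rfl]

theorem arrow_eps (x : Fin 3) (v : V) : a x v * ε v = a x v := by
  rw [h.arrow_mul_eps, if_pos rfl]

theorem eps_mem (v : V) : ε v ∈ 𝒜 0 := by
  rw [h.zero_eq]; exact Submodule.subset_span ⟨v, rfl⟩

theorem one_mem : (1 : R) ∈ 𝒜 0 := by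
  rw [← h.sum_eps]; exact Submodule.sum_mem _ fun v _ => h.eps_mem v

theorem eps_mul_mem {n : ℕ} {r : R} (hr : r ∈ 𝒜 n) (v : V) : ε v * r ∈ 𝒜 n := by
  simpa using h.mul_mem 0 n _ _ (h.eps_mem v) hr

theorem mul_eps_mem {n : ℕ} {r : R} (hr : r ∈ 𝒜 n) (v : V) : r * ε v ∈ 𝒜 n := by
  simpa using h.mul_mem n 0 _ _ hr (h.eps_mem v)

theorem comp_self {n : ℕ} {r : R} (hr : r ∈ 𝒜 n) : comp n r = r := by
  rw [h.comp_of_mem n n r hr, if_pos rfl]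

theorem eq_zero_of_mem {m n : ℕ} (hmn : m ≠ n) {r : R} (hm : r ∈ 𝒜 m) (hn : r ∈ 𝒜 n) : r = 0 := by
  rw [← h.comp_self hm, h.comp_of_mem m n r hn, if_neg hmn]

theorem comp_mul {d : ℕ} {b : R} (hb : b ∈ 𝒜 d) (n : ℕ) (r : R) :
    comp (d + n) (b * r) = b * comp n r := by
  conv_lhs => rw [← h.sum_comp r, Finset.mul_sum, map_sum]
  have : ∀ i ∈ Finset.range 4, comp (d + n) (b * comp i r) =
      if n = i then b * comp n r else 0 := by
    intro i _
    rw [h.comp_of_mem _ _ _ (h.mul_mem d i _ _ hb (h.comp_mem i r))]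
    by_cases hi : n = i
    · subst hi; simp
    · rw [if_neg hi, if_neg (by omega)]
  rw [Finset.sum_congr rfl this, Finset.sum_ite_eq]
  split_ifs with hn
  · rfl
  · have h1 := h.comp_mem n r
    rw [h.eq_bot n (by rw [Finset.mem_range] at hn; omega), Submodule.mem_bot] at h1
    rw [h1, mul_zero]

theorem comp_mul_of_lt {m d : ℕ} (hm : m < d) {b : R} (hb : b ∈ 𝒜 d) (r : R) :
    comp m (b * r) = 0 := by
  conv_lhs => rw [← h.sum_comp r, Finset.mul_sum, map_sum]
  refine Finset.sum_eq_zero fun i _ => ?_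
  rw [h.comp_of_mem _ _ _ (h.mul_mem d i _ _ hb (h.comp_mem i r)), if_neg (by omega)]

/-- The lowest part of a product with an element of `R`. -/
theorem comp_mul_lowest {d : ℕ} {x : R} (hx : ∀ i < d, comp i x = 0) (y : R) :
    comp d (x * y) = comp d x * comp 0 y := by
  have hx' : x * y = ∑ i ∈ Finset.range 4, comp i x * y := by
    rw [← Finset.sum_mul, h.sum_comp]
  rw [hx', map_sum]
  rw [← h.comp_mul (h.comp_mem d x) 0 y, add_zero]
  by_cases hd : d < 4
  · refine Finset.sum_eq_single_of_mem d (Finset.mem_range.2 hd) fun i _ hi => ?_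
    rcases lt_or_gt_of_ne hi with hi | hi
    · rw [hx i hi, zero_mul, map_zero]
    · exact h.comp_mul_of_lt hi (h.comp_mem i x) y
  · have h1 := h.comp_mem d x
    rw [h.eq_bot d (by omega), Submodule.mem_bot] at h1
    rw [h1, zero_mul, map_zero]
    refine Finset.sum_eq_zero fun i hi => ?_
    rw [hx i (by have := Finset.mem_range.1 hi; omega), zero_mul, map_zero]

theorem zero_part {r : R} (hr : r ∈ 𝒜 0) (v : V) :
    ∃ c : k, ε v * r = c • ε v ∧ r * ε v = c • ε v := by
  rw [h.zero_eq] at hr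
  induction hr using Submodule.span_induction with
  | mem r hr =>
    obtain ⟨w, rfl⟩ := hr
    by_cases hvw : v = w
    · subst hvw
      exact ⟨1, by simp [h.eps_mul_self]⟩
    · exact ⟨0, by simp [h.eps_mul_eps, hvw, Ne.symm hvw]⟩
  | zero => exact ⟨0, by simp⟩
  | add x y _ _ hx hy =>
    obtain ⟨c, h1, h2⟩ := hx
    obtain ⟨d, h3, h4⟩ := hy
    exact ⟨c + d, by rw [mul_add, h1, h3, add_smul], by rw [add_mul, h2, h4, add_smul]⟩
  | smul c x _ hx =>
    obtain ⟨d, h1, h2⟩ := hx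
    exact ⟨c * d, by rw [mul_smul_comm, h1, smul_smul], by rw [smul_mul_assoc, h2, smul_smul]⟩

theorem succ_le_right (n : ℕ) :
    𝒜 (n + 1) ≤ Submodule.span k {y | ∃ x v, ∃ r ∈ 𝒜 n, y = r * a x v} := by
  induction n with
  | zero =>
    refine (h.succ_le 0).trans (Submodule.span_le.2 ?_)
    rintro _ ⟨x, v, r, hr, rfl⟩
    obtain ⟨c, h1, h2⟩ := h.zero_part hr v
    have : a x v * r = c • (1 * a x v) := by
      rw [← h.arrow_eps x v, mul_assoc, h1, mul_smul_comm, one_mul]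
    rw [this]
    exact Submodule.smul_mem _ _ (Submodule.subset_span ⟨x, v, 1, h.one_mem, rfl⟩)
  | succ n ih =>
    refine (h.succ_le (n + 1)).trans (Submodule.span_le.2 ?_)
    rintro _ ⟨x, v, r, hr, rfl⟩
    replace hr := ih hr
    induction hr using Submodule.span_induction with
    | mem r hr =>
      obtain ⟨y, w, r, hr, rfl⟩ := hr
      refine Submodule.subset_span ⟨y, w, a x v * r, ?_, by rw [mul_assoc]⟩
      rw [add_comm]
      exact h.mul_mem 1 n _ _ (h.arrow_mem x v) hr
    | zero => simp
    | add r r' _ _ h1 h2 => rw [mul_add]; exact add_mem h1 h2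
    | smul c r _ h1 => rw [mul_smul_comm]; exact Submodule.smul_mem _ _ h1

end Basic

/-! ### The socles of the projectives `R ε v` -/

section Socle

/-- In a self-injective graded quiver algebra the left modules `R ε v` are uniform. -/
theorem exists_common_multiple (h : IsGradedQuiverAlgebra st 𝒜 ε a comp)
    (hinj : Module.Injective R R) {v : V} {x y : R} (hx : x ≠ 0) (hy : y ≠ 0)
    (hxv : x * ε v = x) (hyv : y * ε v = y) : ∃ r r', r * x = r' * y ∧ r * x ≠ 0 := by
  by_contra! hcon
  have hdisj : Disjoint (Submodule.span R {x}) (Submodule.span R {y}) := by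
    rw [Submodule.disjoint_def]
    intro z hz hz'
    obtain ⟨r, rfl⟩ := Submodule.mem_span_singleton.1 hz
    obtain ⟨r', hr'⟩ := Submodule.mem_span_singleton.1 hz'
    exact hcon r r' hr'.symm
  let f := LinearMap.coprod (Submodule.span R {x}).subtype (Submodule.span R {y}).subtype
  have hf : Function.Injective f := by
    rw [← LinearMap.ker_eq_bot]
    have := LinearMap.ker_coprod_of_disjoint_range (Submodule.span R {x}).subtype
      (Submodule.span R {y}).subtype (by simpa using hdisj)
    rw [this]; simp
  -- Right multiplication by `g 1` is the identity on `x` and zero on `y`.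
  obtain ⟨g, hg⟩ := hinj.out f hf
    ((Submodule.span R {x}).subtype ∘ₗ LinearMap.fst R _ _)
  have hgm : ∀ z, g z = z * g 1 := fun z => by
    rw [← smul_eq_mul, ← map_smul, smul_eq_mul, mul_one]
  have h1 : x * g 1 = x := by
    rw [← hgm]
    simpa [f] using hg (⟨x, Submodule.mem_span_singleton_self x⟩, 0)
  have h2 : y * g 1 = 0 := by
    rw [← hgm]
    simpa [f] using hg (0, ⟨y, Submodule.mem_span_singleton_self y⟩)
  obtain ⟨c, hc, -⟩ := h.zero_part (h.comp_mem 0 (g 1)) v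
  -- On the lowest nonzero part of an element, `g 1` acts by its part of degree zero, that is by the
  -- scalar `c`, which would have to be both one and zero.
  have key : ∀ z, z ≠ 0 → z * ε v = z → ∃ w, w ≠ 0 ∧ ∃ d, w = comp d z ∧
      comp d (z * g 1) = c • w := by
    intro z hz hzv
    have hex : ∃ d, comp d z ≠ 0 := by
      by_contra! h0
      exact hz (by rw [← h.sum_comp z]; simp [h0])
    obtain ⟨d, hd, hlow⟩ : ∃ d, comp d z ≠ 0 ∧ ∀ i < d, comp i z = 0 := by
      classical
      exact ⟨_, Nat.find_spec hex, fun i hi => by simpa using Nat.find_min hex hi⟩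
    refine ⟨_, hd, _, rfl, ?_⟩
    have e1 : comp d z = comp d z * ε v := by
      conv_lhs => rw [← hzv]
      rw [h.comp_mul_lowest hlow, h.comp_self (h.eps_mem v)]
    rw [h.comp_mul_lowest hlow, e1, mul_assoc, hc, mul_smul_comm]
  obtain ⟨w, hw, d, hwd, hw'⟩ := key x hx hxv
  rw [h1, ← hwd] at hw'
  obtain ⟨u, hu, d', -, hu'⟩ := key y hy hyv
  rw [h2, map_zero] at hu'
  rcases smul_eq_zero.1 hu'.symm with h0 | h0
  · rw [h0, zero_smul] at hw'; exact hw hw'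
  · exact hu h0

/-- A nonzero element of degree `d` in `ε j R ε i` that is killed by all arrows from the left. -/
structure IsSocleElt (𝒜 : ℕ → Submodule k R) (ε : V → R) (a : Fin 3 → V → R) (i j : V) (d : ℕ)
    (n : R) : Prop where
  ne_zero : n ≠ 0
  mem : n ∈ 𝒜 d
  eps_mul : ε j * n = n
  mul_eps : n * ε i = n
  arrow_mul : ∀ x v, a x v * n = 0

/-- Multiples of a socle element are scalar multiples. -/
theorem IsSocleElt.mul_eq_smul (h : IsGradedQuiverAlgebra st 𝒜 ε a comp) {i j : V} {d : ℕ} {n : R}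
    (hn : IsSocleElt 𝒜 ε a i j d n) (r : R) : ∃ c : k, r * n = c • n := by
  have hpos : ∀ m, ∀ r ∈ 𝒜 (m + 1), r * n = 0 := by
    intro m r hr
    replace hr := h.succ_le_right m hr
    induction hr using Submodule.span_induction with
    | mem r hr =>
      obtain ⟨x, v, r, -, rfl⟩ := hr
      rw [mul_assoc, hn.arrow_mul, mul_zero]
    | zero => simp
    | add r r' _ _ h1 h2 => rw [add_mul, h1, h2, add_zero]
    | smul c r _ h1 => rw [smul_mul_assoc, h1, smul_zero]
  obtain ⟨c, -, hc⟩ := h.zero_part (h.comp_mem 0 r) j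
  refine ⟨c, ?_⟩
  have e : r = comp 0 r + ∑ m ∈ Finset.range 3, comp (m + 1) r := by
    conv_lhs => rw [← h.sum_comp r, Finset.sum_range_succ']
    rw [add_comm]
  rw [e, add_mul, Finset.sum_mul, Finset.sum_eq_zero fun m _ => hpos m _ (h.comp_mem _ _), add_zero,
    ← hn.eps_mul, ← mul_assoc, hc, smul_mul_assoc]

/-- The socle of `R ε i` is simple, so that its elements have one end, one degree, and are
proportional. -/
theorem IsSocleElt.unique (h : IsGradedQuiverAlgebra st 𝒜 ε a comp) (hinj : Module.Injective R R)
    {i j j' : V} {d d' : ℕ} {n n' : R} (hn : IsSocleElt 𝒜 ε a i j d n)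
    (hn' : IsSocleElt 𝒜 ε a i j' d' n') : j = j' ∧ d = d' ∧ ∃ c : k, c ≠ 0 ∧ n = c • n' := by
  obtain ⟨r, r', h1, h2⟩ := h.exists_common_multiple hinj hn.ne_zero hn'.ne_zero hn.mul_eps
    hn'.mul_eps
  obtain ⟨c, hc⟩ := hn.mul_eq_smul h r
  obtain ⟨c', hc'⟩ := hn'.mul_eq_smul h r'
  rw [hc, hc'] at h1
  rw [hc] at h2
  have hc0 : c ≠ 0 := fun h0 => h2 (by rw [h0, zero_smul])
  have hn0 : n = (c⁻¹ * c') • n' := by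
    rw [← smul_smul, ← h1, smul_smul, inv_mul_cancel₀ hc0, one_smul]
  refine ⟨?_, ?_, c⁻¹ * c', ?_, hn0⟩
  · by_contra hj
    apply hn.ne_zero
    rw [← hn.eps_mul, hn0, mul_smul_comm, ← hn'.eps_mul, ← mul_assoc, h.eps_mul_eps, if_neg hj,
      zero_mul, smul_zero]
  · by_contra hd
    exact hn.ne_zero (h.eq_zero_of_mem hd hn.mem (hn0 ▸ Submodule.smul_mem _ _ hn'.mem))
  · intro h0
    exact hn.ne_zero (by rw [hn0, h0, zero_smul])

/-- The product of the arrows along the path that starts at `v` and whose letters, from the last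
one to the first one, are listed in `l`. -/
def word (st : Fin 3 → V) (ε : V → R) (a : Fin 3 → V → R) (v : V) : List (Fin 3) → R
  | [] => ε v
  | x :: l => a x (v + disp st l) * word st ε a v l

variable (h : IsGradedQuiverAlgebra st 𝒜 ε a comp)
include h

theorem word_mem (v : V) (l : List (Fin 3)) : word st ε a v l ∈ 𝒜 l.length := by
  induction l with
  | nil => exact h.eps_mem v
  | cons x l ih =>
    rw [List.length_cons, add_comm]
    exact h.mul_mem 1 _ _ _ (h.arrow_mem _ _) ih

theorem eps_mul_word (v : V) (l : List (Fin 3)) :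
    ε (v + disp st l) * word st ε a v l = word st ε a v l := by
  cases l with
  | nil => simp [disp, word, h.eps_mul_self]
  | cons x l =>
    rw [word, ← mul_assoc, h.eps_mul_arrow, if_pos (by simp only [disp]; abel)]

theorem word_mul_eps (v : V) (l : List (Fin 3)) :
    word st ε a v l * ε v = word st ε a v l := by
  induction l with
  | nil => simp [word, h.eps_mul_self]
  | cons x l ih => rw [word, mul_assoc, ih]

theorem word_append_singleton (v : V) (l : List (Fin 3)) (x : Fin 3) :
    word st ε a v (l ++ [x]) = word st ε a (v + st x) l * a x v := by
  induction l with
  | nil => simp [word, disp, h.eps_arrow, h.arrow_eps]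
  | cons y l ih =>
    rw [List.cons_append, word, ih, word, ← mul_assoc, disp_append]
    congr 3
    simp only [disp]; abel

/-- An arrow can be prolonged by further arrows until the path is a socle element, because the paths
of length four vanish. -/
theorem exists_socle_word (x : Fin 3) (v : V) : ∃ l : List (Fin 3), l.length ≤ 2 ∧
    IsSocleElt 𝒜 ε a v (v + disp st (l ++ [x])) (l.length + 1) (word st ε a v (l ++ [x])) := by
  have hlen : ∀ l : List (Fin 3), word st ε a v (l ++ [x]) ≠ 0 → l.length ≤ 2 := by
    intro l hl
    by_contra hlt
    have := h.word_mem v (l ++ [x])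
    rw [h.eq_bot _ (by simp; omega), Submodule.mem_bot] at this
    exact hl this
  by_cases hcon : ∃ l : List (Fin 3), word st ε a v (l ++ [x]) ≠ 0 ∧
      ∀ y, word st ε a v (y :: l ++ [x]) = 0
  · obtain ⟨l, hl, hy⟩ := hcon
    refine ⟨l, hlen l hl, hl, by simpa using h.word_mem v (l ++ [x]), h.eps_mul_word _ _,
      h.word_mul_eps _ _, fun y w => ?_⟩
    by_cases hw : w = v + disp st (l ++ [x])
    · subst hw; exact hy y
    · rw [← h.eps_mul_word, ← mul_assoc, h.arrow_mul_eps, if_neg hw, zero_mul]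
  · push Not at hcon
    have : ∀ n : ℕ, ∃ l : List (Fin 3), l.length = n ∧ word st ε a v (l ++ [x]) ≠ 0 := by
      intro n
      induction n with
      | zero => exact ⟨[], rfl, by simpa [word, disp, h.arrow_eps] using h.arrow_ne x v⟩
      | succ n ih =>
        obtain ⟨l, hl, hw⟩ := ih
        obtain ⟨y, hy⟩ := hcon l hw
        exact ⟨y :: l, by simp [hl], hy⟩
    obtain ⟨l, hl, hw⟩ := this 3
    have := hlen l hw
    omega

/-- Either the three letters at `v` all continue to a closed path of length three that spans the
socle of `R ε v`, or this socle is spanned by the third power of the third letter as well as by a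
path that starts with another letter. -/
theorem closed_or_cube (hinj : Module.Injective R R) (hst : SeparatesShortWords st)
    (h0 : st 0 + st 1 + st 2 = 0) (v : V) :
    (∀ x, ∃ l : List (Fin 3), l.length = 2 ∧
      IsSocleElt 𝒜 ε a v v 3 (word st ε a (v + st x) l * a x v)) ∨
    ∃ (x : Fin 3) (l : List (Fin 3)) (c : k), x ≠ 2 ∧ l.length = 2 ∧
      v + st x + disp st l = v + disp st [2, 2, 2] ∧
      word st ε a v [2, 2, 2] ≠ 0 ∧
      word st ε a v [2, 2, 2] = c • (word st ε a (v + st x) l * a x v) := by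
  -- The three prolonged paths end at the same vertex and have the same length, so `hst` applies.
  choose l hl hsoc using fun x => h.exists_socle_word x v
  by_cases hcount : ∀ x y t, (l x ++ [x]).count t = (l y ++ [y]).count t
  · left
    intro x
    have hc : ∀ t, 0 < (l x ++ [x]).count t := fun t => by
      rw [hcount x t t]; exact List.count_pos_iff.2 (by simp)
    have hlen := length_eq_count (l x ++ [x])
    have h0' := hc 0
    have h1' := hc 1
    have h2' := hc 2
    have hl' := hl x
    rw [List.length_append, List.length_singleton] at hlen
    have hd : disp st (l x ++ [x]) = 0 := by
      rw [disp_eq_count, show (l x ++ [x]).count 0 = 1 by omega,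
        show (l x ++ [x]).count 1 = 1 by omega, show (l x ++ [x]).count 2 = 1 by omega]
      simpa using h0
    refine ⟨l x, by omega, ?_⟩
    have := hsoc x
    rwa [hd, add_zero, show (l x).length + 1 = 3 by omega, h.word_append_singleton] at this
  · right
    have main : ∀ x y, (l x ++ [x]).count 2 = 3 → (l y ++ [y]).count 2 = 0 → ∃ (x : Fin 3)
        (l : List (Fin 3)) (c : k), x ≠ 2 ∧ l.length = 2 ∧
        v + st x + disp st l = v + disp st [2, 2, 2] ∧ word st ε a v [2, 2, 2] ≠ 0 ∧
        word st ε a v [2, 2, 2] = c • (word st ε a (v + st x) l * a x v) := by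
      intro x y hx hy
      have hx3 : l x ++ [x] = [2, 2, 2] := by
        have h1 : (l x ++ [x]).length = (l x ++ [x]).count 2 := by
          have := List.count_le_length (a := (2 : Fin 3)) (l := l x ++ [x])
          have := hl x
          simp only [List.length_append, List.length_singleton] at *
          omega
        exact List.eq_replicate_iff.2 ⟨h1.trans hx, fun b hb =>
          (List.count_eq_length.1 h1.symm b hb).symm⟩
      obtain ⟨hj, hd, c, -, hc⟩ := (hsoc x).unique h hinj (hsoc y)
      have hlx : (l x).length = 2 := by simpa using congrArg List.length hx3
      rw [hx3] at hc hj
      refine ⟨y, l y, c, ?_, by omega, ?_, ?_, ?_⟩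
      · rintro rfl
        simp at hy
      · rw [hj, disp_append]; simp only [disp]; abel
      · rw [← hx3]; exact (hsoc x).ne_zero
      · rw [← h.word_append_singleton]; exact hc
    push Not at hcount
    obtain ⟨x, y, t, hxy⟩ := hcount
    obtain ⟨hj, hd, -⟩ := (hsoc x).unique h hinj (hsoc y)
    have := hl x
    rcases hst (l x ++ [x]) (l y ++ [y]) (by simp; omega) (by simp; omega)
      (add_left_cancel hj) with h1 | ⟨h1, h2⟩ | ⟨h1, h2⟩
    · exact absurd (h1 t) hxy
    · exact main x y h1 h2
    · exact main y x h1 h2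

end Socle

end IsGradedQuiverAlgebra

/-! ### Graded projective modules generated in one degree -/

section GradedModule

variable {P P' : Type u} [AddCommGroup P] [AddCommGroup P'] {gr : ℕ → AddSubgroup P}
  {gr' : ℕ → AddSubgroup P'}

/-- The projection of a graded abelian group onto its part of degree `n`. -/
noncomputable def gradedProj (hgr : DirectSum.IsInternal gr) (n : ℕ) : P →+ P :=
  letI := hgr.chooseDecomposition
  AddMonoidHom.mk' (fun x => (DirectSum.decompose gr x n : P)) (by simp [DirectSum.decompose_add])

theorem gradedProj_mem (hgr : DirectSum.IsInternal gr) (n : ℕ) (x : P) :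
    gradedProj hgr n x ∈ gr n := by
  let := hgr.chooseDecomposition
  exact (DirectSum.decompose gr x n).2

theorem gradedProj_of_mem (hgr : DirectSum.IsInternal gr) (m : ℕ) {n : ℕ} {x : P} (hx : x ∈ gr n) :
    gradedProj hgr m x = if m = n then x else 0 := by
  let := hgr.chooseDecomposition
  split_ifs with h
  · subst h
    exact DirectSum.decompose_of_mem_same gr hx
  · exact DirectSum.decompose_of_mem_ne gr hx (Ne.symm h)

theorem gradedProj_self (hgr : DirectSum.IsInternal gr) {n : ℕ} {x : P} (hx : x ∈ gr n) :
    gradedProj hgr n x = x := by rw [gradedProj_of_mem hgr n hx, if_pos rfl]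

theorem exists_eq_sum_gradedProj (hgr : DirectSum.IsInternal gr) (x : P) :
    ∃ S : Finset ℕ, x = ∑ n ∈ S, gradedProj hgr n x := by
  classical
  let := hgr.chooseDecomposition
  exact ⟨_, (DirectSum.sum_support_decompose gr x).symm⟩

theorem gradedProj_map (hgr : DirectSum.IsInternal gr) (hgr' : DirectSum.IsInternal gr')
    (f : P →+ P') (hf : ∀ n, ∀ x ∈ gr n, f x ∈ gr' n) (n : ℕ) (x : P) :
    gradedProj hgr' n (f x) = f (gradedProj hgr n x) := by
  obtain ⟨S, hS⟩ := exists_eq_sum_gradedProj hgr x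
  rw [hS]
  simp only [map_sum]
  refine Finset.sum_congr rfl fun i _ => ?_
  rw [gradedProj_of_mem hgr' n (hf i _ (gradedProj_mem hgr i x)),
    gradedProj_of_mem hgr n (gradedProj_mem hgr i x)]
  split_ifs <;> simp

theorem eq_zero_of_mem_gr (hgr : DirectSum.IsInternal gr) {m n : ℕ} (hmn : m ≠ n) {x : P}
    (hm : x ∈ gr m) (hn : x ∈ gr n) : x = 0 := by
  rw [← gradedProj_self hgr hm, gradedProj_of_mem hgr m hn, if_neg hmn]

end GradedModule

namespace IsGradedQuiverAlgebra

variable {k R : Type u} [Field k] [Ring R] [Algebra k R] {V : Type}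
    [AddCommGroup V] [Fintype V] [DecidableEq V] {st : Fin 3 → V} {𝒜 : ℕ → Submodule k R}
    {ε : V → R} {a : Fin 3 → V → R} {comp : ℕ → R →+ R}
    {P : Type u} [AddCommGroup P] [Module R P] {gr : ℕ → AddSubgroup P}
    (h : IsGradedQuiverAlgebra st 𝒜 ε a comp) (hgr : IsModuleGrading 𝒜 gr)
include h hgr

omit [AddCommGroup V] [Fintype V] [DecidableEq V] h in
theorem zero_smul_mem {n : ℕ} {r : R} (hr : r ∈ 𝒜 0) {x : P} (hx : x ∈ gr n) : r • x ∈ gr n := by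
  simpa using hgr.smul_mem 0 n r x hr hx

theorem gradedProj_smul_of_mem {t : ℕ} {x : P} (hx : x ∈ gr t) (d : ℕ) (r : R) :
    gradedProj hgr.isInternal (t + d) (r • x) = comp d r • x := by
  conv_lhs => rw [← h.sum_comp r, Finset.sum_smul, map_sum]
  have : ∀ i ∈ Finset.range 4, gradedProj hgr.isInternal (t + d) (comp i r • x) =
      if d = i then comp d r • x else 0 := by
    intro i _
    rw [gradedProj_of_mem _ _ (hgr.smul_mem i t _ _ (h.comp_mem i r) hx)]
    by_cases hi : d = i
    · subst hi; rw [if_pos (add_comm _ _), if_pos rfl]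
    · rw [if_neg hi, if_neg (by omega)]
  rw [Finset.sum_congr rfl this, Finset.sum_ite_eq]
  split_ifs with hn
  · rfl
  · have h1 := h.comp_mem d r
    rw [h.eq_bot d (by rw [Finset.mem_range] at hn; omega), Submodule.mem_bot] at h1
    rw [h1, zero_smul]

section Generated

variable {t : ℕ} (hgen : Submodule.span R (gr t : Set P) = ⊤)
include hgen

omit h hgr [Field k] [Algebra k R] in
theorem exists_eq_sum_smul (x : P) :
    ∃ (n : ℕ) (f : Fin n → R) (g : Fin n → P), (∀ i, g i ∈ gr t) ∧ x = ∑ i, f i • g i := by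
  have hx : x ∈ Submodule.span R (gr t : Set P) := by rw [hgen]; trivial
  obtain ⟨n, f, g, hfg⟩ := Submodule.mem_span_set'.1 hx
  exact ⟨n, f, fun i => g i, fun i => (g i).2, hfg.symm⟩

theorem gradedProj_of_lt {n : ℕ} (hn : n < t) (x : P) : gradedProj hgr.isInternal n x = 0 := by
  obtain ⟨m, f, g, hg, rfl⟩ := exists_eq_sum_smul hgen x
  rw [map_sum]
  refine Finset.sum_eq_zero fun i _ => ?_
  conv_lhs => rw [← h.sum_comp (f i), Finset.sum_smul, map_sum]
  refine Finset.sum_eq_zero fun j _ => ?_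
  rw [gradedProj_of_mem _ _ (hgr.smul_mem j t _ _ (h.comp_mem j _) (hg i)), if_neg (by omega)]

theorem gradedProj_pos_smul {d : ℕ} (hd : 0 < d) {r : R} (hr : r ∈ 𝒜 d) (x : P) :
    gradedProj hgr.isInternal t (r • x) = 0 := by
  obtain ⟨S, hS⟩ := exists_eq_sum_gradedProj hgr.isInternal x
  rw [hS, Finset.smul_sum, map_sum]
  refine Finset.sum_eq_zero fun i _ => ?_
  rw [gradedProj_of_mem _ _ (hgr.smul_mem d i _ _ hr (gradedProj_mem hgr.isInternal i x))]
  split_ifs with hi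
  · rw [h.gradedProj_of_lt hgr hgen (by omega), smul_zero]
  · rfl

/-- The part of degree `t + d` of a graded module that is generated in degree `t` is obtained from
its part of degree `t` by means of a spanning family of the part of degree `d` of the algebra. -/
theorem exists_eq_sum_family {ι : Type} [Fintype ι] {d : ℕ} {v : V} {b : ι → R} {s : ι → V}
    (hb : ∀ i, b i * ε (s i) = b i) (hspan : ∀ r ∈ 𝒜 d, ∃ c : ι → k, ε v * r = ∑ i, c i • b i)
    {x : P} (hx : x ∈ gr (t + d)) (hvx : ε v • x = x) :
    ∃ p : ι → P, (∀ i, p i ∈ gr t ∧ ε (s i) • p i = p i) ∧ x = ∑ i, b i • p i := by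
  obtain ⟨m, f, g, hg, hfg⟩ := exists_eq_sum_smul hgen x
  choose c hc using fun j => hspan (comp d (f j)) (h.comp_mem d (f j))
  refine ⟨fun i => ∑ j, (c j i • ε (s i)) • g j, fun i => ⟨?_, ?_⟩, ?_⟩
  · exact sum_mem fun j _ => zero_smul_mem hgr (Submodule.smul_mem _ _ (h.eps_mem _)) (hg j)
  · rw [Finset.smul_sum]
    refine Finset.sum_congr rfl fun j _ => ?_
    rw [smul_smul, mul_smul_comm, h.eps_mul_self]
  · have hx' : x = ∑ j, comp d (f j) • g j := by
      rw [← gradedProj_self hgr.isInternal hx, hfg, map_sum]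
      exact Finset.sum_congr rfl fun j _ => h.gradedProj_smul_of_mem hgr (hg j) d (f j)
    rw [← hvx, hx', Finset.smul_sum]
    simp only [Finset.smul_sum]
    rw [Finset.sum_comm]
    refine Finset.sum_congr rfl fun j _ => ?_
    rw [smul_smul, hc, Finset.sum_smul]
    refine Finset.sum_congr rfl fun i _ => ?_
    rw [smul_smul, mul_smul_comm, hb]

/-- A projective module that is generated in degree `t` is free over the vertices in degree `t`: a
nonzero homogeneous `b` whose source is not the source of any other term can only occur in a
relation with coefficient zero.  The coordinates of an element of degree `t` in a free module that
contains `P` cannot all have a vanishing part of degree zero, as otherwise it would lie in the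
radical of `P`, which starts in degree `t + 1`. -/
theorem eq_zero_of_sum_family [Module.Projective R P] {ι : Type} [Fintype ι] {d : ℕ} {b : ι → R}
    {s : ι → V} {p : ι → P} (hb : ∀ i, b i ∈ 𝒜 d) (hbs : ∀ i, b i * ε (s i) = b i)
    (hps : ∀ i, ε (s i) • p i = p i) (hsum : ∑ i, b i • p i = 0) {i₀ : ι} (hb₀ : b i₀ ≠ 0)
    (hs : ∀ i, i ≠ i₀ → s i ≠ s i₀) (hp : p i₀ ∈ gr t) : p i₀ = 0 := by
  obtain ⟨σ, hσ⟩ := Module.projective_def'.1 (inferInstance : Module.Projective R P)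
  have hzero : ∀ y, comp 0 (σ (p i₀) y) = 0 := by
    intro y
    have e1 : ∑ i, b i * σ (p i) y = 0 := by
      have := congrArg (fun z => σ z y) hsum
      simpa only [map_sum, map_smul, Finsupp.coe_finsetSum, Finset.sum_apply, Finsupp.smul_apply,
        smul_eq_mul, map_zero, Finsupp.zero_apply] using this
    choose c hc using fun i => h.zero_part (h.comp_mem 0 (σ (p i) y)) (s i)
    have e2 : ∀ i, comp 0 (σ (p i) y) = c i • ε (s i) := by
      intro i
      rw [← (hc i).1]
      conv_lhs => rw [← hps i, map_smul, Finsupp.smul_apply, smul_eq_mul]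
      exact h.comp_mul (h.eps_mem _) 0 _
    have e3 : ∑ i, c i • b i = 0 := by
      have := congrArg (comp d) e1
      rw [map_sum, map_zero] at this
      rw [← this]
      refine Finset.sum_congr rfl fun i _ => ?_
      rw [← add_zero d, h.comp_mul (hb i) 0, e2, mul_smul_comm, hbs]
    have e4 : c i₀ • b i₀ = 0 := by
      have := congrArg (· * ε (s i₀)) e3
      simp only [Finset.sum_mul, zero_mul] at this
      rw [Finset.sum_eq_single i₀] at this
      · rwa [smul_mul_assoc, hbs] at this
      · intro i _ hi
        rw [smul_mul_assoc, ← hbs i, mul_assoc, h.eps_mul_eps, if_neg (hs i hi), mul_zero,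
          smul_zero]
      · simp
    rw [e2, (smul_eq_zero.1 e4).resolve_right hb₀, zero_smul]
  have e5 : p i₀ = Finsupp.linearCombination R id (σ (p i₀)) := by
    conv_lhs => rw [← LinearMap.id_apply (R := R) (p i₀), ← hσ]
    rfl
  rw [← gradedProj_self hgr.isInternal hp, e5, Finsupp.linearCombination_apply, Finsupp.sum,
    map_sum]
  refine Finset.sum_eq_zero fun y _ => ?_
  rw [← h.sum_comp (σ (p i₀) y), Finset.sum_smul, map_sum]
  refine Finset.sum_eq_zero fun i _ => ?_
  rcases Nat.eq_zero_or_pos i with rfl | hi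
  · rw [hzero, zero_smul, map_zero]
  · exact h.gradedProj_pos_smul hgr hgen hi (h.comp_mem i _) _

end Generated

end IsGradedQuiverAlgebra

/-! ### Graded projective resolutions of the semisimple quotient -/

namespace IsGradedQuiverAlgebra

variable {k R : Type u} [Field k] [Ring R] [Algebra k R] {V : Type}
    [AddCommGroup V] [Fintype V] [DecidableEq V] {st : Fin 3 → V} {𝒜 : ℕ → Submodule k R}
    {ε : V → R} {a : Fin 3 → V → R} {comp : ℕ → R →+ R}

/-- The arrows into `v` span `ε v 𝒜 1`. -/
theorem arrow_family (h : IsGradedQuiverAlgebra st 𝒜 ε a comp) (v : V) {r : R} (hr : r ∈ 𝒜 1) :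
    ∃ c : Fin 3 → k, ε v * r = ∑ x, c x • a x (v - st x) := by
  replace hr := h.succ_le 0 hr
  induction hr using Submodule.span_induction with
  | mem r hr =>
    obtain ⟨x, w, r, hr, rfl⟩ := hr
    obtain ⟨c, hc, -⟩ := h.zero_part hr w
    have e : a x w * r = c • a x w := by
      rw [← h.arrow_eps x w, mul_assoc, hc, mul_smul_comm]
    by_cases hv : v = w + st x
    · refine ⟨Pi.single x c, ?_⟩
      rw [e, Finset.sum_eq_single x]
      · subst hv; simp [h.eps_arrow]
      · intro y _ hy; simp [hy]
      · simp
    · exact ⟨0, by rw [e, mul_smul_comm, h.eps_mul_arrow, if_neg hv]; simp⟩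
  | zero => exact ⟨0, by simp⟩
  | add r r' _ _ h1 h2 =>
    obtain ⟨c, hc⟩ := h1
    obtain ⟨c', hc'⟩ := h2
    exact ⟨c + c', by simp [mul_add, hc, hc', add_smul, Finset.sum_add_distrib]⟩
  | smul c r _ h1 =>
    obtain ⟨c', hc'⟩ := h1
    exact ⟨c • c', by simp [hc', Finset.smul_sum, smul_smul]⟩

theorem mem_arrow_family (h : IsGradedQuiverAlgebra st 𝒜 ε a comp) (v : V) (x : Fin 3) :
    a x (v - st x) * ε (v - st x) = a x (v - st x) := h.arrow_eps _ _

theorem comp_zero_of_mem_positivePart (h : IsGradedQuiverAlgebra st 𝒜 ε a comp) {r : R}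
    (hr : r ∈ positivePart 𝒜) : comp 0 r = 0 := by
  induction hr using Submodule.span_induction with
  | mem r hr =>
    obtain ⟨n, hn, hr⟩ := hr
    rw [h.comp_of_mem 0 n r hr, if_neg hn.ne]
  | zero => simp
  | add x y _ _ hx hy => rw [map_add, hx, hy, add_zero]
  | smul c x _ hx => rw [smul_eq_mul, h.comp_mul_lowest (by simp), hx, mul_zero]

theorem sub_comp_zero_mem (h : IsGradedQuiverAlgebra st 𝒜 ε a comp) (r : R) :
    r - comp 0 r ∈ positivePart 𝒜 := by
  have : r - comp 0 r = ∑ n ∈ Finset.range 3, comp (n + 1) r := by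
    have := h.sum_comp r
    rw [Finset.sum_range_succ'] at this
    exact sub_eq_of_eq_add this.symm
  rw [this]
  exact Submodule.sum_mem _ fun n _ =>
    Submodule.subset_span ⟨n + 1, Nat.succ_pos n, h.comp_mem _ _⟩

section Resolution

variable (h : IsGradedQuiverAlgebra st 𝒜 ε a comp)
  (F : GradedProjectiveResolution 𝒜 (R ⧸ positivePart 𝒜) (degreeZeroGrading _))

theorem d_comp_d (t : ℕ) (x : F.P (t + 2)) : F.d t (F.d (t + 1) x) = 0 :=
  (F.exact_succ t _).2 ⟨x, rfl⟩

theorem mem_ker_iff (t : ℕ) (x : F.P t) : x ∈ F.ker t ↔ ∃ y, F.d t y = x := by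
  cases t with
  | zero => exact F.exact_zero x
  | succ t => exact F.exact_succ t x

include h

/-- Homogeneous cycles are boundaries of homogeneous elements of the same degree and end. -/
theorem exists_preimage {t n : ℕ} {x : F.P t} (hx : x ∈ F.ker t) (hxn : x ∈ F.gr t n) {v : V}
    (hv : ε v • x = x) : ∃ y ∈ F.gr (t + 1) n, ε v • y = y ∧ F.d t y = x := by
  obtain ⟨y, rfl⟩ := (mem_ker_iff F t x).1 hx
  refine ⟨ε v • gradedProj (F.isModuleGrading (t + 1)).isInternal n y, ?_, ?_, ?_⟩
  · exact zero_smul_mem (F.isModuleGrading (t + 1)) (h.eps_mem v) (gradedProj_mem _ _ _)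
  · rw [smul_smul, h.eps_mul_self]
  · rw [map_smul]
    have := gradedProj_map (F.isModuleGrading (t + 1)).isInternal (F.isModuleGrading t).isInternal
      (F.d t).toAddMonoidHom (F.d_mem t) n y
    refine (congrArg (ε v • ·) this.symm).trans ?_
    refine (congrArg (ε v • ·) (gradedProj_self _ hxn)).trans hv

variable {q : ℕ∞} (hgen : ∀ t : ℕ, (t : ℕ∞) ≤ q → Submodule.span R (F.gr t t : Set (F.P t)) = ⊤)
  (hker : ∀ t : ℕ, (t : ℕ∞) = q → ∀ x ∈ F.ker t, x ∈ F.gr t (t + 3))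
include hgen hker

/-- The differentials of a linear resolution are injective in the generating degrees. -/
theorem eq_zero_of_mem_ker {t : ℕ} (ht : (t : ℕ∞) ≤ q) {x : F.P t} (hx : x ∈ F.ker t)
    (hxt : x ∈ F.gr t t) : x = 0 := by
  rcases ht.eq_or_lt with hq | hq
  · exact eq_zero_of_mem_gr (F.isModuleGrading t).isInternal (by omega) hxt (hker t hq x hx)
  · obtain ⟨y, rfl⟩ := (mem_ker_iff F t x).1 hx
    have := gradedProj_map (F.isModuleGrading (t + 1)).isInternal (F.isModuleGrading t).isInternal
      (F.d t).toAddMonoidHom (F.d_mem t) t y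
    rw [h.gradedProj_of_lt (F.isModuleGrading (t + 1))
      (hgen (t + 1) (by exact_mod_cast Order.add_one_le_of_lt hq)) (Nat.lt_succ_self t),
      map_zero] at this
    rw [← this]
    exact (gradedProj_self _ hxt).symm

/-- The degree zero part of the first term of the resolution has a basis indexed by the
vertices. -/
theorem exists_generators :
    ∃ p₀ : V → F.P 0, (∀ v, p₀ v ∈ F.gr 0 0 ∧ ε v • p₀ v = p₀ v ∧ p₀ v ≠ 0 ∧
      ∀ n, 0 < n → ∀ r ∈ 𝒜 n, r • p₀ v ∈ F.ker 0) ∧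
      ∀ v, ∀ x ∈ F.gr 0 0, ε v • x = x → ∃ c : k, x = (c • ε v) • p₀ v := by
  have hp : ∀ v, ∃ p ∈ F.gr 0 0, ε v • p = p ∧
      F.ε p = Submodule.Quotient.mk (p := positivePart 𝒜) (ε v) := by
    intro v
    obtain ⟨p, hp⟩ := F.ε_surjective (Submodule.Quotient.mk (ε v))
    have hp0 : F.ε (gradedProj (F.isModuleGrading 0).isInternal 0 p) = F.ε p := by
      obtain ⟨S, hS⟩ := exists_eq_sum_gradedProj (F.isModuleGrading 0).isInternal p
      have hpos : ∀ n, n ≠ 0 → F.ε (gradedProj (F.isModuleGrading 0).isInternal n p) = 0 := by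
        intro n hn
        have := F.ε_mem n _ (gradedProj_mem (F.isModuleGrading 0).isInternal n p)
        rw [degreeZeroGrading, if_neg hn] at this
        exact this
      by_cases h0 : 0 ∈ S
      · conv_rhs => rw [hS, map_sum]
        rw [Finset.sum_eq_single_of_mem 0 h0]
        intro n _ hn
        exact hpos n hn
      · have h1 : gradedProj (F.isModuleGrading 0).isInternal 0 p = 0 := by
          conv_lhs => rw [hS, map_sum]
          refine Finset.sum_eq_zero fun n hn => ?_
          rw [gradedProj_of_mem _ 0 (gradedProj_mem _ n p), if_neg]
          rintro rfl
          exact h0 hn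
        rw [h1, map_zero]
        conv_rhs => rw [hS, map_sum]
        refine (Finset.sum_eq_zero fun n hn => hpos n ?_).symm
        rintro rfl
        exact h0 hn
    refine ⟨ε v • gradedProj (F.isModuleGrading 0).isInternal 0 p,
      zero_smul_mem (F.isModuleGrading 0) (h.eps_mem v) (gradedProj_mem _ _ _), ?_, ?_⟩
    · rw [smul_smul, h.eps_mul_self]
    · rw [map_smul, hp0, hp, ← Submodule.Quotient.mk_smul, smul_eq_mul, h.eps_mul_self]
  choose p₀ hp₀ hpv hpε using hp
  have hne : ∀ v, p₀ v ≠ 0 := by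
    intro v h0
    have h1 := hpε v
    rw [h0, map_zero, eq_comm, Submodule.Quotient.mk_eq_zero] at h1
    have h2 := h.comp_zero_of_mem_positivePart h1
    rw [h.comp_self (h.eps_mem v)] at h2
    exact h.eps_ne v h2
  refine ⟨p₀, fun v => ⟨hp₀ v, hpv v, hne v, ?_⟩, ?_⟩
  · intro n hn r hr
    change F.ε (r • p₀ v) = 0
    rw [map_smul, hpε, ← Submodule.Quotient.mk_smul, Submodule.Quotient.mk_eq_zero, smul_eq_mul]
    refine Submodule.subset_span ⟨n, hn, h.mul_eps_mem hr v⟩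
  · intro v x hx hxv
    obtain ⟨r, hr⟩ := Submodule.Quotient.mk_surjective _ (F.ε x)
    obtain ⟨c, hc, -⟩ := h.zero_part (h.comp_mem 0 r) v
    refine ⟨c, sub_eq_zero.1 (h.eq_zero_of_mem_ker F hgen hker (t := 0) (by simp) ?_ ?_)⟩
    · change F.ε (x - (c • ε v) • p₀ v) = 0
      rw [map_sub, map_smul, hpε, ← hxv, map_smul, ← hr, ← Submodule.Quotient.mk_smul,
        ← Submodule.Quotient.mk_smul, ← Submodule.Quotient.mk_sub, Submodule.Quotient.mk_eq_zero,
        smul_eq_mul, smul_eq_mul, smul_mul_assoc, h.eps_mul_self, ← hc, ← mul_sub]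
      exact Ideal.mul_mem_left _ _ (h.sub_comp_zero_mem r)
    · exact sub_mem hx (zero_smul_mem (F.isModuleGrading 0)
        (Submodule.smul_mem _ _ (h.eps_mem v)) (hp₀ v))

/-- If the second syzygies of the simple modules are generated in degree two, the third power of the
third letter is not a multiple of a path that starts with another letter: all relations of degree
two are homogeneous in the letters. -/
theorem cube_ne_smul (hq : 2 ≤ q) (hst : SeparatesShortWords st) (v : V)
    (hne : word st ε a v [2, 2, 2] ≠ 0) {x : Fin 3} (hx : x ≠ 2) {l : List (Fin 3)}
    (hl : l.length = 2) (hd : v + st x + disp st l = v + disp st [2, 2, 2]) (c : k) :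
    word st ε a v [2, 2, 2] ≠ c • (word st ε a (v + st x) l * a x v) := by
  intro heq
  obtain ⟨j, rfl⟩ : ∃ j, v = j - st 2 - st 2 - st 2 := ⟨v + st 2 + st 2 + st 2, by abel⟩
  set v₀ := j - st 2 - st 2 - st 2 with hv₀
  have hword : word st ε a v₀ [2, 2, 2] =
      a 2 (j - st 2) * (a 2 (j - st 2 - st 2) * a 2 v₀) := by
    have e1 : v₀ + (st 2 + st 2) = j - st 2 := by rw [hv₀]; abel
    have e2 : v₀ + st 2 = j - st 2 - st 2 := by rw [hv₀]; abel
    simp only [word, disp, e1, e2, add_zero, h.arrow_eps]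
  have hj : v₀ + st x + disp st l = j := by
    rw [hd, hv₀]; simp only [disp]; abel
  set w := word st ε a (v₀ + st x) l with hw
  have hwm : w ∈ 𝒜 2 := by rw [hw, ← hl]; exact h.word_mem _ _
  have hwe : w * ε (v₀ + st x) = w := h.word_mul_eps _ _
  have hjw : ε j * w = w := by rw [← hj]; exact h.eps_mul_word _ _
  rw [hword] at heq hne
  have hne1 : a 2 (j - st 2) * a 2 (j - st 2 - st 2) ≠ 0 := fun h0 => hne (by
    rw [← mul_assoc, h0, zero_mul])
  have hne2 : a 2 (j - st 2 - st 2) * a 2 v₀ ≠ 0 := fun h0 => hne (by rw [h0, mul_zero])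
  have m2 : ∀ x v y w, a x v * a y w ∈ 𝒜 2 := fun x v y w =>
    h.mul_mem 1 1 _ _ (h.arrow_mem x v) (h.arrow_mem y w)
  obtain ⟨p₀, hp₀, -⟩ := h.exists_generators F hgen hker
  obtain ⟨hp, hpv, hpne, hpk⟩ := hp₀ v₀
  have lift : ∀ y, ∃ p ∈ F.gr 1 1, ε (v₀ + st y) • p = p ∧ F.d 0 p = a y v₀ • p₀ v₀ := by
    intro y
    refine h.exists_preimage F (hpk 1 one_pos _ (h.arrow_mem y v₀))
      ((F.isModuleGrading 0).smul_mem 1 0 _ _ (h.arrow_mem y v₀) hp) ?_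
    rw [smul_smul, h.eps_arrow]
  obtain ⟨p₁, hp₁, hpv₁, hpd₁⟩ := lift 2
  obtain ⟨p₂, hp₂, hpv₂, hpd₂⟩ := lift x
  have hv1 : v₀ + st 2 = j - st 2 - st 2 := by rw [hv₀]; abel
  rw [hv1] at hpv₁
  -- The relation of degree three lifts to an element `z` of the second syzygy.
  obtain ⟨y, hy, hyv, hyd⟩ : ∃ y ∈ F.gr 2 3, ε j • y = y ∧ F.d 1 y =
      (a 2 (j - st 2) * a 2 (j - st 2 - st 2)) • p₁ - (c • w) • p₂ := by
    refine h.exists_preimage F ?_ ?_ ?_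
    · change F.d 0 _ = 0
      rw [map_sub, map_smul, map_smul, hpd₁, hpd₂, smul_smul, smul_smul, mul_assoc, heq,
        smul_mul_assoc, sub_self]
    · exact sub_mem ((F.isModuleGrading 1).smul_mem 2 1 _ _ (m2 _ _ _ _) hp₁)
        ((F.isModuleGrading 1).smul_mem 2 1 _ _ (Submodule.smul_mem _ _ hwm) hp₂)
    · rw [smul_sub, smul_smul, smul_smul, mul_smul_comm, hjw, ← mul_assoc, h.eps_mul_arrow,
        if_pos (by abel)]
  have step1 : ∀ (t : ℕ), (t : ℕ∞) ≤ q → ∀ (v : V) (z : F.P t), z ∈ F.gr t (t + 1) → ε v • z = z →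
      ∃ p : Fin 3 → F.P t, (∀ i, p i ∈ F.gr t t ∧ ε (v - st i) • p i = p i) ∧
        z = ∑ i, a i (v - st i) • p i := fun t ht v z hz hvz =>
    h.exists_eq_sum_family (F.isModuleGrading t) (hgen t ht) (h.mem_arrow_family v)
      (fun r hr => h.arrow_family v hr) hz hvz
  have q0 : ((0 : ℕ) : ℕ∞) ≤ q := by simp
  have q1 : ((1 : ℕ) : ℕ∞) ≤ q := le_trans (by norm_num) hq
  obtain ⟨g, hg, hyg⟩ := step1 2 (by exact_mod_cast hq) j y hy hyv
  have hdg : ∀ i, F.d 1 (g i) ∈ F.gr 1 2 ∧ ε (j - st i) • F.d 1 (g i) = F.d 1 (g i) := fun i =>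
    ⟨F.d_mem 1 2 _ (hg i).1, by rw [← map_smul, (hg i).2]⟩
  choose e he hge using fun i => step1 1 q1 (j - st i) _ (hdg i).1 (hdg i).2
  -- The element of degree three comes from `∑ i, a i • g i` with `g i` in degree two, and the
  -- differential of `g i` is `∑ i', a i' • e i i'`.  Comparing the coefficients of the path `γ γ`,
  -- whose source is not the source of any other path of length two with the same end, gives `e 2 2 = p₁`.
  have hproj := F.projective
  have hp1e : e 2 2 = p₁ := by
    have := hproj 1
    have := h.eq_zero_of_sum_family (F.isModuleGrading 1) (hgen 1 q1) (ι := Option (Fin 3 × Fin 3))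
      (d := 2) (i₀ := some (2, 2))
      (b := fun i => i.elim (c • w) fun i => a i.1 (j - st i.1) * a i.2 (j - st i.1 - st i.2))
      (s := fun i => i.elim (v₀ + st x) fun i => j - st i.1 - st i.2)
      (p := fun i => i.elim p₂ fun i => e i.1 i.2 - if i = (2, 2) then p₁ else 0)
      ?_ ?_ ?_ ?_ hne1 ?_ ?_
    · simpa [sub_eq_zero] using this
    · rintro (_ | ⟨i, i'⟩)
      · exact Submodule.smul_mem _ _ hwm
      · exact m2 _ _ _ _
    · rintro (_ | ⟨i, i'⟩)
      · simp [hwe]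
      · simp [mul_assoc, h.arrow_eps]
    · rintro (_ | ⟨i, i'⟩)
      · simpa using hpv₂
      · by_cases hi : (i, i') = (2, 2)
        · obtain ⟨rfl, rfl⟩ := Prod.mk.inj hi
          simp [smul_sub, (he 2 2).2, hpv₁]
        · simp only [Option.elim, if_neg hi, sub_zero, (he i i').2]
    · rw [Fintype.sum_option, Fintype.sum_prod_type]
      have e1 : F.d 1 y = ∑ i, ∑ i', (a i (j - st i) * a i' (j - st i - st i')) • e i i' := by
        rw [hyg, map_sum]
        refine Finset.sum_congr rfl fun i _ => ?_
        rw [map_smul, hge, Finset.smul_sum]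
        simp only [smul_smul]
      rw [hyd] at e1
      simp only [Option.elim, smul_sub, Finset.sum_sub_distrib, ← e1]
      have e2 : ∑ i : Fin 3, ∑ i' : Fin 3, (a i (j - st i) * a i' (j - st i - st i')) •
          (if (i, i') = ((2 : Fin 3), (2 : Fin 3)) then p₁ else 0) =
          (a 2 (j - st 2) * a 2 (j - st 2 - st 2)) • p₁ := by
        rw [Finset.sum_eq_single 2, Finset.sum_eq_single 2]
        · simp
        · intro i _ hi; simp [hi]
        · simp
        · intro i _ hi; simp [hi]
        · simp
      rw [e2]; abel
    · rintro (_ | ⟨i, i'⟩) hi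
      · simp only [Option.elim]
        rw [← hv1]
        exact fun h0 => hx (hst.injective (add_left_cancel h0))
      · intro h0
        simp only [Option.elim, sub_sub, sub_right_inj] at h0
        obtain ⟨rfl, rfl⟩ := hst.eq_two h0
        exact hi rfl
    · simpa using sub_mem (he 2 2).1 hp₁
  -- As `F.d 1 (g 2)` is a cycle, the same comparison one step further down shows that the generator
  -- `p₀ v₀` vanishes.
  have hde : ∀ i, F.d 0 (e 2 i) ∈ F.gr 0 1 ∧
      ε (j - st 2 - st i) • F.d 0 (e 2 i) = F.d 0 (e 2 i) := fun i =>
    ⟨F.d_mem 0 1 _ (he 2 i).1, by rw [← map_smul, (he 2 i).2]⟩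
  choose f hf hef using fun i => step1 0 q0 (j - st 2 - st i) _ (hde i).1 (hde i).2
  refine hpne ?_
  have := hproj 0
  refine h.eq_zero_of_sum_family (F.isModuleGrading 0) (hgen 0 q0) (ι := Fin 3 × Fin 3)
      (d := 2) (i₀ := (2, 2))
      (b := fun i => a i.1 (j - st 2 - st i.1) * a i.2 (j - st 2 - st i.1 - st i.2))
      (s := fun i => j - st 2 - st i.1 - st i.2)
      (p := fun i => if i.1 = 2 then (if i.2 = 2 then p₀ v₀ else 0) else f i.1 i.2)
      ?_ ?_ ?_ ?_ hne2 ?_ hp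
  · exact fun i => m2 _ _ _ _
  · intro i
    rw [mul_assoc, h.arrow_eps]
  · rintro ⟨i, i'⟩
    by_cases hi : i = 2
    · subst hi
      by_cases hi' : i' = 2
      · subst hi'; simpa using hpv
      · simp [hi']
    · simp [hi, (hf i i').2]
  · have e1 : F.d 0 (F.d 1 (g 2)) = 0 := d_comp_d F 0 (g 2)
    rw [hge, map_sum] at e1
    refine Eq.trans ?_ e1
    rw [Fintype.sum_prod_type]
    refine Finset.sum_congr rfl fun i _ => ?_
    rw [map_smul]
    by_cases hi : i = 2
    · subst hi
      rw [hp1e, hpd₁, Finset.sum_eq_single 2, smul_smul]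
      · simp [hv₀]
      · intro i _ hi; simp [hi]
      · simp
    · rw [hef, Finset.smul_sum]
      simp only [hi, if_false, smul_smul]
  · rintro ⟨i, i'⟩ hi h0
    simp only [sub_sub, sub_right_inj, add_assoc] at h0
    have h0 : st i + st i' = st 2 + st 2 := add_left_cancel h0
    obtain ⟨rfl, rfl⟩ := hst.eq_two h0
    exact hi rfl

end Resolution

end IsGradedQuiverAlgebra

/-! ### The Frobenius structure -/

theorem fin_three_cases {x y : Fin 3} (hxy : x ≠ y) :
    (x = 0 ∧ y = 1 ∧ -x - y = 2) ∨ (x = 1 ∧ y = 0 ∧ -x - y = 2) ∨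
    (x = 0 ∧ y = 2 ∧ -x - y = 1) ∨ (x = 2 ∧ y = 0 ∧ -x - y = 1) ∨
    (x = 1 ∧ y = 2 ∧ -x - y = 0) ∨ (x = 2 ∧ y = 1 ∧ -x - y = 0) := by
  revert x y; decide

theorem step_add_third {V : Type} [AddCommGroup V] {st : Fin 3 → V}
    (h0 : st 0 + st 1 + st 2 = 0) {x y : Fin 3} (hxy : x ≠ y) :
    st x + st y + st (-x - y) = 0 := by
  rcases fin_three_cases hxy with ⟨rfl, rfl, h⟩ | ⟨rfl, rfl, h⟩ | ⟨rfl, rfl, h⟩ | ⟨rfl, rfl, h⟩ |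
    ⟨rfl, rfl, h⟩ | ⟨rfl, rfl, h⟩ <;> rw [h, ← h0] <;> abel

namespace IsGradedQuiverAlgebra

variable {k R : Type u} [Field k] [Ring R] [Algebra k R] {V : Type}
    [AddCommGroup V] [Fintype V] [DecidableEq V] {st : Fin 3 → V} {𝒜 : ℕ → Submodule k R}
    {ε : V → R} {a : Fin 3 → V → R} {comp : ℕ → R →+ R}

/-- The structure of a self-injective graded quiver algebra in which every socle is spanned by a
closed path of length three: `ω v` spans the socle of `R ε v`, the elements `U z v`, which lead from
`v + st z` back to `v`, are dual to the arrows, and `p v x y` is the coordinate with respect to `U`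
of the path that leaves `v` along the letter `x` and continues along the letter `y`.  In `Fin 3`,
the letter different from `x ≠ y` is `-x - y`. -/
structure IsFrobenius (st : Fin 3 → V) (𝒜 : ℕ → Submodule k R) (ε : V → R) (a : Fin 3 → V → R)
    (U : Fin 3 → V → R) (ω : V → R) (p : V → Fin 3 → Fin 3 → k) : Prop where
  omega_mem : ∀ v, ω v ∈ 𝒜 3
  omega_ne : ∀ v, ω v ≠ 0
  eps_omega : ∀ v, ε v * ω v = ω v
  omega_eps : ∀ v, ω v * ε v = ω v
  U_mem : ∀ z v, U z v ∈ 𝒜 2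
  eps_U : ∀ z v, ε v * U z v = U z v
  U_eps : ∀ z v, U z v * ε (v + st z) = U z v
  U_mul_arrow : ∀ z v, U z v * a z v = ω v
  arrow_mul_arrow : ∀ v x y, a y (v + st x) * a x v = p v x y • U (-x - y) (v + st x + st y)
  p_self : ∀ v x, p v x x = 0
  three_eq_zero : ∀ r ∈ 𝒜 3, ∀ v w, v ≠ w → ε v * r * ε w = 0
  eq_smul_omega : ∀ r ∈ 𝒜 3, ∀ v, ε v * r = r → r * ε v = r → ∃ c : k, r = c • ω v

/-- If every arrow at every vertex can be completed to a socle element that is a closed path of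
length three, the algebra has a Frobenius structure. -/
theorem exists_isFrobenius (h : IsGradedQuiverAlgebra st 𝒜 ε a comp)
    (hinj : Module.Injective R R) (hst : SeparatesShortWords st) (h0 : st 0 + st 1 + st 2 = 0)
    (hclosed : ∀ v x, ∃ l : List (Fin 3), l.length = 2 ∧
      IsSocleElt 𝒜 ε a v v 3 (word st ε a (v + st x) l * a x v)) :
    ∃ (U : Fin 3 → V → R) (ω : V → R) (p : V → Fin 3 → Fin 3 → k),
      IsFrobenius st 𝒜 ε a U ω p := by
  choose l hl hsoc using hclosed
  let ω : V → R := fun v => word st ε a (v + st 0) (l v 0) * a 0 v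
  have hω : ∀ v, IsSocleElt 𝒜 ε a v v 3 (ω v) := fun v => hsoc v 0
  choose c hc0 hc using fun v z => ((hω v).unique h hinj (hsoc v z)).2.2
  let U : Fin 3 → V → R := fun z v => c v z • word st ε a (v + st z) (l v z)
  have hUω : ∀ z v, U z v * a z v = ω v := fun z v => by
    rw [hc v z, ← smul_mul_assoc]
  have hUmem : ∀ z v, U z v ∈ 𝒜 2 := fun z v => by
    have := h.word_mem (v + st z) (l v z)
    rw [hl] at this
    exact Submodule.smul_mem _ _ this
  have hUeps : ∀ z v, U z v * ε (v + st z) = U z v := fun z v => by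
    simp only [U, smul_mul_assoc, h.word_mul_eps]
  have hepsU : ∀ z v, ε v * U z v = U z v := by
    intro z v
    have hend : v = v + st z + disp st (l v z) := by
      by_contra hne
      apply (hsoc v z).ne_zero
      rw [← (hsoc v z).eps_mul, ← h.eps_mul_word, ← mul_assoc, ← mul_assoc, h.eps_mul_eps,
        if_neg hne, zero_mul, zero_mul]
    simp only [U, mul_smul_comm]
    congr 1
    conv_lhs => enter [1]; rw [hend]
    exact h.eps_mul_word _ _
  have hkill : ∀ r ∈ 𝒜 3, ∀ x v, a x v * r = 0 := by
    intro r hr x v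
    have := h.mul_mem 1 3 _ _ (h.arrow_mem x v) hr
    rwa [h.eq_bot _ (by omega), Submodule.mem_bot] at this
  have hsoc3 : ∀ r ∈ 𝒜 3, ∀ v w, ε v * r * ε w ≠ 0 →
      IsSocleElt 𝒜 ε a w v 3 (ε v * r * ε w) := by
    intro r hr v w hne
    have hm := h.mul_eps_mem (h.eps_mul_mem hr v) w
    exact ⟨hne, hm, by rw [← mul_assoc, ← mul_assoc, h.eps_mul_self], by
      rw [mul_assoc, h.eps_mul_self], hkill _ hm⟩
  have hthree : ∀ r ∈ 𝒜 3, ∀ v w, v ≠ w → ε v * r * ε w = 0 := by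
    intro r hr v w hvw
    by_contra hne
    exact hvw ((hsoc3 r hr v w hne).unique h hinj (hω w)).1
  have hone : ∀ r ∈ 𝒜 3, ∀ v, ε v * r = r → r * ε v = r → ∃ c : k, r = c • ω v := by
    intro r hr v h1 h2
    by_cases hr0 : r = 0
    · exact ⟨0, by rw [hr0, zero_smul]⟩
    · obtain ⟨-, -, c, -, hc⟩ := (hsoc3 r hr v v (by rwa [h1, h2])).unique h hinj (hω v)
      rw [h1, h2] at hc
      exact ⟨c, hc⟩
  -- An element of degree two is determined by its products with arrows, as the socle has degree
  -- three.
  have htwo : ∀ r ∈ 𝒜 2, ∀ i j, ε j * r = r → r * ε i = r → (∀ z, a z j * r = 0) → r = 0 := by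
    intro r hr i j h1 h2 h3
    by_contra hne
    have : IsSocleElt 𝒜 ε a i j 2 r := ⟨hne, hr, h1, h2, fun z v => by
      by_cases hv : v = j
      · rw [hv, h3]
      · rw [← h1, ← mul_assoc, h.arrow_mul_eps, if_neg hv, zero_mul]⟩
    have := (this.unique h hinj (hω i)).2.1
    omega
  -- Only the arrow with the third letter can close a path along `x` and `y`; if `x = y` there is
  -- none.
  have harrow : ∀ v x y, ∃ c : k, a y (v + st x) * a x v = c • U (-x - y) (v + st x + st y) ∧
      (x = y → c = 0) := by
    intro v x y
    set j := v + st x + st y with hj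
    have hm : a y (v + st x) * a x v ∈ 𝒜 2 := h.mul_mem 1 1 _ _ (h.arrow_mem _ _) (h.arrow_mem _ _)
    have hem : ε j * (a y (v + st x) * a x v) = a y (v + st x) * a x v := by
      rw [← mul_assoc, h.eps_arrow]
    have hme : a y (v + st x) * a x v * ε v = a y (v + st x) * a x v := by
      rw [mul_assoc, h.arrow_eps]
    have hend : ∀ z r, r ∈ 𝒜 2 → r * ε v = r → j + st z ≠ v → a z j * r = 0 := by
      intro z r hr hrv hne
      have h1 := h.mul_mem 1 2 _ _ (h.arrow_mem z j) hr
      rw [← hthree _ h1 _ _ hne, ← mul_assoc, h.eps_arrow, mul_assoc, hrv]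
    by_cases hxy : x = y
    · refine ⟨0, ?_, fun _ => rfl⟩
      rw [zero_smul]
      refine htwo _ hm v j hem hme fun z => hend z _ hm hme fun hz => ?_
      have h1 : disp st [x, y, z] = 0 := by
        rw [hj, add_assoc, add_assoc, add_eq_left] at hz
        simpa [disp] using hz
      have h2 := hst.count_eq h0 (l := [x, y, z]) rfl h1 x
      rw [hxy] at h2
      simp at h2
    · have hclose : j + st (-x - y) = v := by
        rw [hj, add_assoc, add_assoc, ← add_assoc (st x), step_add_third h0 hxy, add_zero]
      have hend' : ∀ z r, r ∈ 𝒜 2 → r * ε v = r → z ≠ -x - y → a z j * r = 0 := by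
        intro z r hr hrv hz
        refine hend z r hr hrv fun h1 => hz (hst.injective ?_)
        rw [← hclose] at h1
        exact add_left_cancel h1
      have hUv : U (-x - y) j * ε v = U (-x - y) j := by
        rw [← hclose]; exact hUeps _ _
      have hcoeff : ∀ r, r ∈ 𝒜 2 → r * ε v = r → ∃ c : k, a (-x - y) j * r = c • ω v := by
        intro r hr hrv
        refine hone _ (h.mul_mem 1 2 _ _ (h.arrow_mem _ _) hr) v ?_ (by rw [mul_assoc, hrv])
        rw [← mul_assoc, ← hclose, h.eps_arrow]
      obtain ⟨d, hd⟩ := hcoeff _ hm hme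
      obtain ⟨d', hd'⟩ := hcoeff _ (hUmem (-x - y) j) hUv
      have hd0 : d' ≠ 0 := by
        intro h1
        rw [h1, zero_smul] at hd'
        have : U (-x - y) j = 0 := by
          refine htwo _ (hUmem _ _) v j (hepsU _ _) hUv fun z => ?_
          by_cases hz : z = -x - y
          · rw [hz, hd']
          · exact hend' z _ (hUmem _ _) hUv hz
        have h2 := hUω (-x - y) j
        rw [this, zero_mul] at h2
        exact (hω j).ne_zero h2.symm
      refine ⟨d / d', ?_, fun h1 => absurd h1 hxy⟩
      rw [← sub_eq_zero]
      have hm' := sub_mem hm (Submodule.smul_mem _ (d / d') (hUmem (-x - y) j))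
      have hv' : (a y (v + st x) * a x v - (d / d') • U (-x - y) j) * ε v =
          a y (v + st x) * a x v - (d / d') • U (-x - y) j := by
        rw [sub_mul, hme, smul_mul_assoc, hUv]
      refine htwo _ hm' v j (by rw [mul_sub, hem, mul_smul_comm, hepsU]) hv' fun z => ?_
      by_cases hz : z = -x - y
      · rw [hz, mul_sub, hd, mul_smul_comm, hd', smul_smul, div_mul_cancel₀ _ hd0, sub_self]
      · exact hend' z _ hm' hv' hz
  choose p hp hp0 using harrow
  exact ⟨U, ω, p, fun v => (hω v).mem, fun v => (hω v).ne_zero, fun v => (hω v).eps_mul,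
    fun v => (hω v).mul_eps, hUmem, hepsU, hUeps, hUω, hp, fun v x => hp0 v x x rfl, hthree, hone⟩

section Frobenius

variable {U : Fin 3 → V → R} {ω : V → R} {p : V → Fin 3 → Fin 3 → k}
  (h : IsGradedQuiverAlgebra st 𝒜 ε a comp) (hF : IsFrobenius st 𝒜 ε a U ω p)
include hF

omit [Fintype V] [DecidableEq V] in
theorem IsFrobenius.U_ne (z : Fin 3) (v : V) : U z v ≠ 0 := fun h0 =>
  hF.omega_ne v (by rw [← hF.U_mul_arrow z v, h0, zero_mul])

omit [Fintype V] [DecidableEq V] in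
/-- If two consecutive arrows of a closed path of length three compose to zero, then so do the next
two. -/
theorem IsFrobenius.p_rotate (h0 : st 0 + st 1 + st 2 = 0) {v : V} {x y : Fin 3} (hxy : x ≠ y)
    (hp : p v x y = 0) : p (v + st x) y (-x - y) = 0 := by
  have e1 := hF.arrow_mul_arrow v x y
  rw [hp, zero_smul] at e1
  have e2 := hF.arrow_mul_arrow (v + st x) y (-x - y)
  have hclose : v + st x + st y + st (-x - y) = v := by
    rw [add_assoc, add_assoc, ← add_assoc (st x), step_add_third h0 hxy, add_zero]
  rw [show -y - (-x - y) = x by abel, hclose] at e2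
  have e3 := congrArg (· * a x v) e2
  simp only [smul_mul_assoc, hF.U_mul_arrow] at e3
  rw [mul_assoc, e1, mul_zero] at e3
  exact (smul_eq_zero.1 e3.symm).resolve_right (hF.omega_ne v)

include h

theorem IsFrobenius.U_mul_arrow_of_ne (hst : Function.Injective st) {z x : Fin 3} (hzx : x ≠ z)
    (v : V) : U z v * a x (v + st z - st x) = 0 := by
  have hm := h.mul_mem 2 1 _ _ (hF.U_mem z v) (h.arrow_mem x (v + st z - st x))
  rw [← hF.three_eq_zero _ hm v (v + st z - st x), mul_assoc, mul_assoc, h.arrow_eps,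
    ← mul_assoc, hF.eps_U]
  intro h1
  rw [eq_sub_iff_add_eq] at h1
  exact hzx (hst (add_left_cancel h1))

/-- Both bracketings of a closed path of length three: the coordinates of its last two arrows and
those of its first two arrows differ by a factor that depends on the last arrow only. -/
theorem IsFrobenius.exists_p_eq_mul (h0 : st 0 + st 1 + st 2 = 0) :
    ∃ σ : Fin 3 → V → k, ∀ j x z, p (j + st z) (-x - z) x = σ x j * p j z (-x - z) := by
  have H : ∀ x j, ∃ c : k, a x (j - st x) * U x (j - st x) = c • ω j := by
    intro x j
    refine hF.eq_smul_omega _ (h.mul_mem 1 2 _ _ (h.arrow_mem _ _) (hF.U_mem _ _)) j ?_ ?_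
    · have := h.eps_arrow x (j - st x)
      rw [sub_add_cancel] at this
      rw [← mul_assoc, this]
    · have := hF.U_eps x (j - st x)
      rw [sub_add_cancel] at this
      rw [mul_assoc, this]
  choose σ hσ using H
  refine ⟨σ, fun j x z => ?_⟩
  by_cases hxz : x = z
  · have : -x - z = x := by subst hxz; revert x; decide
    rw [this, ← hxz, hF.p_self, hF.p_self, mul_zero]
  · have hj : j + st z + st (-x - z) = j - st x := by
      rw [eq_sub_iff_add_eq, add_assoc, add_assoc, add_comm (st (-x - z)), ← add_assoc (st z),
        add_comm (st z), step_add_third h0 hxz, add_zero]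
    have e1 := hF.arrow_mul_arrow (j + st z) (-x - z) x
    have e2 := hF.arrow_mul_arrow j z (-x - z)
    rw [hj, show -z - (-x - z) = x by abel] at e2
    rw [hj, sub_add_cancel, show -(-x - z) - x = z by abel] at e1
    have e3 := congrArg (· * a z j) e1
    simp only [smul_mul_assoc, hF.U_mul_arrow] at e3
    rw [mul_assoc, e2, mul_smul_comm, hσ, smul_smul] at e3
    have := smul_left_injective k (hF.omega_ne j) e3
    rw [← this, mul_comm]

/-- The elements `U z v` span `ε v 𝒜 2`. -/
theorem IsFrobenius.U_family (v : V) {r : R} (hr : r ∈ 𝒜 2) :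
    ∃ c : Fin 3 → k, ε v * r = ∑ z, c z • U z v := by
  replace hr := h.succ_le 1 hr
  induction hr using Submodule.span_induction with
  | mem r hr =>
    obtain ⟨y, w, r, hr, rfl⟩ := hr
    obtain ⟨c, hc⟩ := h.arrow_family w hr
    by_cases hv : v = w + st y
    · refine ⟨fun z => c (-y - z) * p (w - st (-y - z)) (-y - z) y, ?_⟩
      rw [hv, ← mul_assoc, h.eps_arrow, ← h.arrow_eps, mul_assoc, hc, Finset.mul_sum]
      refine Fintype.sum_equiv (Equiv.subLeft (-y)) _ _ fun x => ?_
      have e := hF.arrow_mul_arrow (w - st x) x y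
      rw [sub_add_cancel] at e
      rw [Equiv.subLeft_apply, mul_smul_comm, e, smul_smul]
      beta_reduce
      rw [show -y - (-y - x) = x by abel,
        show -x - y = -y - x by abel]
    · exact ⟨0, by rw [← mul_assoc, h.eps_mul_arrow, if_neg hv]; simp⟩
  | zero => exact ⟨0, by simp⟩
  | add r r' _ _ h1 h2 =>
    obtain ⟨c, hc⟩ := h1
    obtain ⟨c', hc'⟩ := h2
    exact ⟨c + c', by simp [mul_add, hc, hc', add_smul, Finset.sum_add_distrib]⟩
  | smul c r _ h1 =>
    obtain ⟨c', hc'⟩ := h1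
    exact ⟨c • c', by simp [hc', Finset.smul_sum, smul_smul]⟩

end Frobenius

end IsGradedQuiverAlgebra

/-! ### The Koszul spaces -/

section KoszulSpace

variable {k : Type u} [Field k] {V : Type} [AddCommGroup V] (st : Fin 3 → V)
  (p : V → Fin 3 → Fin 3 → k)

/-- Removal of the letter `x` from the front of a word, as an operation on functions on words. -/
def strip (x : Fin 3) : (List (Fin 3) → k) →ₗ[k] (List (Fin 3) → k) :=
  LinearMap.funLeft k k (List.cons x)

@[simp]
theorem strip_apply (x : Fin 3) (f : List (Fin 3) → k) (w : List (Fin 3)) :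
    strip x f w = f (x :: w) := rfl

/-- The functions on words (listed from the last letter to the first one, and read as paths that
end at `j`) that satisfy the relations dual to the algebra structure `p` at any two consecutive
letters.  The two letters are `-x - z` followed by `x`; they start at the vertex
`j - disp st u + st z`. -/
def koszulSpace (j : V) : Submodule k (List (Fin 3) → k) where
  carrier := {f | ∀ (u w : List (Fin 3)) (z : Fin 3),
    ∑ x, p (j - disp st u + st z) (-x - z) x * f (u ++ x :: (-x - z) :: w) = 0}
  zero_mem' := by simp
  add_mem' := by
    intro f g hf hg u w z
    simp only [Pi.add_apply, mul_add, Finset.sum_add_distrib, hf u w z, hg u w z, add_zero]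
  smul_mem' := by
    intro c f hf u w z
    simp only [Pi.smul_apply, smul_eq_mul, mul_left_comm _ c, ← Finset.mul_sum, hf u w z, mul_zero]

/-- The part of the Koszul space that lives on words of length `n`. -/
def koszulLength (n : ℕ) (j : V) : Submodule k (List (Fin 3) → k) :=
  koszulSpace st p j ⊓
    { carrier := {f | ∀ w : List (Fin 3), w.length ≠ n → f w = 0}
      zero_mem' := by simp
      add_mem' := by
        intro f g hf hg w hw
        rw [Pi.add_apply, hf w hw, hg w hw, add_zero]
      smul_mem' := by
        intro c f hf w hw
        rw [Pi.smul_apply, hf w hw, smul_zero] }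

variable {st p}

theorem strip_mem_koszulSpace {j : V} {f : List (Fin 3) → k} (hf : f ∈ koszulSpace st p j)
    (x : Fin 3) : strip x f ∈ koszulSpace st p (j - st x) := by
  intro u w z
  have := hf (x :: u) w z
  simpa only [disp, sub_sub, List.cons_append, strip_apply] using this

theorem mem_koszulSpace_of_strip {j : V} {f : List (Fin 3) → k}
    (hf : ∀ x, strip x f ∈ koszulSpace st p (j - st x))
    (h : ∀ z w, ∑ x, p (j + st z) (-x - z) x * f (x :: (-x - z) :: w) = 0) :
    f ∈ koszulSpace st p j := by
  intro u w z
  cases u with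
  | nil => simpa [disp] using h z w
  | cons x u =>
    have := hf x u w z
    simpa only [disp, sub_sub, List.cons_append, strip_apply] using this

theorem strip_mem_koszulLength {n : ℕ} {j : V} {f : List (Fin 3) → k}
    (hf : f ∈ koszulLength st p (n + 1) j) (x : Fin 3) :
    strip x f ∈ koszulLength st p n (j - st x) :=
  ⟨strip_mem_koszulSpace hf.1 x, fun w hw => hf.2 (x :: w) (by simpa using hw)⟩

theorem mem_koszulLength_of_strip {n : ℕ} {j : V} {f : List (Fin 3) → k} (h0 : f [] = 0)
    (hf : ∀ x, strip x f ∈ koszulLength st p n (j - st x))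
    (h : ∀ z w, ∑ x, p (j + st z) (-x - z) x * f (x :: (-x - z) :: w) = 0) :
    f ∈ koszulLength st p (n + 1) j := by
  refine ⟨mem_koszulSpace_of_strip (fun x => (hf x).1) h, fun w hw => ?_⟩
  cases w with
  | nil => exact h0
  | cons x w => exact (hf x).2 w (by simpa using hw)

theorem koszul_relation {j : V} {f : List (Fin 3) → k} (hf : f ∈ koszulSpace st p j) (z : Fin 3) :
    ∑ x, p (j + st z) (-x - z) x • strip (-x - z) (strip x f) = 0 := by
  funext w
  have := hf [] w z
  simpa [disp, Finset.sum_apply] using this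

/-- The vertex of the paths that occur in `Σ x, p (j + st z) (-x - z) x • φ x (-x - z)`. -/
theorem sub_sub_eq_add_third (h0 : st 0 + st 1 + st 2 = 0) (j : V) {x z : Fin 3} (hxz : x ≠ z) :
    j - st x - st (-x - z) = j + st z := by
  have := step_add_third h0 hxz
  rw [sub_sub, sub_eq_iff_eq_add]
  rw [show j + st z + (st x + st (-x - z)) = j + (st x + st z + st (-x - z)) by abel, this,
    add_zero]

theorem comb_mem_koszulLength (h0 : st 0 + st 1 + st 2 = 0) (hp : ∀ v x, p v x x = 0) {n : ℕ}
    {j : V} {φ : Fin 3 → Fin 3 → List (Fin 3) → k}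
    (hφ : ∀ x y, φ x y ∈ koszulLength st p n (j - st x - st y)) (z : Fin 3) :
    ∑ x, p (j + st z) (-x - z) x • φ x (-x - z) ∈ koszulLength st p n (j + st z) := by
  refine Submodule.sum_mem _ fun x _ => ?_
  by_cases hxz : x = z
  · have : -x - z = x := by subst hxz; revert x; decide
    rw [this, hp, zero_smul]
    exact zero_mem _
  · rw [← sub_sub_eq_add_third h0 j hxz]
    exact Submodule.smul_mem _ _ (hφ x _)

theorem strip_single (x y : Fin 3) (l : List (Fin 3)) :
    strip x (Pi.single (y :: l) (1 : k)) = if x = y then Pi.single l 1 else 0 := by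
  funext w
  by_cases hxy : x = y
  · subst hxy
    by_cases hw : w = l
    · subst hw; simp
    · simp [hw]
  · simp [hxy]

/-- A word any two consecutive letters of which compose to zero lies in the Koszul space. -/
theorem single_cons_mem {n : ℕ} {j : V} {x : Fin 3} {l : List (Fin 3)}
    (hl : Pi.single l 1 ∈ koszulLength st p n (j - st x))
    (h : ∀ y, l.head? = some y → ∀ z, y = -x - z → p (j + st z) y x = 0) :
    Pi.single (x :: l) 1 ∈ koszulLength st p (n + 1) j := by
  refine mem_koszulLength_of_strip (by simp) (fun y => ?_) fun z w => ?_
  · rw [strip_single]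
    split_ifs with hy
    · rw [hy]; exact hl
    · exact zero_mem _
  · refine Finset.sum_eq_zero fun y _ => ?_
    by_cases hw : y :: (-y - z) :: w = x :: l
    · obtain ⟨rfl, rfl⟩ := List.cons.inj hw
      rw [h (-y - z) rfl z rfl, zero_mul]
    · rw [Pi.single_eq_of_ne hw, mul_zero]

theorem single_nil_mem (j : V) : Pi.single [] (1 : k) ∈ koszulLength st p 0 j := by
  refine ⟨fun u w z => Finset.sum_eq_zero fun x _ => ?_, fun w hw => ?_⟩
  · rw [Pi.single_eq_of_ne (by simp), mul_zero]
  · rw [Pi.single_eq_of_ne (by rintro rfl; simp at hw)]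

theorem third_ne {x y : Fin 3} (hxy : y ≠ x) : -x - y ≠ x := by
  revert x y; decide

theorem single_replicate_append_mem (hp : ∀ v x, p v x x = 0) {n : ℕ} {j : V} {x : Fin 3}
    {l : List (Fin 3)} (hl : Pi.single l 1 ∈ koszulLength st p n j)
    (h : ∀ y, l.head? = some y → ∀ z, y = -x - z → p (j + st x + st z) y x = 0) (m : ℕ) :
    Pi.single (List.replicate m x ++ l) 1 ∈ koszulLength st p (m + n) (j + m • st x) := by
  induction m with
  | zero => simpa using hl
  | succ m ih =>
    rw [List.replicate_succ, List.cons_append, Nat.succ_add]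
    refine single_cons_mem ?_ ?_
    · rw [succ_nsmul, ← add_assoc, add_sub_cancel_right]; exact ih
    · intro y hy z hz
      cases m with
      | zero => simpa using h y (by simpa using hy) z hz
      | succ m =>
        have : y = x := by simpa [List.replicate_succ] using hy.symm
        rw [this, hp]

end KoszulSpace

/-! ### Linear resolutions are Koszul complexes -/

namespace IsGradedQuiverAlgebra

variable {k R : Type u} [Field k] [Ring R] [Algebra k R] {V : Type}
    [AddCommGroup V] [Fintype V] [DecidableEq V] {st : Fin 3 → V} {𝒜 : ℕ → Submodule k R}
    {ε : V → R} {a : Fin 3 → V → R} {comp : ℕ → R →+ R}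
    {U : Fin 3 → V → R} {ω : V → R} {p : V → Fin 3 → Fin 3 → k}

omit [Fintype V] [DecidableEq V] in
/-- Products of two arrows, collected according to the elements `U z j`. -/
theorem IsFrobenius.sum_arrow_arrow {P : Type u} [AddCommGroup P] [Module R P]
    (hF : IsFrobenius st 𝒜 ε a U ω p) (h0 : st 0 + st 1 + st 2 = 0) (j : V)
    (y : Fin 3 → Fin 3 → P) :
    ∑ x, ∑ l, (a x (j - st x) * a l (j - st x - st l)) • y x l =
      ∑ z, U z j • ∑ x, algebraMap k R (p (j + st z) (-x - z) x) • y x (-x - z) := by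
  simp only [Finset.smul_sum]
  conv_rhs => rw [Finset.sum_comm]
  refine Finset.sum_congr rfl fun x _ => ?_
  refine Fintype.sum_equiv (Equiv.subLeft (-x)) _ _ fun l => ?_
  have e := hF.arrow_mul_arrow (j - st x - st l) l x
  rw [sub_add_cancel, sub_add_cancel] at e
  rw [e, Equiv.subLeft_apply, show -x - (-x - l) = l by abel, smul_smul,
    ← Algebra.commutes, ← Algebra.smul_def, show -l - x = -x - l by abel]
  by_cases hxl : l = x
  · subst hxl; rw [hF.p_self, hF.p_self]
  · have hz : -x - l ≠ x := third_ne hxl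
    rw [← sub_sub_eq_add_third h0 j (Ne.symm hz), show -x - (-x - l) = l by abel]

section Resolution

variable (F : GradedProjectiveResolution 𝒜 (R ⧸ positivePart 𝒜) (degreeZeroGrading _))

/-- The correspondence between functions on words of length `t` that end at `j` and elements of
degree `t` of the term `P t` of a linear resolution: the differential strips the last letter. -/
def Rep (st : Fin 3 → V) (ε : V → R) (a : Fin 3 → V → R) (p₀ : V → F.P 0) :
    (t : ℕ) → V → (List (Fin 3) → k) → F.P t → Prop
  | 0, j, f, x => x = algebraMap k R (f []) • p₀ j
  | t + 1, j, f, x => x ∈ F.gr (t + 1) (t + 1) ∧ ε j • x = x ∧ ∃ y : Fin 3 → F.P t,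
      (∀ i, Rep st ε a p₀ t (j - st i) (strip i f) (y i)) ∧
      F.d t x = ∑ i, a i (j - st i) • y i

theorem algebraMap_mem (h : IsGradedQuiverAlgebra st 𝒜 ε a comp) (c : k) :
    algebraMap k R c ∈ 𝒜 0 := by
  rw [Algebra.algebraMap_eq_smul_one]; exact Submodule.smul_mem _ _ h.one_mem

variable {F} {p₀ : V → F.P 0}

section Rep

theorem Rep.mem (h : IsGradedQuiverAlgebra st 𝒜 ε a comp)
    (hp₀ : ∀ v, p₀ v ∈ F.gr 0 0 ∧ ε v • p₀ v = p₀ v) {t : ℕ} {j : V} {f : List (Fin 3) → k}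
    {x : F.P t} (hx : Rep F st ε a p₀ t j f x) : x ∈ F.gr t t ∧ ε j • x = x := by
  cases t with
  | zero =>
    rw [Rep] at hx
    subst hx
    refine ⟨zero_smul_mem (F.isModuleGrading 0) (h.algebraMap_mem _) (hp₀ j).1, ?_⟩
    rw [smul_smul, ← Algebra.commutes, ← smul_smul, (hp₀ j).2]
  | succ t => exact ⟨hx.1, hx.2.1⟩

omit [Fintype V] [DecidableEq V] in
theorem Rep.add {t : ℕ} {j : V} {f g : List (Fin 3) → k} {x y : F.P t}
    (hx : Rep F st ε a p₀ t j f x) (hy : Rep F st ε a p₀ t j g y) :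
    Rep F st ε a p₀ t j (f + g) (x + y) := by
  induction t generalizing j f g with
  | zero =>
    rw [Rep] at *
    rw [hx, hy, Pi.add_apply, map_add, add_smul]
  | succ t ih =>
    obtain ⟨h1, h2, x', h3, h4⟩ := hx
    obtain ⟨h1', h2', y', h3', h4'⟩ := hy
    refine ⟨add_mem h1 h1', by rw [smul_add, h2, h2'], x' + y', fun i => ?_, ?_⟩
    · rw [map_add]; exact ih (h3 i) (h3' i)
    · simp [h4, h4', Finset.sum_add_distrib]

omit [Fintype V] [DecidableEq V] in
theorem Rep.zero (t : ℕ) (j : V) : Rep F st ε a p₀ t j (0 : List (Fin 3) → k) 0 := by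
  induction t generalizing j with
  | zero => rw [Rep]; simp
  | succ t ih =>
    exact ⟨zero_mem _, smul_zero _, 0, fun i => by rw [map_zero]; exact ih _, by simp⟩

theorem Rep.smul (h : IsGradedQuiverAlgebra st 𝒜 ε a comp) {t : ℕ} {j : V}
    {f : List (Fin 3) → k} {x : F.P t} (hx : Rep F st ε a p₀ t j f x) (c : k) :
    Rep F st ε a p₀ t j (c • f) (algebraMap k R c • x) := by
  induction t generalizing j f with
  | zero =>
    rw [Rep] at *
    rw [hx, Pi.smul_apply, smul_eq_mul, map_mul, smul_smul]
  | succ t ih =>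
    obtain ⟨h1, h2, x', h3, h4⟩ := hx
    refine ⟨zero_smul_mem (F.isModuleGrading _) (h.algebraMap_mem _) h1, ?_,
      fun i => algebraMap k R c • x' i, fun i => ?_, ?_⟩
    · rw [smul_smul, ← Algebra.commutes, ← smul_smul, h2]
    · rw [map_smul]; exact ih (h3 i)
    · rw [map_smul, h4, Finset.smul_sum]
      refine Finset.sum_congr rfl fun i _ => ?_
      rw [smul_smul, smul_smul, Algebra.commutes]

omit [Fintype V] [DecidableEq V] in
theorem Rep.sum {ι : Type} (s : Finset ι) {t : ℕ} {j : V} {f : ι → List (Fin 3) → k}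
    {x : ι → F.P t} (hx : ∀ i ∈ s, Rep F st ε a p₀ t j (f i) (x i)) :
    Rep F st ε a p₀ t j (∑ i ∈ s, f i) (∑ i ∈ s, x i) := by
  classical
  induction s using Finset.induction_on with
  | empty => simpa using Rep.zero t j
  | insert i s hi ih =>
    rw [Finset.sum_insert hi, Finset.sum_insert hi]
    exact (hx i (Finset.mem_insert_self _ _)).add
      (ih fun i' hi' => hx i' (Finset.mem_insert_of_mem hi'))

theorem Rep.sub (h : IsGradedQuiverAlgebra st 𝒜 ε a comp) {t : ℕ} {j : V}
    {f g : List (Fin 3) → k} {x y : F.P t}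
    (hx : Rep F st ε a p₀ t j f x) (hy : Rep F st ε a p₀ t j g y) :
    Rep F st ε a p₀ t j (f - g) (x - y) := by
  have := hx.add (hy.smul h (-1))
  simpa [sub_eq_add_neg] using this

theorem Rep.comb (h : IsGradedQuiverAlgebra st 𝒜 ε a comp) (h0 : st 0 + st 1 + st 2 = 0)
    (hp : ∀ v x, p v x x = 0) {t : ℕ} {j : V} {φ : Fin 3 → Fin 3 → List (Fin 3) → k}
    {y : Fin 3 → Fin 3 → F.P t} (hφ : ∀ x l, Rep F st ε a p₀ t (j - st x - st l) (φ x l) (y x l))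
    (z : Fin 3) : Rep F st ε a p₀ t (j + st z) (∑ x, p (j + st z) (-x - z) x • φ x (-x - z))
      (∑ x, algebraMap k R (p (j + st z) (-x - z) x) • y x (-x - z)) := by
  refine Rep.sum _ fun x _ => ?_
  by_cases hxz : x = z
  · have : -x - z = x := by subst hxz; revert x; decide
    rw [this, hp, zero_smul, map_zero, zero_smul]
    exact Rep.zero _ _
  · have := (hφ x (-x - z)).smul h (p (j + st z) (-x - z) x)
    rwa [sub_sub_eq_add_third h0 j hxz] at this

end Rep

section Exact

variable (h : IsGradedQuiverAlgebra st 𝒜 ε a comp) (hF : IsFrobenius st 𝒜 ε a U ω p)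
  (hst : Function.Injective st) (h0 : st 0 + st 1 + st 2 = 0) {q : ℕ∞}
  (hgen : ∀ t : ℕ, (t : ℕ∞) ≤ q → Submodule.span R (F.gr t t : Set (F.P t)) = ⊤)
include h hgen

theorem exists_arrow_sum {t : ℕ} (ht : (t : ℕ∞) ≤ q) {v : V} {z : F.P t} (hz : z ∈ F.gr t (t + 1))
    (hvz : ε v • z = z) : ∃ y : Fin 3 → F.P t,
      (∀ i, y i ∈ F.gr t t ∧ ε (v - st i) • y i = y i) ∧ z = ∑ i, a i (v - st i) • y i :=
  h.exists_eq_sum_family (F.isModuleGrading t) (hgen t ht) (h.mem_arrow_family v)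
    (fun _ hr => h.arrow_family v hr) hz hvz

include hst in
theorem arrow_sum_eq_zero {t : ℕ} (ht : (t : ℕ∞) ≤ q) {v : V} {y : Fin 3 → F.P t}
    (hy : ∀ i, y i ∈ F.gr t t ∧ ε (v - st i) • y i = y i)
    (hsum : ∑ i, a i (v - st i) • y i = 0) (i : Fin 3) : y i = 0 := by
  have := F.projective t
  exact h.eq_zero_of_sum_family (F.isModuleGrading t) (hgen t ht) (d := 1)
    (fun i => h.arrow_mem i _) (h.mem_arrow_family v) (fun i => (hy i).2) hsum (h.arrow_ne i _)
    (fun i' hi' h1 => hi' (hst (sub_right_injective h1))) (hy i).1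

include hF

theorem exists_U_sum {t : ℕ} (ht : (t : ℕ∞) ≤ q) {v : V} {z : F.P t} (hz : z ∈ F.gr t (t + 2))
    (hvz : ε v • z = z) : ∃ y : Fin 3 → F.P t,
      (∀ i, y i ∈ F.gr t t ∧ ε (v + st i) • y i = y i) ∧ z = ∑ i, U i v • y i :=
  h.exists_eq_sum_family (F.isModuleGrading t) (hgen t ht) (fun i => hF.U_eps i v)
    (fun _ hr => hF.U_family h v hr) hz hvz

include hst in
theorem U_sum_eq_zero {t : ℕ} (ht : (t : ℕ∞) ≤ q) {v : V} {y : Fin 3 → F.P t}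
    (hy : ∀ i, y i ∈ F.gr t t ∧ ε (v + st i) • y i = y i)
    (hsum : ∑ i, U i v • y i = 0) (i : Fin 3) : y i = 0 := by
  have := F.projective t
  exact h.eq_zero_of_sum_family (F.isModuleGrading t) (hgen t ht) (d := 2)
    (fun i => hF.U_mem i _) (fun i => hF.U_eps i v) (fun i => (hy i).2) hsum (hF.U_ne i _)
    (fun i' hi' h1 => hi' (hst (add_left_cancel h1))) (hy i).1

theorem omega_smul_eq_zero {t : ℕ} (ht : (t : ℕ∞) ≤ q) {v : V} {y : F.P t} (hy : y ∈ F.gr t t)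
    (hvy : ε v • y = y) (hsum : ω v • y = 0) : y = 0 := by
  have := F.projective t
  exact h.eq_zero_of_sum_family (F.isModuleGrading t) (hgen t ht) (ι := Unit) (d := 3)
    (b := fun _ => ω v) (s := fun _ => v) (p := fun _ => y) (i₀ := ())
    (fun _ => hF.omega_mem v) (fun _ => hF.omega_eps v) (fun _ => hvy) (by simpa using hsum)
    (hF.omega_ne v) (fun i hi => absurd rfl hi) hy

variable (hker : ∀ t : ℕ, (t : ℕ∞) = q → ∀ x ∈ F.ker t, x ∈ F.gr t (t + 3))
  (hp₀ : ∀ v, p₀ v ∈ F.gr 0 0 ∧ ε v • p₀ v = p₀ v)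

omit hF in
include hker in
/-- The element of `P t` is determined by the function on words. -/
theorem Rep.eq_zero_of_zero {t : ℕ} (ht : (t : ℕ∞) ≤ q) {j : V} {x : F.P t}
    (hx : Rep F st ε a p₀ t j (0 : List (Fin 3) → k) x) : x = 0 := by
  induction t generalizing j with
  | zero => rw [Rep] at hx; simpa using hx
  | succ t ih =>
    obtain ⟨h1, -, y, h3, h4⟩ := hx
    refine h.eq_zero_of_mem_ker F hgen hker ht ?_ h1
    change F.d t x = 0
    rw [h4]
    refine Finset.sum_eq_zero fun i _ => ?_
    have := h3 i
    rw [map_zero] at this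
    rw [ih (le_trans (by exact_mod_cast Nat.le_succ t) ht) this, smul_zero]

omit hF in
include hp₀ hst in
/-- The function on words is determined by the element of `P t`. -/
theorem Rep.fun_eq_zero (hne : ∀ v, p₀ v ≠ 0) {t : ℕ} (ht : (t : ℕ∞) ≤ q) {j : V}
    {f : List (Fin 3) → k} (hf : f ∈ koszulLength st p t j) (hx : Rep F st ε a p₀ t j f 0) :
    f = 0 := by
  induction t generalizing j f with
  | zero =>
    rw [Rep] at hx
    funext w
    by_cases hw : w.length = 0
    · rw [List.length_eq_zero_iff.1 hw]
      by_contra hc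
      apply hne j
      have := congrArg (algebraMap k R (f [])⁻¹ • ·) hx
      simp only [smul_zero, smul_smul, ← map_mul] at this
      rw [inv_mul_cancel₀ hc, map_one, one_smul] at this
      exact this.symm
    · exact hf.2 w hw
  | succ t ih =>
    have ht' : (t : ℕ∞) ≤ q := le_trans (by exact_mod_cast Nat.le_succ t) ht
    obtain ⟨-, -, y, h3, h4⟩ := hx
    rw [map_zero] at h4
    have hy := h.arrow_sum_eq_zero hst hgen ht' (fun i => (h3 i).mem h hp₀) h4.symm
    have hs : ∀ i, strip i f = 0 := fun i => by
      have := h3 i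
      rw [hy i] at this
      exact ih ht' (strip_mem_koszulLength hf i) this
    funext w
    cases w with
    | nil => exact hf.2 [] (by simp)
    | cons i w => exact congrFun (hs i) w

variable (hpk : ∀ v, ∀ n, 0 < n → ∀ r ∈ 𝒜 n, r • p₀ v ∈ F.ker 0)

include h0 hker hpk in
/-- The element of `P t` attached to an element of the Koszul space of length `t + 1` is a
cycle. -/
theorem sum_arrow_mem_ker {t : ℕ} (ht : (t : ℕ∞) ≤ q) {j : V} {f : List (Fin 3) → k}
    (hf : f ∈ koszulLength st p (t + 1) j) {y : Fin 3 → F.P t}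
    (hy : ∀ i, Rep F st ε a p₀ t (j - st i) (strip i f) (y i)) :
    ∑ i, a i (j - st i) • y i ∈ F.ker t := by
  cases t with
  | zero =>
    refine Submodule.sum_mem _ fun i _ => ?_
    have := hy i
    rw [Rep] at this
    rw [this, smul_smul, ← Algebra.commutes, ← smul_smul]
    exact Submodule.smul_mem _ _ (hpk _ 1 one_pos _ (h.arrow_mem _ _))
  | succ t =>
    have ht' : (t : ℕ∞) ≤ q := le_trans (by exact_mod_cast Nat.le_succ t) ht
    choose h1 h2 y' h3 h4 using hy
    change F.d t _ = 0
    simp only [map_sum, map_smul, h4, Finset.smul_sum, smul_smul]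
    rw [hF.sum_arrow_arrow h0]
    refine Finset.sum_eq_zero fun z _ => ?_
    have hrep := Rep.comb h h0 hF.p_self h3 z
    rw [koszul_relation hf.1] at hrep
    rw [hrep.eq_zero_of_zero h hgen hker ht', smul_zero]

include h0 hker hpk hp₀ in
/-- Every element of the Koszul space is attached to an element of `P t`, since the cycle formed
with its contractions is a boundary. -/
theorem exists_rep {t : ℕ} (ht : (t : ℕ∞) ≤ q) {j : V} {f : List (Fin 3) → k}
    (hf : f ∈ koszulLength st p t j) : ∃ x, Rep F st ε a p₀ t j f x := by
  induction t generalizing j f with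
  | zero => exact ⟨_, rfl⟩
  | succ t ih =>
    have ht' : (t : ℕ∞) ≤ q := le_trans (by exact_mod_cast Nat.le_succ t) ht
    choose y hy using fun i => ih ht' (strip_mem_koszulLength hf i)
    have hgr : ∑ i, a i (j - st i) • y i ∈ F.gr t (t + 1) := sum_mem fun i _ => by
      rw [add_comm]
      exact (F.isModuleGrading t).smul_mem 1 t _ _ (h.arrow_mem _ _) ((hy i).mem h hp₀).1
    obtain ⟨x, hx, hjx, hdx⟩ := h.exists_preimage F
      (h.sum_arrow_mem_ker hF h0 hgen hker hpk ht' hf hy) hgr (v := j) (by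
        rw [Finset.smul_sum]
        refine Finset.sum_congr rfl fun i _ => ?_
        rw [smul_smul, h.eps_mul_arrow, if_pos (by abel)])
    exact ⟨x, hx, hjx, y, hy, hdx⟩

include h0 hp₀ hst in
/-- Every element of the degree `t` part of `P t` is attached to an element of the Koszul space: the
Koszul relations express that the square of the differential is zero. -/
theorem exists_fun_rep (hne : ∀ v, p₀ v ≠ 0)
    (hspan : ∀ v, ∀ x ∈ F.gr 0 0, ε v • x = x → ∃ c : k, x = (c • ε v) • p₀ v)
    {t : ℕ} (ht : (t : ℕ∞) ≤ q) {j : V} {x : F.P t} (hx : x ∈ F.gr t t) (hjx : ε j • x = x) :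
    ∃ f ∈ koszulLength st p t j, Rep F st ε a p₀ t j f x := by
  induction t generalizing j with
  | zero =>
    obtain ⟨c, hc⟩ := hspan j x hx hjx
    refine ⟨c • Pi.single [] 1, Submodule.smul_mem _ _ (single_nil_mem j), ?_⟩
    rw [Rep, hc, Algebra.smul_def, ← smul_smul, (hp₀ j).2]
    simp
  | succ t ih =>
    have ht' : (t : ℕ∞) ≤ q := le_trans (by exact_mod_cast Nat.le_succ t) ht
    obtain ⟨y, hy, hdy⟩ := h.exists_arrow_sum hgen ht' (F.d_mem t _ _ hx) (v := j)
      (by rw [← map_smul, hjx])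
    choose g hg hrep using fun i => ih ht' (hy i).1 (hy i).2
    let f : List (Fin 3) → k := fun w => w.casesOn 0 fun i w => g i w
    have hfs : ∀ i, strip i f = g i := fun i => rfl
    refine ⟨f, mem_koszulLength_of_strip rfl (fun i => by rw [hfs]; exact hg i) fun z w => ?_,
      hx, hjx, y, fun i => by rw [hfs]; exact hrep i, hdy⟩
    cases t with
    | zero =>
      refine Finset.sum_eq_zero fun i _ => ?_
      have : f (i :: (-i - z) :: w) = 0 := (hg i).2 _ (by simp)
      rw [this, mul_zero]
    | succ t =>
      have ht'' : (t : ℕ∞) ≤ q := le_trans (by exact_mod_cast Nat.le_succ t) ht'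
      choose h1 h2 y' h3 h4 using hrep
      have e1 : F.d t (F.d (t + 1) x) = 0 := d_comp_d F t x
      rw [hdy] at e1
      simp only [map_sum, map_smul, h4, Finset.smul_sum, smul_smul] at e1
      rw [hF.sum_arrow_arrow h0] at e1
      have hcomb := fun z => Rep.comb h h0 hF.p_self h3 z
      have hz := h.U_sum_eq_zero hF hst hgen ht'' (fun i => (hcomb i).mem h hp₀) e1 z
      have hc := hcomb z
      rw [hz] at hc
      have hzero := hc.fun_eq_zero h hst hgen hp₀ hne ht''
        (comb_mem_koszulLength h0 hF.p_self
          (fun i l => strip_mem_koszulLength (hg i) l) z)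
      have := congrFun hzero w
      simpa [Finset.sum_apply] using this

end Exact

end Resolution

end IsGradedQuiverAlgebra

/-! ### Exactness of the Koszul complex -/

namespace IsGradedQuiverAlgebra

variable {k R : Type u} [Field k] [Ring R] [Algebra k R] {V : Type}
    [AddCommGroup V] [Fintype V] [DecidableEq V] {st : Fin 3 → V} {𝒜 : ℕ → Submodule k R}
    {ε : V → R} {a : Fin 3 → V → R} {comp : ℕ → R →+ R}
    {U : Fin 3 → V → R} {ω : V → R} {p : V → Fin 3 → Fin 3 → k}

/-- A linear resolution with almost Koszul end cannot stop at a finite stage, as the powers of one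
letter give elements of all Koszul spaces. -/
theorem eq_top_of_resolution (h : IsGradedQuiverAlgebra st 𝒜 ε a comp)
    (hF : IsFrobenius st 𝒜 ε a U ω p) (hst : Function.Injective st)
    (h0 : st 0 + st 1 + st 2 = 0)
    (F : GradedProjectiveResolution 𝒜 (R ⧸ positivePart 𝒜) (degreeZeroGrading _)) {q : ℕ∞}
    (hgen : ∀ t : ℕ, (t : ℕ∞) ≤ q → Submodule.span R (F.gr t t : Set (F.P t)) = ⊤)
    (hker : ∀ t : ℕ, (t : ℕ∞) = q → ∀ x ∈ F.ker t, x ∈ F.gr t (t + 3)) : q = ⊤ := by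
  by_contra hq
  obtain ⟨t, rfl⟩ := ENat.ne_top_iff_exists.1 hq
  obtain ⟨p₀, hp₀, -⟩ := h.exists_generators F hgen hker
  have hp₀' : ∀ v, p₀ v ∈ F.gr 0 0 ∧ ε v • p₀ v = p₀ v := fun v => ⟨(hp₀ v).1, (hp₀ v).2.1⟩
  -- The word `0 ^ (t + 1)` gives a nonzero cycle in degree `t + 1` of `P t`, where no cycle
  -- can lie.
  have hf := single_replicate_append_mem (st := st) hF.p_self (x := 0) (l := [])
    (single_nil_mem (0 : V)) (by simp) (t + 1)
  set j : V := 0 + (t + 1) • st 0 with hj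
  set f : List (Fin 3) → k := Pi.single (List.replicate (t + 1) 0 ++ []) 1 with hfdef
  choose y hy using fun i => h.exists_rep hF h0 hgen hker hp₀' (fun v => (hp₀ v).2.2.2)
    le_rfl (strip_mem_koszulLength hf i)
  have hgr : ∑ i, a i (j - st i) • y i ∈ F.gr t (t + 1) := sum_mem fun i _ => by
    rw [add_comm]
    exact (F.isModuleGrading t).smul_mem 1 t _ _ (h.arrow_mem _ _) ((hy i).mem h hp₀').1
  have hkr := h.sum_arrow_mem_ker hF h0 hgen hker (fun v => (hp₀ v).2.2.2) le_rfl hf hy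
  have hzero := eq_zero_of_mem_gr (F.isModuleGrading t).isInternal (by omega) hgr
    (hker t rfl _ hkr)
  have hy0 := h.arrow_sum_eq_zero hst hgen le_rfl (fun i => (hy i).mem h hp₀') hzero 0
  have h1 := hy 0
  rw [hy0] at h1
  have h2 := h1.fun_eq_zero h hst hgen hp₀' (fun v => (hp₀ v).2.2.1) le_rfl
    (strip_mem_koszulLength hf 0)
  have h3 := congrFun h2 (List.replicate t 0)
  simp [hfdef, List.replicate_succ] at h3

/-- The Koszul complex of a linear resolution is exact at its two nontrivial places: the
contractions with the last letter are jointly surjective, and their kernel consists of the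
elements that come from two steps further.  For words of length zero there is no contraction, and
every element comes from one step further. -/
theorem koszul_exact (h : IsGradedQuiverAlgebra st 𝒜 ε a comp)
    (hF : IsFrobenius st 𝒜 ε a U ω p) (hst : Function.Injective st)
    (h0 : st 0 + st 1 + st 2 = 0)
    (F : GradedProjectiveResolution 𝒜 (R ⧸ positivePart 𝒜) (degreeZeroGrading _))
    (hgen : ∀ t : ℕ, Submodule.span R (F.gr t t : Set (F.P t)) = ⊤) (j : V) :
    (∀ n, ∀ f ∈ koszulLength st p n j, ∃ g : Fin 3 → List (Fin 3) → k,
      (∀ z, g z ∈ koszulLength st p (n + 1) (j + st z)) ∧ ∑ z, strip z (g z) = f) ∧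
    ∀ n, ∀ g : Fin 3 → List (Fin 3) → k, (∀ z, g z ∈ koszulLength st p n (j + st z)) →
      (0 < n → ∑ z, strip z (g z) = 0) → ∃ f : Fin 3 → List (Fin 3) → k,
        (∀ x, f x ∈ koszulLength st p (n + 1) (j - st x)) ∧
        ∀ z, g z = ∑ x, p (j + st z) (-x - z) x • strip (-x - z) (f x) := by
  have htop : ∀ t : ℕ, (t : ℕ∞) ≤ ⊤ := fun t => le_top
  replace hgen : ∀ t : ℕ, (t : ℕ∞) ≤ ⊤ → Submodule.span R (F.gr t t : Set (F.P t)) = ⊤ :=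
    fun t _ => hgen t
  have hker : ∀ t : ℕ, (t : ℕ∞) = ⊤ → ∀ x ∈ F.ker t, x ∈ F.gr t (t + 3) :=
    fun t ht => absurd ht (ENat.natCast_ne_top t)
  obtain ⟨p₀, hp₀, hspan⟩ := h.exists_generators F hgen hker
  have hp₀' : ∀ v, p₀ v ∈ F.gr 0 0 ∧ ε v • p₀ v = p₀ v := fun v => ⟨(hp₀ v).1, (hp₀ v).2.1⟩
  have hne : ∀ v, p₀ v ≠ 0 := fun v => (hp₀ v).2.2.1
  have hpk := fun v => (hp₀ v).2.2.2
  have exRep : ∀ (t : ℕ) (j : V) (f : List (Fin 3) → k), f ∈ koszulLength st p t j →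
      ∃ x, Rep F st ε a p₀ t j f x := fun t j f hf =>
    h.exists_rep hF h0 hgen hker hp₀' hpk (htop t) hf
  have exFun : ∀ (t : ℕ) (j : V) (x : F.P t), x ∈ F.gr t t → ε j • x = x →
      ∃ f ∈ koszulLength st p t j, Rep F st ε a p₀ t j f x := fun t j x hx hjx =>
    h.exists_fun_rep hF hst h0 hgen hp₀' hne hspan (htop t) hx hjx
  -- The differential of `∑ z, U z j • y z`.
  have hdU : ∀ (t : ℕ) (j : V) (g : Fin 3 → List (Fin 3) → k) (y : Fin 3 → F.P (t + 1)),
      (∀ z, Rep F st ε a p₀ (t + 1) (j + st z) (g z) (y z)) →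
      ∃ x, Rep F st ε a p₀ t j (∑ z, strip z (g z)) x ∧ F.d t (∑ z, U z j • y z) = ω j • x := by
    intro t j g y hy
    choose h1 h2 y' h3 h4 using hy
    refine ⟨∑ z, y' z z, Rep.sum _ fun z _ => ?_, ?_⟩
    · have := h3 z z
      rwa [add_sub_cancel_right] at this
    · rw [map_sum, Finset.smul_sum]
      refine Finset.sum_congr rfl fun z _ => ?_
      rw [map_smul, h4, Finset.smul_sum, Finset.sum_eq_single z]
      · rw [smul_smul, add_sub_cancel_right, hF.U_mul_arrow]
      · intro x _ hx
        rw [smul_smul, hF.U_mul_arrow_of_ne h hst hx, zero_smul]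
      · simp
  have hUgr : ∀ (t : ℕ) (j : V) (y : Fin 3 → F.P t), (∀ z, y z ∈ F.gr t t) →
      ∑ z, U z j • y z ∈ F.gr t (t + 2) ∧ ε j • ∑ z, U z j • y z = ∑ z, U z j • y z := by
    intro t j y hy
    refine ⟨sum_mem fun z _ => ?_, ?_⟩
    · rw [add_comm]
      exact (F.isModuleGrading t).smul_mem 2 t _ _ (hF.U_mem z j) (hy z)
    · rw [Finset.smul_sum]
      exact Finset.sum_congr rfl fun z _ => by rw [smul_smul, hF.eps_U]
  -- Both parts apply the exactness of the resolution to a cycle formed from socle elements, or from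
  -- elements of degree two, and translate its preimage back into functions on words.
  constructor
  · intro n f hf
    obtain ⟨x, hx⟩ := exRep n j f hf
    obtain ⟨hxg, hjx⟩ := hx.mem h hp₀'
    have hωker : ω j • x ∈ F.ker n := by
      cases n with
      | zero =>
        rw [Rep] at hx
        rw [hx, smul_smul, ← Algebra.commutes, ← smul_smul]
        exact Submodule.smul_mem _ _ (hpk _ 3 (by norm_num) _ (hF.omega_mem j))
      | succ n =>
        obtain ⟨-, -, y, -, hy⟩ := hx
        change F.d n _ = 0
        rw [map_smul, hy, Finset.smul_sum]
        refine Finset.sum_eq_zero fun i _ => ?_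
        have := h.mul_mem 3 1 _ _ (hF.omega_mem j) (h.arrow_mem i (j - st i))
        rw [h.eq_bot _ (by norm_num), Submodule.mem_bot] at this
        rw [smul_smul, this, zero_smul]
    have hωgr : ω j • x ∈ F.gr n (n + 3) := by
      rw [add_comm]
      exact (F.isModuleGrading n).smul_mem 3 n _ _ (hF.omega_mem j) hxg
    obtain ⟨e, he, hje, hde⟩ := h.exists_preimage F hωker hωgr (v := j) (by
      rw [smul_smul, hF.eps_omega])
    obtain ⟨y, hy, rfl⟩ := h.exists_U_sum hF hgen (htop (n + 1)) (v := j) he hje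
    choose g hg hrep using fun z => exFun (n + 1) (j + st z) (y z) (hy z).1 (hy z).2
    refine ⟨g, hg, ?_⟩
    obtain ⟨x', hx', hdx'⟩ := hdU n j g y hrep
    have hsub := hx'.sub h hx
    have hzero := h.omega_smul_eq_zero hF hgen (htop n) (hsub.mem h hp₀').1 (hsub.mem h hp₀').2
      (by rw [smul_sub, ← hdx', hde, sub_self])
    rw [hzero] at hsub
    refine sub_eq_zero.1 (hsub.fun_eq_zero h hst hgen hp₀' hne (htop n) (sub_mem ?_ hf))
    refine Submodule.sum_mem _ fun z _ => ?_
    have := strip_mem_koszulLength (hg z) z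
    rwa [add_sub_cancel_right] at this
  · intro n g hg hsum
    choose y hy using fun z => exRep n (j + st z) (g z) (hg z)
    have hcycle : ∑ z, U z j • y z ∈ F.ker n := by
      cases n with
      | zero =>
        refine Submodule.sum_mem _ fun z _ => ?_
        have := hy z
        rw [Rep] at this
        rw [this, smul_smul, ← Algebra.commutes, ← smul_smul]
        exact Submodule.smul_mem _ _ (hpk _ 2 two_pos _ (hF.U_mem z j))
      | succ n =>
        obtain ⟨x, hx, hdx⟩ := hdU n j g y hy
        rw [hsum n.succ_pos] at hx
        rw [hx.eq_zero_of_zero h hgen hker (htop n), smul_zero] at hdx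
        exact hdx
    obtain ⟨hUg, hUv⟩ := hUgr n j y fun z => ((hy z).mem h hp₀').1
    obtain ⟨e, he, hje, hde⟩ := h.exists_preimage F hcycle hUg hUv
    obtain ⟨b, hb, rfl⟩ := h.exists_arrow_sum hgen (htop (n + 1)) (v := j) he hje
    choose f hf hrep using fun i => exFun (n + 1) (j - st i) (b i) (hb i).1 (hb i).2
    refine ⟨f, hf, fun z => ?_⟩
    have hrep' := hrep
    choose h1 h2 b' h3 h4 using hrep'
    simp only [map_sum, map_smul, h4, Finset.smul_sum, smul_smul] at hde
    rw [hF.sum_arrow_arrow h0, ← sub_eq_zero, ← Finset.sum_sub_distrib] at hde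
    simp only [← smul_sub] at hde
    have hcomb := fun z => (Rep.comb h h0 hF.p_self h3 z).sub h (hy z)
    have hz := h.U_sum_eq_zero hF hst hgen (htop n) (fun i => (hcomb i).mem h hp₀') hde z
    have hc := hcomb z
    rw [hz] at hc
    refine (sub_eq_zero.1 (hc.fun_eq_zero h hst hgen hp₀' hne (htop n)
      (sub_mem ?_ (hg z)))).symm
    exact comb_mem_koszulLength h0 hF.p_self (fun i l => strip_mem_koszulLength (hf i) l) z

end IsGradedQuiverAlgebra

/-! ### Dimensions of the Koszul spaces -/

section Content

variable {k : Type u} [Field k] {V : Type} [AddCommGroup V] {st : Fin 3 → V}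
  {p : V → Fin 3 → Fin 3 → k}

/-- The content of a word: how often each letter occurs. -/
def content (w : List (Fin 3)) (x : Fin 3) : ℤ := w.count x

theorem content_cons (x : Fin 3) (w : List (Fin 3)) :
    content (x :: w) = content w + Pi.single x 1 := by
  funext y
  by_cases h : x = y
  · subst h; simp [content]
  · simp [content, h, Ne.symm h]

theorem content_append (u w : List (Fin 3)) : content (u ++ w) = content u + content w := by
  funext y; simp [content]

theorem sum_content (w : List (Fin 3)) :
    content w 0 + content w 1 + content w 2 = w.length := by
  rw [length_eq_count]; simp [content]

theorem single_add_single_add_third {x y : Fin 3} (hxy : x ≠ y) :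
    (Pi.single x 1 + Pi.single y 1 + Pi.single (-x - y) 1 : Fin 3 → ℤ) = 1 := by
  revert x y; decide

variable (st p) in
/-- The part of the Koszul space that lives on words of content `m`. -/
def koszulContent (m : Fin 3 → ℤ) (j : V) : Submodule k (List (Fin 3) → k) :=
  koszulSpace st p j ⊓
    { carrier := {f | ∀ w : List (Fin 3), content w ≠ m → f w = 0}
      zero_mem' := by simp
      add_mem' := by
        intro f g hf hg w hw
        rw [Pi.add_apply, hf w hw, hg w hw, add_zero]
      smul_mem' := by
        intro c f hf w hw
        rw [Pi.smul_apply, hf w hw, smul_zero] }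

/-- The restriction of a function to the words of content `m`. -/
def contentPart (m : Fin 3 → ℤ) : (List (Fin 3) → k) →ₗ[k] (List (Fin 3) → k) where
  toFun f w := if content w = m then f w else 0
  map_add' f g := by funext w; simp only [Pi.add_apply]; split_ifs <;> simp
  map_smul' c f := by funext w; simp

theorem contentPart_apply (m : Fin 3 → ℤ) (f : List (Fin 3) → k) (w : List (Fin 3)) :
    contentPart m f w = if content w = m then f w else 0 := rfl

theorem contentPart_of_mem {m : Fin 3 → ℤ} {j : V} {f : List (Fin 3) → k}
    (hf : f ∈ koszulContent st p m j) : contentPart m f = f := by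
  funext w
  rw [contentPart_apply]
  split_ifs with h
  · rfl
  · exact (hf.2 w h).symm

theorem strip_contentPart (x : Fin 3) (m : Fin 3 → ℤ) (f : List (Fin 3) → k) :
    strip x (contentPart m f) = contentPart (m - Pi.single x 1) (strip x f) := by
  funext w
  simp only [strip_apply, contentPart_apply, content_cons, eq_sub_iff_add_eq]

/-- The Koszul relations are homogeneous with respect to the content. -/
theorem contentPart_mem (hp : ∀ v x, p v x x = 0) (m : Fin 3 → ℤ) {j : V} {f : List (Fin 3) → k}
    (hf : f ∈ koszulSpace st p j) : contentPart m f ∈ koszulContent st p m j := by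
  refine ⟨fun u w z => ?_, fun w hw => by rw [contentPart_apply, if_neg hw]⟩
  have key : ∀ x, p (j - disp st u + st z) (-x - z) x *
      contentPart m f (u ++ x :: (-x - z) :: w) =
      (if content u + content w + 1 - Pi.single z 1 = m then 1 else 0) *
        (p (j - disp st u + st z) (-x - z) x * f (u ++ x :: (-x - z) :: w)) := by
    intro x
    by_cases hxz : x = z
    · have : -x - z = x := by subst hxz; revert x; decide
      rw [this, hp]; simp
    · have hc : content (u ++ x :: (-x - z) :: w) = content u + content w + 1 - Pi.single z 1 := by
        rw [content_append, content_cons, content_cons, ← single_add_single_add_third hxz]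
        abel
      rw [contentPart_apply, hc]
      split_ifs <;> simp
  simp only [key, ← Finset.mul_sum, hf u w z, mul_zero]

theorem koszulContent_le_length {m : Fin 3 → ℤ} {n : ℕ} (hm : m 0 + m 1 + m 2 = n) (j : V) :
    koszulContent st p m j ≤ koszulLength st p n j := by
  refine fun f hf => ⟨hf.1, fun w hw => hf.2 w ?_⟩
  rintro rfl
  rw [sum_content] at hm
  exact hw (by exact_mod_cast hm)

theorem koszulContent_eq_bot {m : Fin 3 → ℤ} {x : Fin 3} (hx : m x < 0) (j : V) :
    koszulContent st p m j = ⊥ := by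
  rw [eq_bot_iff]
  intro f hf
  rw [Submodule.mem_bot]
  funext w
  refine hf.2 w ?_
  rintro rfl
  simp only [content] at hx
  omega

theorem strip_mem_koszulContent {m : Fin 3 → ℤ} {j : V} {f : List (Fin 3) → k}
    (hf : f ∈ koszulContent st p m j) (x : Fin 3) :
    strip x f ∈ koszulContent st p (m - Pi.single x 1) (j - st x) :=
  ⟨strip_mem_koszulSpace hf.1 x, fun w hw => hf.2 (x :: w) fun h =>
    hw (eq_sub_of_add_eq (by rwa [content_cons] at h))⟩

instance (m : Fin 3 → ℤ) (j : V) : Module.Finite k (koszulContent st p m j) := by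
  let n := (m 0 + m 1 + m 2).toNat
  let φ : koszulContent st p m j →ₗ[k] (List.Vector (Fin 3) n → k) :=
    LinearMap.funLeft k k (fun w : List.Vector (Fin 3) n => w.1) ∘ₗ Submodule.subtype _
  refine Module.Finite.of_injective φ ?_
  rw [injective_iff_map_eq_zero]
  intro f hf
  ext w
  by_cases hw : content w = m
  · have hl : w.length = n := by
      have := sum_content w
      rw [hw] at this
      simp only [n]; omega
    exact congrFun hf ⟨w, hl⟩
  · exact f.2.2 w hw

/-- The alternating sum of the dimensions in an exact sequence with four terms. -/
theorem finrank_of_exact {A B C D : Type u} [AddCommGroup A] [AddCommGroup B] [AddCommGroup C]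
    [AddCommGroup D] [Module k A] [Module k B] [Module k C] [Module k D] [Module.Finite k A]
    [Module.Finite k B] [Module.Finite k C] [Module.Finite k D] (f : A →ₗ[k] B) (g : B →ₗ[k] C)
    (h : C →ₗ[k] D) (hf : Function.Injective f) (hfg : Function.Exact f g)
    (hgh : Function.Exact g h) (hh : Function.Surjective h) :
    Module.finrank k A + Module.finrank k C = Module.finrank k B + Module.finrank k D := by
  have h1 := LinearMap.finrank_range_add_finrank_ker f
  have h2 := LinearMap.finrank_range_add_finrank_ker g
  have h3 := LinearMap.finrank_range_add_finrank_ker h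
  rw [LinearMap.ker_eq_bot.2 hf, finrank_bot] at h1
  rw [hfg.linearMap_ker_eq] at h2
  rw [hgh.linearMap_ker_eq, LinearMap.range_eq_top.2 hh, finrank_top] at h3
  omega

variable (st p) in
/-- The Koszul complex is exact; see `IsGradedQuiverAlgebra.koszul_exact`. -/
def KoszulExact : Prop := ∀ j : V,
  (∀ n, ∀ f ∈ koszulLength st p n j, ∃ g : Fin 3 → List (Fin 3) → k,
    (∀ z, g z ∈ koszulLength st p (n + 1) (j + st z)) ∧ ∑ z, strip z (g z) = f) ∧
  ∀ n, ∀ g : Fin 3 → List (Fin 3) → k, (∀ z, g z ∈ koszulLength st p n (j + st z)) →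
    (0 < n → ∑ z, strip z (g z) = 0) → ∃ f : Fin 3 → List (Fin 3) → k,
      (∀ x, f x ∈ koszulLength st p (n + 1) (j - st x)) ∧
      ∀ z, g z = ∑ x, p (j + st z) (-x - z) x • strip (-x - z) (f x)

section Exact

variable (hex : KoszulExact st p) (hp : ∀ v x, p v x x = 0) (h0 : st 0 + st 1 + st 2 = 0)
include hex hp

/-- The contractions with the last letter are jointly surjective in every content. -/
theorem KoszulExact.surjective (m : Fin 3 → ℤ) (j : V) {f : List (Fin 3) → k}
    (hf : f ∈ koszulContent st p (m - 1) j) : ∃ g : Fin 3 → List (Fin 3) → k,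
      (∀ z, g z ∈ koszulContent st p (m - 1 + Pi.single z 1) (j + st z)) ∧
        ∑ z, strip z (g z) = f := by
  by_cases hm : ∀ x, 0 ≤ (m - 1) x
  · obtain ⟨g, hg, hgf⟩ := (hex j).1 ((m - 1) 0 + (m - 1) 1 + (m - 1) 2).toNat f
      (koszulContent_le_length (by have := hm 0; have := hm 1; have := hm 2; omega) j hf)
    refine ⟨fun z => contentPart (m - 1 + Pi.single z 1) (g z),
      fun z => contentPart_mem hp _ (hg z).1, ?_⟩
    simp only [strip_contentPart, add_sub_cancel_right]
    rw [← map_sum, hgf, contentPart_of_mem hf]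
  · push Not at hm
    obtain ⟨x, hx⟩ := hm
    rw [koszulContent_eq_bot hx, Submodule.mem_bot] at hf
    exact ⟨0, fun z => zero_mem _, by simp [hf]⟩

/-- Exactness of the Koszul complex at its middle term in every content. -/
theorem KoszulExact.middle (m : Fin 3 → ℤ) (j : V) {g : Fin 3 → List (Fin 3) → k}
    (hg : ∀ z, g z ∈ koszulContent st p (m - 1 + Pi.single z 1) (j + st z))
    (hsum : ∑ z, strip z (g z) = 0) : ∃ f : Fin 3 → List (Fin 3) → k,
      (∀ x, f x ∈ koszulContent st p (m - Pi.single x 1) (j - st x)) ∧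
      ∀ z, g z = ∑ x, p (j + st z) (-x - z) x • strip (-x - z) (f x) := by
  have hlen : ∀ z, (m - 1 + Pi.single z 1 : Fin 3 → ℤ) 0 + (m - 1 + Pi.single z 1 : Fin 3 → ℤ) 1 +
      (m - 1 + Pi.single z 1 : Fin 3 → ℤ) 2 = m 0 + m 1 + m 2 - 2 := by
    intro z
    fin_cases z <;> simp <;> ring
  by_cases hm : 0 ≤ m 0 + m 1 + m 2 - 2
  · obtain ⟨f, hf, hgf⟩ := (hex j).2 (m 0 + m 1 + m 2 - 2).toNat g
      (fun z => koszulContent_le_length (by rw [hlen]; omega) _ (hg z)) (fun _ => hsum)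
    refine ⟨fun x => contentPart (m - Pi.single x 1) (f x), fun x => contentPart_mem hp _ (hf x).1,
      fun z => ?_⟩
    conv_lhs => rw [← contentPart_of_mem (hg z), hgf, map_sum]
    refine Finset.sum_congr rfl fun x _ => ?_
    by_cases hxz : x = z
    · have : -x - z = x := by subst hxz; revert x; decide
      rw [this, hp, zero_smul, zero_smul, map_zero]
    · rw [map_smul, strip_contentPart, ← single_add_single_add_third hxz]
      congr 3
      abel
  · refine ⟨0, fun x => zero_mem _, fun z => ?_⟩
    have h1 := hg z
    have h2 := hlen z
    have h3 : ∃ x, (m - 1 + Pi.single z 1 : Fin 3 → ℤ) x < 0 := by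
      by_contra! h3
      have := h3 0
      have := h3 1
      have := h3 2
      omega
    obtain ⟨x, hx⟩ := h3
    rw [koszulContent_eq_bot hx, Submodule.mem_bot] at h1
    simp [h1]

include h0 in
/-- The Euler characteristic of the Koszul complex of a given content. -/
theorem KoszulExact.finrank_recursion
    (hσ : ∃ σ : Fin 3 → V → k, ∀ j x z, p (j + st z) (-x - z) x = σ x j * p j z (-x - z))
    {m : Fin 3 → ℤ} (hm : m ≠ 0) (j : V) :
    Module.finrank k (koszulContent st p m j) +
      ∑ z, Module.finrank k (koszulContent st p (m - 1 + Pi.single z 1) (j + st z)) =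
    ∑ x, Module.finrank k (koszulContent st p (m - Pi.single x 1) (j - st x)) +
      Module.finrank k (koszulContent st p (m - 1) j) := by
  let M₁ : koszulContent st p m j →ₗ[k]
      (∀ x, koszulContent st p (m - Pi.single x 1) (j - st x)) :=
    LinearMap.pi fun x => (strip x).restrict fun f hf => strip_mem_koszulContent hf x
  let M₂ : (∀ x, koszulContent st p (m - Pi.single x 1) (j - st x)) →ₗ[k]
      (∀ z, koszulContent st p (m - 1 + Pi.single z 1) (j + st z)) :=
    LinearMap.pi fun z => LinearMap.codRestrict _
      (∑ x, p (j + st z) (-x - z) x • (strip (-x - z) ∘ₗ Submodule.subtype _ ∘ₗ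
        LinearMap.proj x)) (by
        intro f
        simp only [LinearMap.sum_apply, LinearMap.smul_apply]
        refine Submodule.sum_mem _ fun x _ => ?_
        by_cases hxz : x = z
        · have : -x - z = x := by subst hxz; revert x; decide
          rw [this, hp, zero_smul]
          exact zero_mem _
        · have := strip_mem_koszulContent (f x).2 (-x - z)
          rw [sub_sub_eq_add_third h0 j hxz] at this
          rw [← single_add_single_add_third hxz,
            show m - (Pi.single x 1 + Pi.single z 1 + Pi.single (-x - z) 1) + Pi.single z 1 =
              m - Pi.single x 1 - Pi.single (-x - z) 1 by abel]
          exact Submodule.smul_mem _ _ this)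
  let M₃ : (∀ z, koszulContent st p (m - 1 + Pi.single z 1) (j + st z)) →ₗ[k]
      koszulContent st p (m - 1) j :=
    LinearMap.codRestrict _ (∑ z, strip z ∘ₗ Submodule.subtype _ ∘ₗ LinearMap.proj z) (by
      intro g
      simp only [LinearMap.sum_apply]
      refine Submodule.sum_mem _ fun z _ => ?_
      have := strip_mem_koszulContent (g z).2 z
      rwa [add_sub_cancel_right, add_sub_cancel_right] at this)
  have h₁ : ∀ f x, ((M₁ f x : _) : List (Fin 3) → k) = strip x f := fun f x => rfl
  have h₂ : ∀ f z, ((M₂ f z : _) : List (Fin 3) → k) =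
      ∑ x, p (j + st z) (-x - z) x • strip (-x - z) (f x : List (Fin 3) → k) := by
    intro f z
    simp [M₂, LinearMap.sum_apply]
  have h₃ : ∀ g, ((M₃ g : _) : List (Fin 3) → k) =
      ∑ z, strip z (g z : List (Fin 3) → k) := by
    intro g
    simp [M₃, LinearMap.sum_apply]
  have key := finrank_of_exact M₁ M₂ M₃ ?_ ?_ ?_ ?_
  · rwa [Module.finrank_pi_fintype, Module.finrank_pi_fintype] at key
  · rw [injective_iff_map_eq_zero]
    intro f hf
    ext w
    cases w with
    | nil =>
      refine f.2.2 [] fun h => hm ?_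
      rw [← h]
      funext x
      simp [content]
    | cons x w => exact congrFun (congrArg Subtype.val (congrFun hf x)) w
  · intro f
    constructor
    · intro hf
      have hf' : ∀ z, ∑ x, p (j + st z) (-x - z) x • strip (-x - z) (f x : List (Fin 3) → k) = 0 :=
        fun z => by rw [← h₂, hf]; rfl
      let F : List (Fin 3) → k := fun w => w.casesOn 0 fun i w => (f i : List (Fin 3) → k) w
      have hF : ∀ x, strip x F = f x := fun x => rfl
      refine ⟨⟨F, mem_koszulSpace_of_strip (fun x => by rw [hF]; exact (f x).2.1) fun z w => ?_,
        fun w hw => ?_⟩, ?_⟩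
      · have := congrFun (hf' z) w
        simpa [Finset.sum_apply] using this
      · cases w with
        | nil => rfl
        | cons x w =>
          refine (f x).2.2 w fun h => hw ?_
          rw [content_cons, h, sub_add_cancel]
      · rfl
    · rintro ⟨f, rfl⟩
      funext z
      apply Subtype.ext
      rw [h₂]
      simp only [h₁]
      rw [koszul_relation f.2.1]; rfl
  · intro g
    constructor
    · intro hg
      obtain ⟨f, hf, hgf⟩ := hex.middle hp m j (g := fun z => g z) (fun z => (g z).2)
        (by rw [← h₃, hg]; rfl)
      refine ⟨fun x => ⟨f x, hf x⟩, ?_⟩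
      funext z
      apply Subtype.ext
      rw [h₂]
      exact (hgf z).symm
    · rintro ⟨f, rfl⟩
      apply Subtype.ext
      rw [h₃]
      simp only [h₂, map_sum, map_smul]
      -- The two orders of contracting the letters `x` and `z` cancel by the Koszul relation.
      obtain ⟨σ, hσ⟩ := hσ
      rw [Finset.sum_comm]
      refine Finset.sum_eq_zero fun x _ => ?_
      have := koszul_relation (f x).2.1 x
      rw [sub_add_cancel] at this
      simp only [hσ, mul_smul, ← Finset.smul_sum]
      rw [← smul_zero (σ x j), ← this]
      congr 1
      refine Fintype.sum_equiv (Equiv.subLeft (-x)) _ _ fun z => ?_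
      rw [Equiv.subLeft_apply, show -(-x - z) - x = z by abel]
  · intro f
    obtain ⟨g, hg, hgf⟩ := hex.surjective hp m j f.2
    exact ⟨fun z => ⟨g z, hg z⟩, Subtype.ext (by rw [h₃]; exact hgf)⟩

include h0 in
/-- The Koszul spaces of all contents are one-dimensional, as for commuting variables. -/
theorem KoszulExact.finrank_eq
    (hσ : ∃ σ : Fin 3 → V → k, ∀ j x z, p (j + st z) (-x - z) x = σ x j * p j z (-x - z))
    (m : Fin 3 → ℤ) (j : V) :
    Module.finrank k (koszulContent st p m j) =
      if 0 ≤ m 0 ∧ 0 ≤ m 1 ∧ 0 ≤ m 2 then 1 else 0 := by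
  have hneg : ∀ (m : Fin 3 → ℤ) (j : V), ¬ (0 ≤ m 0 ∧ 0 ≤ m 1 ∧ 0 ≤ m 2) →
      Module.finrank k (koszulContent st p m j) = 0 := by
    intro m j hm
    obtain ⟨x, hx⟩ : ∃ x, m x < 0 := by
      by_contra! hx
      exact hm ⟨hx 0, hx 1, hx 2⟩
    rw [koszulContent_eq_bot hx, finrank_bot]
  induction hn : (m 0 + m 1 + m 2).toNat using Nat.strong_induction_on generalizing m j with
  | _ n ih =>
    by_cases hm : 0 ≤ m 0 ∧ 0 ≤ m 1 ∧ 0 ≤ m 2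
    swap
    · rw [hneg m j hm, if_neg hm]
    by_cases hm0 : m = 0
    · subst hm0
      rw [if_pos hm]
      have hspan : koszulContent st p 0 j = Submodule.span k {Pi.single [] 1} := by
        refine le_antisymm (fun f hf => ?_) ?_
        · rw [Submodule.mem_span_singleton]
          refine ⟨f [], ?_⟩
          funext w
          cases w with
          | nil => simp
          | cons x w =>
            rw [hf.2 (x :: w)]
            · simp
            · intro h
              have := sum_content (x :: w)
              rw [h] at this
              simp at this
              omega
        · rw [Submodule.span_singleton_le_iff_mem]
          refine ⟨(single_nil_mem j).1, fun w hw => Pi.single_eq_of_ne ?_ _⟩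
          rintro rfl
          exact hw (by funext x; simp [content])
      rw [hspan]
      exact finrank_span_singleton (by simp)
    · have hpos : 0 < m 0 + m 1 + m 2 := by
        by_contra hle
        apply hm0
        funext x
        fin_cases x <;> simp <;> omega
      have ih' : ∀ (m' : Fin 3 → ℤ) (j : V), m' 0 + m' 1 + m' 2 < m 0 + m 1 + m 2 →
          Module.finrank k (koszulContent st p m' j) =
            if 0 ≤ m' 0 ∧ 0 ≤ m' 1 ∧ 0 ≤ m' 2 then 1 else 0 :=
        fun m' j hm' => ih _ (by omega) m' j rfl
      have hrec := hex.finrank_recursion hp h0 hσ hm0 j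
      have e1 := ih' (m - 1) j (by simp; omega)
      have e2 : ∀ z, _ := fun z => ih' (m - Pi.single z 1) (j - st z)
        (by fin_cases z <;> simp)
      have e3 : ∀ z, _ := fun z => ih' (m - 1 + Pi.single z 1) (j + st z)
        (by fin_cases z <;> simp <;> omega)
      simp only [Fin.sum_univ_three, e1, e2, e3] at hrec
      rw [if_pos hm]
      simp only [Pi.sub_apply, Pi.add_apply, Pi.one_apply, Pi.single_apply] at hrec
      simp at hrec
      obtain ⟨h1, h2, h3⟩ := hm
      split_ifs at hrec <;> omega

end Exact

end Content

/-! ### No product of two different arrows vanishes -/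

section NonVanishing

variable {k : Type u} [Field k] {V : Type} [AddCommGroup V] {st : Fin 3 → V}
  {p : V → Fin 3 → Fin 3 → k}

theorem single_mem_koszulContent {n : ℕ} {j : V} {w : List (Fin 3)}
    (hw : Pi.single w 1 ∈ koszulLength st p n j) :
    Pi.single w 1 ∈ koszulContent st p (content w) j :=
  ⟨hw.1, fun u hu => Pi.single_eq_of_ne (by rintro rfl; exact hu rfl) _⟩

/-- If the path along `x` and `y` vanishes, then, with `z` the third letter and `N` a multiple of
the order of `st x`, the paths `x ^ N x y z` and `x y z x ^ N` are two elements of the Koszul space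
with the same content, which is too much for a space of dimension one. -/
theorem coordinate_ne_zero (hex : KoszulExact st p) (hp : ∀ v x, p v x x = 0)
    (h0 : st 0 + st 1 + st 2 = 0)
    (hσ : ∃ σ : Fin 3 → V → k, ∀ j x z, p (j + st z) (-x - z) x = σ x j * p j z (-x - z))
    (hrot : ∀ v x y, x ≠ y → p v x y = 0 → p (v + st x) y (-x - y) = 0) {N : ℕ} (hN : 0 < N)
    (hNst : ∀ x, N • st x = 0) (i : V) {x y : Fin 3} (hxy : x ≠ y) : p i x y ≠ 0 := by
  intro h1
  have h2 := hrot i x y hxy h1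
  obtain ⟨z, hz⟩ : ∃ z, z = -x - y := ⟨_, rfl⟩
  have hyz : y ≠ z := by subst hz; clear h1 h2; revert x y; decide
  have hzx : z ≠ x := by subst hz; clear h1 h2; revert x y; decide
  have hx : -y - z = x := by rw [hz]; abel
  have hy : -z - x = y := by rw [hz]; abel
  have hclose : i + st x + st y + st z = i := by
    rw [hz, add_assoc, add_assoc, ← add_assoc (st x), step_add_third h0 hxy, add_zero]
  rw [← hz] at h2
  have h3 := hrot _ _ _ hyz h2
  rw [hx] at h3
  -- Words list the last letter first, so `m1` is about `x ^ N x y z` and `m2` about `x y z x ^ N`.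
  have m1 : Pi.single (z :: y :: (List.replicate (N + 1) x ++ [])) (1 : k) ∈
      koszulLength st p (N + 1 + 0 + 1 + 1) i := by
    refine single_cons_mem (single_cons_mem ?_ ?_) ?_
    · have := single_replicate_append_mem hp (single_nil_mem (p := p) (st := st) i)
        (x := x) (by simp) (N + 1)
      rw [succ_nsmul, hNst, zero_add] at this
      rwa [show i - st z - st y = i + st x by
        rw [sub_sub, sub_eq_iff_eq_add]; nth_rw 1 [← hclose]; abel]
    · intro x' hx' z' hz'
      obtain rfl : x = x' := by simpa [List.replicate_succ] using hx'
      obtain rfl : z = z' := by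
        rw [hz, hz']; abel
      rwa [sub_add_cancel]
    · intro y' hy' z' hz'
      obtain rfl : y = y' := by simpa using hy'
      obtain rfl : x = z' := by
        rw [← hx, hz']; abel
      exact h2
  have m2 : Pi.single (List.replicate N x ++ [z, y, x]) (1 : k) ∈ koszulLength st p (N + 3) i := by
    have := single_replicate_append_mem (st := st) hp (j := i) (x := x) (l := [z, y, x])
      (n := 3) ?_ ?_ N
    · rwa [hNst, add_zero] at this
    · refine single_cons_mem (single_cons_mem (single_cons_mem (single_nil_mem _) ?_) ?_) ?_
      · simp
      · intro x' hx' z' hz'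
        obtain rfl : x = x' := by simpa using hx'
        obtain rfl : z = z' := by
          rw [hz, hz']; abel
        rwa [sub_add_cancel]
      · intro y' hy' z' hz'
        obtain rfl : y = y' := by simpa using hy'
        obtain rfl : x = z' := by
          rw [← hx, hz']; abel
        exact h2
    · intro z' hz' y' hy'
      obtain rfl : z = z' := by simpa using hz'
      obtain rfl : y = y' := by
        rw [← hy, hy']; abel
      exact h3
  have hne : List.replicate N x ++ [z, y, x] ≠ z :: y :: (List.replicate (N + 1) x ++ []) := by
    obtain ⟨M, rfl⟩ := Nat.exists_eq_succ_of_ne_zero hN.ne'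
    rw [List.replicate_succ, List.cons_append]
    intro h
    exact hzx (List.cons.inj h).1.symm
  have hc : content (List.replicate N x ++ [z, y, x]) =
      content (z :: y :: (List.replicate (N + 1) x ++ [])) := by
    rw [List.append_nil, List.replicate_succ]
    simp only [content_append, content_cons]
    rw [show content ([] : List (Fin 3)) = 0 from funext fun _ => rfl]
    abel
  have m1' := single_mem_koszulContent m1
  have m2' := single_mem_koszulContent m2
  rw [hc] at m2'
  have hle : Module.finrank k (koszulContent st p
      (content (z :: y :: (List.replicate (N + 1) x ++ []))) i) ≤ 1 := by
    rw [hex.finrank_eq hp h0 hσ]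
    split_ifs <;> simp
  obtain ⟨f, hf⟩ := finrank_le_one_iff.1 hle
  obtain ⟨c, hc1⟩ := hf ⟨_, m1'⟩
  obtain ⟨d, hd⟩ := hf ⟨_, m2'⟩
  have e1 := congrFun (congrArg Subtype.val hc1) (z :: y :: (List.replicate (N + 1) x ++ []))
  have e2 := congrFun (congrArg Subtype.val hd) (z :: y :: (List.replicate (N + 1) x ++ []))
  have e3 := congrFun (congrArg Subtype.val hd) (List.replicate N x ++ [z, y, x])
  simp only [SetLike.val_smul, Pi.smul_apply, smul_eq_mul, Pi.single_eq_same] at e1 e2 e3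
  rw [Pi.single_eq_of_ne hne.symm] at e2
  rcases mul_eq_zero.1 e2 with h | h
  · rw [h, zero_mul] at e3
    exact zero_ne_one e3
  · rw [h, mul_zero] at e1
    exact zero_ne_one e1

end NonVanishing

namespace IsGradedQuiverAlgebra

variable {k R : Type u} [Field k] [Ring R] [Algebra k R] {V : Type}
    [AddCommGroup V] [Fintype V] [DecidableEq V] {st : Fin 3 → V} {𝒜 : ℕ → Submodule k R}
    {ε : V → R} {a : Fin 3 → V → R} {comp : ℕ → R →+ R}

end IsGradedQuiverAlgebra

/-! ### Comparison of two ideals of relations -/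

namespace PathAlgebra

open McKayVertex

variable {k : Type u} [Field k] {s r : ℕ}

theorem ofPath_toPath (i : McKayVertex s r) {j : McKayVertex s r} (f : i ⟶ j) :
    (ofPath f.toPath : PathAlgebra k (McKayVertex s r)) = arrowElt f.1 i := by
  obtain ⟨x, rfl⟩ := f
  rfl

variable [NeZero s] [NeZero r]

theorem vertexElt_mul_wordElt (w v : McKayVertex s r) (l : List (Fin 3)) :
    (vertexElt w * wordElt v l : PathAlgebra k (McKayVertex s r)) =
      if w = v + disp (step s r) l then wordElt v l else 0 := by
  cases l with
  | nil =>
    rw [wordElt, vertexElt_mul_vertexElt, disp, add_zero]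
    split_ifs with h
    · rw [h]
    · rfl
  | cons x l =>
    rw [wordElt, ← mul_assoc, vertexElt_mul_arrowElt, disp, add_assoc, add_comm (disp _ _)]
    split_ifs <;> simp

theorem wordElt_mul_vertexElt (v w : McKayVertex s r) (l : List (Fin 3)) :
    (wordElt v l * vertexElt w : PathAlgebra k (McKayVertex s r)) =
      if v = w then wordElt v l else 0 := by
  induction l with
  | nil => exact vertexElt_mul_vertexElt v w
  | cons x l ih => rw [wordElt, mul_assoc, ih]; split_ifs <;> simp

omit [NeZero s] [NeZero r] in
theorem disp_perm {l l' : List (Fin 3)} (h : l.Perm l') :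
    disp (step s r) l = disp (step s r) l' := by
  induction h with
  | nil => rfl
  | cons x _ ih => rw [disp, disp, ih]
  | swap x y l => simp only [disp]; abel
  | trans _ _ h1 h2 => rw [h1, h2]

section Ideal

variable {J : Ideal (PathAlgebra k (McKayVertex s r))} [J.IsTwoSided]
  (hself : ∀ x v, (arrowElt x (v + step s r x) * arrowElt x v :
    PathAlgebra k (McKayVertex s r)) ∈ J)
  (hswap : ∀ x y v, x ≠ y → ∃ μ : k, arrowElt y (v + step s r x) * arrowElt x v -
    μ • (arrowElt x (v + step s r y) * arrowElt y v) ∈ J)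

include hswap in
/-- If any two arrows commute up to a scalar modulo `J`, then paths with the same letters are
proportional modulo `J`. -/
theorem exists_sub_smul_mem_of_perm (v : McKayVertex s r) {l l' : List (Fin 3)} (h : l.Perm l') :
    ∃ μ : k, wordElt v l - μ • wordElt v l' ∈ J := by
  induction h with
  | nil => exact ⟨1, by simp⟩
  | cons x h ih =>
    obtain ⟨μ, hμ⟩ := ih
    refine ⟨μ, ?_⟩
    rw [wordElt, wordElt, disp_perm h, ← mul_smul', ← mul_sub]
    exact J.mul_mem_left _ hμ
  | swap x y l =>
    by_cases hxy : x = y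
    · exact ⟨1, by simp [hxy]⟩
    · obtain ⟨μ, hμ⟩ := hswap x y (v + disp (step s r) l) hxy
      refine ⟨μ, ?_⟩
      have := J.mul_mem_right (wordElt v l) hμ
      rw [sub_mul, smul_mul', mul_assoc, mul_assoc] at this
      simpa only [wordElt, disp, add_assoc, add_comm (disp (step s r) l)] using this
  | trans _ _ h1 h2 =>
    obtain ⟨μ, hμ⟩ := h1
    obtain ⟨ν, hν⟩ := h2
    refine ⟨μ * ν, ?_⟩
    have := J.add_mem hμ (Submodule.smul_of_tower_mem J μ hν)
    rwa [smul_sub, smul_smul, sub_add_sub_cancel] at this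

include hself hswap

/-- If moreover the squares of the arrows lie in `J`, then so does every path with a repeated
letter; in particular every path of length at least four. -/
theorem wordElt_mem_of_not_nodup (v : McKayVertex s r) {l : List (Fin 3)} (hl : ¬ l.Nodup) :
    (wordElt v l : PathAlgebra k (McKayVertex s r)) ∈ J := by
  obtain ⟨x, hx⟩ := List.exists_duplicate_iff_not_nodup.2 hl
  obtain ⟨l', hl'⟩ := (List.duplicate_iff_sublist.1 hx).exists_perm_append
  obtain ⟨μ, hμ⟩ := exists_sub_smul_mem_of_perm hswap v hl'
  have h : (wordElt v ([x, x] ++ l') : PathAlgebra k (McKayVertex s r)) ∈ J := by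
    have := J.mul_mem_right (wordElt v l') (hself x (v + disp (step s r) l'))
    rw [mul_assoc] at this
    simpa only [List.cons_append, List.nil_append, wordElt, disp, add_comm (step s r x),
      add_assoc] using this
  have := J.add_mem hμ (Submodule.smul_of_tower_mem J μ h)
  rwa [sub_add_cancel] at this

theorem lengthPart_le {n : ℕ} (hn : 3 < n) {x : PathAlgebra k (McKayVertex s r)}
    (hx : x ∈ lengthPart k _ n) : x ∈ J := by
  induction hx using Submodule.span_induction with
  | mem x h =>
    obtain ⟨v, w, p, hp, rfl⟩ := h
    obtain ⟨l, -, hl, h⟩ := ofPath_eq_wordElt (k := k) p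
    rw [h]
    refine wordElt_mem_of_not_nodup hself hswap v fun hnd => ?_
    have := hnd.length_le_card
    rw [Fintype.card_fin] at this
    omega
  | zero => exact zero_mem _
  | add x y _ _ hx hy => exact add_mem hx hy
  | smul c x _ hx => exact Submodule.smul_of_tower_mem J c hx

theorem sub_sum_component_mem (x : PathAlgebra k (McKayVertex s r)) :
    x - ∑ n ∈ Finset.range 4, component n x ∈ J := by
  induction x using PathAlgebra.induction with
  | h0 => simp [component_zero]
  | hadd x y hx hy =>
    simp only [component_add, Finset.sum_add_distrib]
    have := add_mem hx hy
    rwa [sub_add_sub_comm] at this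
  | hs c p =>
    simp only [component_smul, ← Finset.smul_sum, ← smul_sub]
    refine Submodule.smul_of_tower_mem J c ?_
    simp only [component_ofPath, Finset.sum_ite_eq, Finset.mem_range]
    split_ifs with h
    · rw [sub_self]; exact zero_mem _
    · rw [sub_zero]
      exact lengthPart_le hself hswap (n := p.length) (by omega)
        (Submodule.subset_span ⟨_, _, p, rfl, rfl⟩)

/-- Modulo `J` the paths of a given length between two given vertices span a space of dimension at
most one, and it is generated by a path without repeated letters, if there is one. -/
theorem exists_vertexElt_mul_mul_sub_mem (hst : SeparatesShortWords (step s r)) {n : ℕ}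
    (v w : McKayVertex s r) {l₀ : List (Fin 3)} (hl₀ : (∃ l : List (Fin 3), l.Nodup ∧ l.length = n ∧
      w = v + disp (step s r) l) → l₀.Nodup ∧ l₀.length = n ∧ w = v + disp (step s r) l₀)
    {x : PathAlgebra k (McKayVertex s r)} (hx : x ∈ lengthPart k _ n) :
    ∃ c : k, vertexElt w * x * vertexElt v - c • wordElt v l₀ ∈ J ∧
      (c ≠ 0 → l₀.Nodup) := by
  induction hx using Submodule.span_induction with
  | mem x h =>
    obtain ⟨v', w', p, hp, rfl⟩ := h
    obtain ⟨l, -, hl, h⟩ := ofPath_eq_wordElt (k := k) p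
    rw [h, mul_assoc, wordElt_mul_vertexElt]
    by_cases hv : v' = v
    · subst hv
      rw [if_pos rfl, vertexElt_mul_wordElt]
      by_cases hw : w = v' + disp (step s r) l
      · rw [if_pos hw]
        by_cases hnd : l.Nodup
        · obtain ⟨h1, h2, h3⟩ := hl₀ ⟨l, hnd, hl.trans hp, hw⟩
          have hperm : l.Perm l₀ := by
            rw [List.perm_iff_count]
            have hlen := hnd.length_le_card
            rw [Fintype.card_fin] at hlen
            have e1 := List.nodup_iff_count_le_one.1 hnd 2
            have e2 := List.nodup_iff_count_le_one.1 h1 2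
            rcases hst l l₀ (by omega) hlen (add_left_cancel (hw.symm.trans h3)) with h | h | h
            · exact h
            · omega
            · omega
          obtain ⟨μ, hμ⟩ := exists_sub_smul_mem_of_perm hswap v' hperm
          exact ⟨μ, hμ, fun _ => h1⟩
        · exact ⟨0, by simpa using wordElt_mem_of_not_nodup hself hswap v' hnd, by simp⟩
      · exact ⟨0, by simp [hw]⟩
    · exact ⟨0, by simp [hv]⟩
  | zero => exact ⟨0, by simp⟩
  | add x y _ _ hx hy =>
    obtain ⟨c, hc, hc'⟩ := hx
    obtain ⟨d, hd, hd'⟩ := hy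
    refine ⟨c + d, ?_, fun h => ?_⟩
    · have := add_mem hc hd
      rwa [sub_add_sub_comm, ← add_mul, ← mul_add, ← add_smul] at this
    · by_cases hc0 : c = 0
      · exact hd' (by rintro rfl; exact h (by rw [hc0, add_zero]))
      · exact hc' hc0
  | smul c x _ hx =>
    obtain ⟨d, hd, hd'⟩ := hx
    refine ⟨c * d, ?_, fun h => hd' (right_ne_zero_of_mul h)⟩
    have := Submodule.smul_of_tower_mem J c hd
    rwa [smul_sub, smul_smul, ← smul_mul', ← mul_smul'] at this

/-- An ideal of relations contains no more than `J` if it contains no path without repeated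
letters. -/
theorem le_of_wordElt_notMem (hst : SeparatesShortWords (step s r))
    {I : Ideal (PathAlgebra k (McKayVertex s r))} [I.IsTwoSided] (hI : IsRelationIdeal I)
    (hJI : J ≤ I) (hword : ∀ (v : McKayVertex s r) (l : List (Fin 3)), l.Nodup →
      (wordElt v l : PathAlgebra k (McKayVertex s r)) ∉ I) : I ≤ J := by
  intro x hx
  have h := sub_sum_component_mem hself hswap x
  refine (Submodule.sub_mem_iff_left J (Submodule.sum_mem _ fun n _ => ?_)).1 h
  have hy := hI.component_mem x hx n
  have hyn := component_mem_lengthPart n x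
  generalize component n x = y at hy hyn
  have hsum : y = ∑ w : McKayVertex s r, ∑ v : McKayVertex s r, vertexElt w * y * vertexElt v := by
    have h1 : (∑ v : McKayVertex s r, vertexElt v : PathAlgebra k (McKayVertex s r)) = 1 := rfl
    simp only [← Finset.mul_sum, ← Finset.sum_mul, h1, mul_one, one_mul]
  rw [hsum]
  refine Submodule.sum_mem _ fun w _ => Submodule.sum_mem _ fun v _ => ?_
  obtain ⟨l₀, hl₀⟩ : ∃ l₀ : List (Fin 3), (∃ l : List (Fin 3), l.Nodup ∧ l.length = n ∧
      w = v + disp (step s r) l) → l₀.Nodup ∧ l₀.length = n ∧ w = v + disp (step s r) l₀ := by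
    by_cases h : ∃ l : List (Fin 3), l.Nodup ∧ l.length = n ∧ w = v + disp (step s r) l
    · exact ⟨h.choose, fun _ => h.choose_spec⟩
    · exact ⟨[], fun h' => absurd h' h⟩
  obtain ⟨c, hc, hc'⟩ := exists_vertexElt_mul_mul_sub_mem hself hswap hst v w hl₀ hyn
  by_cases hc0 : c = 0
  · simpa [hc0] using hc
  · exfalso
    have h1 : vertexElt w * y * vertexElt v ∈ I :=
      I.mul_mem_right _ (I.mul_mem_left _ hy)
    have h2 := Submodule.smul_of_tower_mem I c⁻¹ ((Submodule.sub_mem_iff_right I h1).1 (hJI hc))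
    rw [smul_smul, inv_mul_cancel₀ hc0, one_smul] at h2
    exact hword v l₀ (hc' hc0) h2

end Ideal

end PathAlgebra

namespace IsGradedQuiverAlgebra

section

variable {k R : Type u} [Field k] [Ring R] [Algebra k R] {V : Type}
    [AddCommGroup V] [Fintype V] [DecidableEq V] {st : Fin 3 → V} {𝒜 : ℕ → Submodule k R}
    {ε : V → R} {a : Fin 3 → V → R} {comp : ℕ → R →+ R}

/-- A self-injective graded quiver algebra with a resolution as in the definition of a
`(3, q)`-Koszul algebra has a Frobenius structure all of whose coordinates are nonzero. -/
theorem exists_isFrobenius_of_resolution (h : IsGradedQuiverAlgebra st 𝒜 ε a comp)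
    (hinj : Module.Injective R R) (hst : SeparatesShortWords st) (h0 : st 0 + st 1 + st 2 = 0)
    {N : ℕ} (hN : 0 < N) (hNst : ∀ x, N • st x = 0)
    (F : GradedProjectiveResolution 𝒜 (R ⧸ positivePart 𝒜) (degreeZeroGrading _)) {q : ℕ∞}
    (hq : 2 ≤ q)
    (hgen : ∀ t : ℕ, (t : ℕ∞) ≤ q → Submodule.span R (F.gr t t : Set (F.P t)) = ⊤)
    (hker : ∀ t : ℕ, (t : ℕ∞) = q → ∀ x ∈ F.ker t, x ∈ F.gr t (t + 3)) :
    ∃ (U : Fin 3 → V → R) (ω : V → R) (p : V → Fin 3 → Fin 3 → k),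
      IsFrobenius st 𝒜 ε a U ω p ∧ ∀ v x y, x ≠ y → p v x y ≠ 0 := by
  obtain ⟨U, ω, p, hF⟩ := h.exists_isFrobenius hinj hst h0 fun v => by
    rcases h.closed_or_cube hinj hst h0 v with h1 | ⟨x, l, c, hx, hl, hd, hne, heq⟩
    · exact h1
    · exact absurd heq (h.cube_ne_smul F hgen hker hq hst v hne hx hl hd c)
  refine ⟨U, ω, p, hF, fun v x y hxy => ?_⟩
  obtain rfl := h.eq_top_of_resolution hF hst.injective h0 F hgen hker
  have hex : KoszulExact st p :=
    h.koszul_exact hF hst.injective h0 F fun t => hgen t le_top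
  exact coordinate_ne_zero hex hF.p_self h0 (hF.exists_p_eq_mul h h0)
    (fun v x y => hF.p_rotate h0) hN hNst v hxy

omit [Fintype V] [DecidableEq V] in
theorem IsFrobenius.arrow_mul_arrow_mul_arrow_ne {U : Fin 3 → V → R} {ω : V → R}
    {p : V → Fin 3 → Fin 3 → k} (hF : IsFrobenius st 𝒜 ε a U ω p) (h0 : st 0 + st 1 + st 2 = 0)
    (hp : ∀ v x y, x ≠ y → p v x y ≠ 0) {x y z : Fin 3} (hxy : x ≠ y) (hyz : y ≠ z) (hzx : z ≠ x)
    (v : V) : a z (v + st x + st y) * (a y (v + st x) * a x v) ≠ 0 := by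
  have hx : -y - z = x := by revert x y z; decide
  have hclose : v + st x + st y + st z = v := by
    have := step_add_third h0 hyz
    rw [hx] at this
    rw [show v + st x + st y + st z = v + (st y + st z + st x) by abel, this, add_zero]
  have e := hF.arrow_mul_arrow (v + st x) y z
  rw [hx, hclose] at e
  rw [← mul_assoc, e, smul_mul_assoc, hF.U_mul_arrow]
  exact smul_ne_zero (hp _ _ _ hyz) (hF.omega_ne v)

end

end IsGradedQuiverAlgebra

namespace PathAlgebra

open McKayVertex McKayRelations

variable {k : Type u} [Field k] {s r : ℕ} [NeZero s] [NeZero r]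

omit [NeZero s] [NeZero r] in
theorem γ_eq (i : McKayVertex s r) :
    (γ i : PathAlgebra k (McKayVertex s r)) = arrowElt 2 i := ofPath_toPath i _

theorem zγ_eq (i : McKayVertex s r) (c : k) : zγ i c =
    c • (arrowElt 1 (i + step s r 0) * arrowElt 0 i) +
      arrowElt 0 (i + step s r 1) * arrowElt 1 i := rfl

theorem zβ_eq (i : McKayVertex s r) (c : k) : zβ i c =
    c • (arrowElt 0 (i + step s r 2) * arrowElt 2 i) +
      arrowElt 2 (i + step s r 0) * arrowElt 0 i := by
  rw [zβ, γ_eq, γ_eq, sub_eq_add_neg]; rfl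

theorem zα_eq (i : McKayVertex s r) (c : k) : zα i c =
    c • (arrowElt 1 (i + step s r 2) * arrowElt 2 i) +
      arrowElt 2 (i + step s r 1) * arrowElt 1 i := by
  rw [zα, γ_eq, γ_eq, sub_eq_add_neg]; rfl

omit [NeZero s] [NeZero r] in
theorem γ_mul_γ (i : McKayVertex s r) : (γ (i - e s r) * γ i : PathAlgebra k (McKayVertex s r)) =
    arrowElt 2 (i + step s r 2) * arrowElt 2 i := by
  rw [γ_eq, γ_eq, sub_eq_add_neg]; rfl

/-- An ideal of relations whose quotient has a Frobenius structure with nonzero coordinates is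
generated by the commutativity relations and the zero relations. -/
theorem exists_eq_span_relations (hst : SeparatesShortWords (step s r))
    {I : Ideal (PathAlgebra k (McKayVertex s r))} [I.IsTwoSided] (hI : IsRelationIdeal I)
    {U : Fin 3 → McKayVertex s r → PathAlgebra k (McKayVertex s r) ⧸ I}
    {ω : McKayVertex s r → PathAlgebra k (McKayVertex s r) ⧸ I}
    {p : McKayVertex s r → Fin 3 → Fin 3 → k}
    (hF : IsGradedQuiverAlgebra.IsFrobenius (step s r) (quotientGrading I)
      (fun v => Ideal.Quotient.mk I (vertexElt v)) (fun x v => Ideal.Quotient.mk I (arrowElt x v))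
      U ω p)
    (hp : ∀ v x y, x ≠ y → p v x y ≠ 0) :
    ∃ a b c : McKayVertex s r → k, (∀ i, a i ≠ 0 ∧ b i ≠ 0 ∧ c i ≠ 0) ∧
      I = (TwoSidedIdeal.span (relations a b c)).asIdeal := by
  have hsq : ∀ x v, (arrowElt x (v + step s r x) * arrowElt x v :
      PathAlgebra k (McKayVertex s r)) ∈ I := by
    intro x v
    rw [← Ideal.Quotient.eq_zero_iff_mem, map_mul]
    exact (hF.arrow_mul_arrow v x x).trans (by rw [hF.p_self, zero_smul])
  have hcomm : ∀ x y v, x ≠ y → -(p v y x / p v x y) •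
      (arrowElt y (v + step s r x) * arrowElt x v) + arrowElt x (v + step s r y) * arrowElt y v
        ∈ I := by
    intro x y v hxy
    have e1 := hF.arrow_mul_arrow v x y
    have e2 := hF.arrow_mul_arrow v y x
    rw [show -y - x = -x - y by abel, add_right_comm] at e2
    rw [← Ideal.Quotient.eq_zero_iff_mem, map_add, mk_smul, map_mul, map_mul]
    refine (congrArg₂ (fun r r' => -(p v y x / p v x y) • r + r') e1 e2).trans ?_
    rw [smul_smul, neg_mul, div_mul_cancel₀ _ (hp v x y hxy), neg_smul, neg_add_cancel]
  let a : McKayVertex s r → k := fun v => -(p v 1 2 / p v 2 1)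
  let b : McKayVertex s r → k := fun v => -(p v 0 2 / p v 2 0)
  let c : McKayVertex s r → k := fun v => -(p v 1 0 / p v 0 1)
  have hne : ∀ x y v, x ≠ y → -(p v y x / p v x y) ≠ 0 := fun x y v hxy =>
    neg_ne_zero.2 (div_ne_zero (hp v y x hxy.symm) (hp v x y hxy))
  refine ⟨a, b, c, fun i => ⟨hne 2 1 i (by decide), hne 2 0 i (by decide), hne 0 1 i (by decide)⟩,
    ?_⟩
  set J := TwoSidedIdeal.span (relations a b c) with hJ
  have hJI : J.asIdeal ≤ I := by
    intro x hx
    rw [TwoSidedIdeal.mem_asIdeal] at hx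
    have hle : J ≤ I.toTwoSided := by
      rw [hJ, TwoSidedIdeal.span_le]
      rintro x (⟨i, rfl | rfl | rfl⟩ | ⟨i, rfl | rfl | rfl⟩)
      · rw [zα_eq]; exact Ideal.mem_toTwoSided.2 (hcomm 2 1 i (by decide))
      · rw [zβ_eq]; exact Ideal.mem_toTwoSided.2 (hcomm 2 0 i (by decide))
      · rw [zγ_eq]; exact Ideal.mem_toTwoSided.2 (hcomm 0 1 i (by decide))
      · exact Ideal.mem_toTwoSided.2 (hsq 0 i)
      · exact Ideal.mem_toTwoSided.2 (hsq 1 i)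
      · rw [γ_mul_γ]; exact Ideal.mem_toTwoSided.2 (hsq 2 i)
    exact Ideal.mem_toTwoSided.1 (hle hx)
  have hmem : ∀ x ∈ relations a b c, x ∈ J.asIdeal := fun x hx =>
    TwoSidedIdeal.mem_asIdeal.2 (TwoSidedIdeal.subset_span hx)
  refine le_antisymm (le_of_wordElt_notMem ?_ ?_ hst hI hJI ?_) hJI
  · intro x v
    fin_cases x
    · exact hmem _ (Or.inr ⟨v, Or.inl rfl⟩)
    · exact hmem _ (Or.inr ⟨v, Or.inr (Or.inl rfl)⟩)
    · have := hmem _ (Or.inr ⟨v, Or.inr (Or.inr rfl)⟩)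
      rwa [γ_mul_γ] at this
  · have hJcomm : ∀ x y v, x ≠ y → -(p v y x / p v x y) •
        (arrowElt y (v + step s r x) * arrowElt x v) + arrowElt x (v + step s r y) * arrowElt y v
          ∈ J.asIdeal ∨ -(p v x y / p v y x) •
        (arrowElt x (v + step s r y) * arrowElt y v) + arrowElt y (v + step s r x) * arrowElt x v
          ∈ J.asIdeal := by
      intro x y v hxy
      have h1 := hmem (zα v (a v)) (Or.inl ⟨v, Or.inl rfl⟩)
      have h2 := hmem (zβ v (b v)) (Or.inl ⟨v, Or.inr (Or.inl rfl)⟩)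
      have h3 := hmem (zγ v (c v)) (Or.inl ⟨v, Or.inr (Or.inr rfl)⟩)
      rw [zα_eq] at h1
      rw [zβ_eq] at h2
      rw [zγ_eq] at h3
      rcases fin_three_cases hxy with ⟨rfl, rfl, -⟩ | ⟨rfl, rfl, -⟩ | ⟨rfl, rfl, -⟩ |
        ⟨rfl, rfl, -⟩ | ⟨rfl, rfl, -⟩ | ⟨rfl, rfl, -⟩
      · exact Or.inl h3
      · exact Or.inr h3
      · exact Or.inr h2
      · exact Or.inl h2
      · exact Or.inr h1
      · exact Or.inl h1
    intro x y v hxy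
    rcases hJcomm x y v hxy with h | h
    · refine ⟨-(-(p v y x / p v x y))⁻¹, ?_⟩
      have := Submodule.smul_of_tower_mem J.asIdeal (-(p v y x / p v x y))⁻¹ h
      rwa [smul_add, smul_smul, inv_mul_cancel₀ (hne x y v hxy), one_smul, ← sub_neg_eq_add,
        ← neg_smul] at this
    · refine ⟨p v x y / p v y x, ?_⟩
      rwa [neg_smul, add_comm, ← sub_eq_add_neg] at h
  · intro v l hl hmemI
    have hcons : ∀ y l, (wordElt v (y :: l) : PathAlgebra k (McKayVertex s r)) =
        arrowElt y (v + disp (step s r) l) * wordElt v l := fun _ _ => rfl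
    have hone : ∀ x, (wordElt v [x] : PathAlgebra k (McKayVertex s r)) = arrowElt x v := by
      intro x
      rw [hcons, disp, add_zero, wordElt, arrowElt_mul_vertexElt, if_pos rfl]
    by_cases hl2 : l.length < 2
    · obtain ⟨w, q, -, hq, h⟩ := wordElt_eq_ofPath (k := k) v l
      rw [h] at hmemI
      exact ofPath_notMem hI q (by omega) hmemI
    rw [← Ideal.Quotient.eq_zero_iff_mem] at hmemI
    have hl3 := hl.length_le_card
    rw [Fintype.card_fin] at hl3
    match l, hl, hl2, hl3, hmemI with
    | [y, x], hl, _, _, hmemI =>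
      have hxy : x ≠ y := by rintro rfl; simp at hl
      rw [hcons, hone, disp, disp, add_zero, map_mul] at hmemI
      exact smul_ne_zero (hp v x y hxy) (hF.U_ne _ _) ((hF.arrow_mul_arrow v x y).symm.trans hmemI)
    | [z, y, x], hl, _, _, hmemI =>
      have hxy : x ≠ y := by rintro rfl; simp at hl
      have hyz : y ≠ z := by rintro rfl; simp at hl
      have hzx : z ≠ x := by rintro rfl; simp at hl
      rw [hcons, hcons, hone, disp, disp, disp, add_zero, add_comm (step s r y), ← add_assoc,
        map_mul, map_mul] at hmemI
      exact hF.arrow_mul_arrow_mul_arrow_ne (step_sum s r) hp hxy hyz hzx v hmemI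
    | [], _, h, _, _ => simp at h
    | [_], _, h, _, _ => simp at h
    | _ :: _ :: _ :: _ :: _, _, _, h, _ => simp at h; omega

end PathAlgebra

theorem proposition5p3 {k : Type u} [Field k] (s r : ℕ) [NeZero s] [NeZero r]
    (hs : 4 ≤ s) (hr : 4 ≤ r)
    (I : Ideal (PathAlgebra k (McKayVertex s r))) [I.IsTwoSided]
    (hI : PathAlgebra.IsRelationIdeal I)
    (hΛ : IsStableTranslationAlgebra (PathAlgebra.quotientGrading I) 2) :
    ∃ a b c : McKayVertex s r → k,
      (∀ i, a i ≠ 0 ∧ b i ≠ 0 ∧ c i ≠ 0) ∧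
      I = (TwoSidedIdeal.span (McKayRelations.relations a b c)).asIdeal := by
  obtain ⟨hinj, q, hq, h3, F, hgen, hker⟩ := hΛ
  have h := PathAlgebra.isGradedQuiverAlgebra I hI h3
  have hst := separatesShortWords_step hs hr
  have hN : ∀ x, (s * r) • McKayVertex.step s r x = 0 := fun x =>
    Prod.ext (show (s * r) • (McKayVertex.step s r x).1 = 0 by simp)
      (show (s * r) • (McKayVertex.step s r x).2 = 0 by simp)
  obtain ⟨U, ω, p, hF, hp⟩ := h.exists_isFrobenius_of_resolution hinj hst (step_sum s r)
    (Nat.mul_pos (NeZero.pos s) (NeZero.pos r)) hN F hq hgen hker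
  exact PathAlgebra.exists_eq_span_relations hst hI hF hp
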